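/- **Setting.** Let $d\ge 1$, $\mathsf X=\mathbb R^d$ with the Euclidean norm $|\cdot|$, and $\mathsf W=(0,\infty)$. *Marginal algorithm.* Let $\pi$ be a positive, continuously differentiable probability density on $\mathbb R^d$ with $$\lim_{|x|\to\infty}\frac{x}{|x|}\cdot\nabla\log\pi(x)=-\infty,\qquad \limsup_{|x|\to\infty}\frac{x}{|x|}\cdot\frac{\nabla\pi(x)}{|\nabla\pi(x)|}<0,$$ and let $q$ be a symmetric probability density on $\mathbb R^d$ that is bounded away from zero in a neighbourhood of the origin. For $A\subset\mathbb R^d$ write $q(A)=\int_A q(z)\,dz$. *Pseudo-marginal kernel.* Let $Q=\{Q_x\}_{x\in\mathsf X}$ be a Markov kernel from $\mathsf X$ to $\mathsf W$ with $\int u\,Q_x(du)=1$ for all $x$. Put $$\tilde P(x,w;dy,du)=\min\Big\{1,\tfrac{\pi(y)}{\pi(x)}\tfrac uw\Big\}q(y-x)\,dy\,Q_y(du)+\tilde\rho(x,w)\,\delta_{(x,w)}(dy,du),$$ where $\tilde\rho(x,w)=1-\iint\min\{1,\frac{\pi(y)}{\pi(x)}\frac uw\}q(y-x)\,dy\,Q_y(du)$.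 *Drift.* For exponents $\eta,\alpha,\beta$ let $$V(x,w)=c_\pi^{\eta}\,\pi(x)^{-\eta}\,(w^{-\alpha}\vee w^{\beta}),\qquad c_\pi=\sup_{z}\pi(z).$$ The *polynomial drift inequality* with constants $\bar w,M,b\in[1,\infty)$, $\underline w\in(0,1]$, $\delta_V>0$ is $$\tilde PV(x,w)\le\begin{cases}V(x,w)-\delta_V V(x,w)^{\frac{\beta-1}{\beta}},&(x,w)\notin\mathsf C,\\ b,&(x,w)\in\mathsf C,\end{cases}\qquad \mathsf C=\{(x,w):|x|\le M,\ w\in[\underline w,\bar w]\}.$$ For constants $\alpha'>0$, $\beta'>1$ write $m_x=\int (u^{-\alpha'}\vee u^{\beta'})\,Q_x(du)$ and $M_W(r)=\operatorname{ess\,sup}_{|x|\le r}m_x$ (essential suprema are with respect to Lebesgue measure). **Part 1 (non-uniform moment bounds).** If $d=1$, assume in addition that the contours of $\pi$ are comparable: there are constants $B,M_0$ such that $|y|\le B|x|$ whenever $|x|\ge M_0$ and $\pi(y)=\pi(x)$. Fix the following. * Constants $\alpha'>0$, $\beta'>1$, $\xi_w\in(0,\beta'-1)$ and $\xi_\pi\in(0,\beta'-1-\xi_w)$.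 * A function $\hat w:\mathsf X\to[1,\infty)$, bounded on compact sets, with $\hat w(x)\to\infty$ as $|x|\to\infty$. * A non-increasing $\psi:(0,\infty)\to[1,\infty)$ with $\psi(t)\to\infty$ as $t\to0$, such that $g(x)=\psi(\pi(x))$ satisfies $$\sup_{x}\frac{g(x)}{\hat w^{\xi_\pi}(x)}\sup_{z:\,\pi(x+z)<\pi(x)}\Big[\Big(\frac{\pi(x+z)}{\pi(x)}\Big)^{\xi_\pi}\frac{g(x+z)}{g(x)}\Big]<\infty.$$ * Exponents $\eta\in(0,\alpha'\wedge(\beta'-1-\xi_w)\wedge(1-\xi_\pi))$, $\alpha\in(\eta,\alpha']$ and $\beta\in(1+\xi_w-\eta,\beta'-\eta)$ with $\eta\le[(\beta'-\beta)\wedge1]-\xi_\pi$. * A function $c:\mathsf X\to[1,\infty)$, bounded on compact sets, with $\limsup_{|x|\to\infty}c(x)e^{-|x|}<\infty$, and a constant $\xi_c\in(0,[(\beta'-\beta)\wedge\alpha\wedge1]-\eta-\xi_\pi)$ with $\limsup_{|x|\to\infty}\hat w^{\xi_\pi}(x)/c^{\xi_c}(x)=0$. * Bounds $K(b)<\infty$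 for $b>1$, and functions $\varepsilon_b:\mathsf X\to[0,\infty]$ for $b\ge1$ with $\limsup_{|x|\to\infty}\varepsilon_b(x)=0$. Then there are constants $\bar w,M,b\in[1,\infty)$, $\underline w\in(0,1]$ and $\delta_V>0$, depending only on the objects fixed so far, such that the polynomial drift inequality holds for every $Q$ as above that satisfies 1. $\operatorname{ess\,sup}_{x}\ g(x)^{-1}m_x\le1$; 2. $\sup_x M_W(b'(|x|\vee1))/\hat w^{\xi_w}(x)\le K(b')$ for every $b'>1$; 3. for every $b'\ge1$ and every $x$, with $D_x=\{z:\frac1{c(x)}\le\frac{\pi(x+z)}{\pi(x)}\le c(x)\}$, $$M_W(b'|x|)\,\max\Big\{q(D_x),\frac1{c^\eta(x)},\Big(\frac{\hat w(x)}{c(x)}\Big)^{\alpha'}\Big\}\le\varepsilon_{b'}(x).$$ (For a single $Q$, conditions 2 and 3 hold with some $K$ and $\varepsilon$ as above exactly when the supremum in 2 is finite for every $b'>1$ and the left-hand side of 3 tends to $0$ as $|x|\to\infty$ for every $b'\ge1$.) **Part 2 (simple sufficient conditions).** Suppose that for some $\rho>1$ $$\lim_{|x|\to\infty}\frac{x}{|x|^{\rho}}\cdot\nabla\log\pi(x)=-\infty,$$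 and that $q(z)\le\bar q(|z|)$ for some bounded, differentiable, non-increasing $\bar q:[0,\infty)\to[0,\infty)$ with $\int\bar q(|z|)\,dz<\infty$. Let $\alpha'>0$, $\beta'>1$, $C<\infty$, $\rho'\in[0,\rho-1)$, and $$\eta\in(0,\alpha'\wedge(\beta'-1)\wedge1),\qquad\alpha\in(\eta,\alpha'],\qquad\beta\in(1-\eta,\beta'-\eta).$$ Then there are constants $\bar w,M,b\in[1,\infty)$, $\underline w\in(0,1]$ and $\delta_V>0$, depending only on $\pi,q,\rho,\alpha',\beta',C,\rho',\eta,\alpha,\beta$, such that the polynomial drift inequality holds for every $Q$ as above with $$\int (u^{-\alpha'}\vee u^{\beta'})\,Q_x(du)\le C(1\vee|x|)^{\rho'}\quad\text{for all }x.$$ -/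

import Mathlib

open MeasureTheory ProbabilityTheory Filter
open scoped ENNReal NNReal Topology

noncomputable section

namespace PseudoMarginal

/-- The state space `ℝ^d` with its Euclidean norm. -/
abbrev Space (d : ℕ) : Type := EuclideanSpace ℝ (Fin d)

/-- The weight space `(0, ∞)`. -/
abbrev Weight : Type := Set.Ioi (0 : ℝ)

/-- `π` is a positive, continuously differentiable probability density on `ℝ^d` whose tails are
super-exponentially decaying with regular contours. -/
structure SuperExpRegularTarget {d : ℕ} (π : Space d → ℝ) : Prop where
  pos : ∀ x, 0 < π x
  contDiff : ContDiff ℝ 1 π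
  lintegral_eq_one : ∫⁻ x, ENNReal.ofReal (π x) = 1
  super_exp : Tendsto
    (fun x : Space d => inner ℝ (‖x‖⁻¹ • x) (gradient (fun y => Real.log (π y)) x))
    (Bornology.cobounded (Space d)) atBot
  regular_contours : limsup
    (fun x : Space d => inner ℝ (‖x‖⁻¹ • x) (‖gradient π x‖⁻¹ • gradient π x))
    (Bornology.cobounded (Space d)) < 0

/-- `q` is a symmetric probability density on `ℝ^d`, bounded away from zero in some
neighbourhood of the origin. -/
structure SymmetricIncrement {d : ℕ} (q : Space d → ℝ) : Prop where
  measurable : Measurable q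
  nonneg : ∀ z, 0 ≤ q z
  lintegral_eq_one : ∫⁻ z, ENNReal.ofReal (q z) = 1
  symm : ∀ z, q (-z) = q z
  pos_near_zero : ∃ ε > 0, ∃ r > 0, ∀ z, ‖z‖ < r → ε ≤ q z

/-- Level sets of `π` through points `x` far from the origin stay within a fixed multiple of `‖x‖`
from the origin. -/
def ComparableContours {d : ℕ} (π : Space d → ℝ) : Prop :=
  ∃ b M : ℝ, ∀ x y : Space d, M ≤ ‖x‖ → π y = π x → ‖y‖ ≤ b * ‖x‖

/-- The strengthened tail condition: `(x / |x|^ρ) · ∇ log π(x) → -∞` as `|x| → ∞`. -/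
def StrongSuperExp {d : ℕ} (π : Space d → ℝ) (ρ : ℝ) : Prop :=
  Tendsto (fun x : Space d => inner ℝ ((‖x‖ ^ ρ)⁻¹ • x) (gradient (fun y => Real.log (π y)) x))
    (Bornology.cobounded (Space d)) atBot

/-- `q` is dominated by an integrable, bounded, differentiable, non-increasing radial profile. -/
def RadiallyDominated {d : ℕ} (q : Space d → ℝ) : Prop :=
  ∃ qbar : ℝ → ℝ,
    (∀ r, 0 ≤ r → 0 ≤ qbar r) ∧ BddAbove (qbar '' Set.Ici 0) ∧
    DifferentiableOn ℝ qbar (Set.Ici 0) ∧ AntitoneOn qbar (Set.Ici 0) ∧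
    (∫⁻ z : Space d, ENNReal.ofReal (qbar ‖z‖) < ⊤) ∧ ∀ z, q z ≤ qbar ‖z‖

/-- The weight distributions have unit mean (unbiasedness). -/
def UnitMean {d : ℕ} (Q : Kernel (Space d) Weight) : Prop :=
  ∀ x, ∫⁻ u, ENNReal.ofReal (u : ℝ) ∂(Q x) = 1

/-- The law of the proposed pair `(y, u)`: `y = x + z` with `z` of density `q`, and `u ∼ Q_y`. -/
def proposal {d : ℕ} (q : Space d → ℝ) (Q : Kernel (Space d) Weight) (x : Space d) :
    Measure (Space d × Weight) :=
  (volume.withDensity fun y => ENNReal.ofReal (q (y - x))) ⊗ₘ Q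

/-- The acceptance probability `min {1, (π(y) / π(x)) (u / w)}` of a move from `s = (x, w)` to
`t = (y, u)`. -/
def accProb {d : ℕ} (π : Space d → ℝ) (s t : Space d × Weight) : ℝ≥0∞ :=
  ENNReal.ofReal (min 1 (π t.1 / π s.1 * ((t.2 : ℝ) / (s.2 : ℝ))))

/-- The pseudo-marginal random walk Metropolis transition kernel: accept the proposal with
probability `accProb`, and stay put otherwise. -/
def pseudoMarginal {d : ℕ} (π q : Space d → ℝ) (Q : Kernel (Space d) Weight)
    (s : Space d × Weight) : Measure (Space d × Weight) :=
  (proposal q Q s.1).withDensity (accProb π s) +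
    (1 - ∫⁻ t, accProb π s t ∂(proposal q Q s.1)) • Measure.dirac s

/-- The moment `∫ (u^{-a} ∨ u^b) Q_x(du)`. -/
def moment {d : ℕ} (Q : Kernel (Space d) Weight) (a b : ℝ) (x : Space d) : ℝ≥0∞ :=
  ∫⁻ u, ENNReal.ofReal (max ((u : ℝ) ^ (-a)) ((u : ℝ) ^ b)) ∂(Q x)

/-- `M_W(r)`: the (Lebesgue) essential supremum over `|x| ≤ r` of the moments. -/
def localMoment {d : ℕ} (Q : Kernel (Space d) Weight) (a b r : ℝ) : ℝ≥0∞ :=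
  essSup (moment Q a b) (volume.restrict (Metric.closedBall 0 r))

/-- `R_x = {z : π(x+z) / π(x) < 1}`. -/
def rejectRegion {d : ℕ} (π : Space d → ℝ) (x : Space d) : Set (Space d) :=
  {z | π (x + z) / π x < 1}

/-- `D_x = {z : 1 / c(x) ≤ π(x+z) / π(x) ≤ c(x)}`. -/
def annulus {d : ℕ} (π c : Space d → ℝ) (x : Space d) : Set (Space d) :=
  {z | 1 / c x ≤ π (x + z) / π x ∧ π (x + z) / π x ≤ c x}

/-- `q(A) = ∫_A q(z) dz`. -/
def incrementProb {d : ℕ} (q : Space d → ℝ) (A : Set (Space d)) : ℝ≥0∞ :=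
  ∫⁻ z in A, ENNReal.ofReal (q z)

/-- A function `f : ℝ^d → [1, ∞)` that is bounded on compact sets. -/
def LocallyBoundedGeOne {d : ℕ} (f : Space d → ℝ) : Prop :=
  (∀ x, 1 ≤ f x) ∧ ∀ K : Set (Space d), IsCompact K → BddAbove (f '' K)

/-- A non-increasing `ψ : (0, ∞) → [1, ∞)` with `ψ(t) → ∞` as `t → 0`. -/
structure GrowthProfile (ψ : ℝ → ℝ) : Prop where
  one_le : ∀ t, 0 < t → 1 ≤ ψ t
  antitoneOn : AntitoneOn ψ (Set.Ioi 0)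
  tendsto : Tendsto ψ (𝓝[>] 0) atTop

/-- Balance between `g = ψ ∘ π` and `ŵ` over the rejection regions:
`sup_x (g(x) / ŵ(x)^ξ) sup_{z ∈ R_x} (π(x+z)/π(x))^ξ g(x+z)/g(x) < ∞`. -/
def RejectionBalance {d : ℕ} (π : Space d → ℝ) (ψ : ℝ → ℝ) (what : Space d → ℝ) (ξ : ℝ) : Prop :=
  (⨆ x : Space d, ENNReal.ofReal (ψ (π x) / what x ^ ξ) *
    ⨆ z ∈ rejectRegion π x,
      ENNReal.ofReal ((π (x + z) / π x) ^ ξ * (ψ (π (x + z)) / ψ (π x)))) < ⊤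

/-- The quantity `M_W(b|x|) max {q(D_x), c(x)^{-η}, (ŵ(x)/c(x))^{α'}}`, where `M_W` is formed with
the exponents `α'` and `β'`. -/
def tailQuantity {d : ℕ} (π q : Space d → ℝ) (Q : Kernel (Space d) Weight) (what c : Space d → ℝ)
    (α' β' η b : ℝ) (x : Space d) : ℝ≥0∞ :=
  localMoment Q α' β' (b * ‖x‖) *
    max (incrementProb q (annulus π c x))
      (max (ENNReal.ofReal (1 / c x ^ η)) (ENNReal.ofReal ((what x / c x) ^ α')))

/-- The drift function `V(x, w) = c_π^η π(x)^{-η} (w^{-α} ∨ w^β)` with `c_π = sup π`. -/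
def driftFn {d : ℕ} (π : Space d → ℝ) (η α β : ℝ) (s : Space d × Weight) : ℝ :=
  (⨆ z, π z) ^ η * π s.1 ^ (-η) * max ((s.2 : ℝ) ^ (-α)) ((s.2 : ℝ) ^ β)

/-- The set `C = {(x, w) : |x| ≤ M, w ∈ [wlo, whi]}`. -/
def driftSet (d : ℕ) (M wlo whi : ℝ) : Set (Space d × Weight) :=
  {s | ‖s.1‖ ≤ M ∧ wlo ≤ (s.2 : ℝ) ∧ (s.2 : ℝ) ≤ whi}

/-- The polynomial drift inequality for the pseudo-marginal kernel `P` and `V = driftFn π η α β`: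
`P V ≤ V - δ V^{(β-1)/β}` off `C` and `P V ≤ b` on `C`, where `P V(s) = ∫ V dP(s, ·)`. -/
def PolynomialDrift {d : ℕ} (π q : Space d → ℝ) (Q : Kernel (Space d) Weight)
    (η α β M wlo whi b δ : ℝ) : Prop :=
  ∀ s : Space d × Weight,
    (s ∉ driftSet d M wlo whi →
      ∫⁻ t, ENNReal.ofReal (driftFn π η α β t) ∂(pseudoMarginal π q Q s) ≤
        ENNReal.ofReal (driftFn π η α β s - δ * driftFn π η α β s ^ ((β - 1) / β))) ∧
    (s ∈ driftSet d M wlo whi →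
      ∫⁻ t, ENNReal.ofReal (driftFn π η α β t) ∂(pseudoMarginal π q Q s) ≤ ENNReal.ofReal b)

end PseudoMarginal

end

namespace PseudoMarginal

noncomputable section

/-! One step changes V by an accepted part minus (acceptance rate) × V. The drift follows once the
accepted part is at most half of what acceptance removes.

Accepted part: min{1, t} ≤ t^θ for θ in [0, 1], so relative to c_π^η π(x)^(-η) it is at most w^(-θ)
∫ (π(y)/π(x))^(θ-η) m_y q(y-x) dy. The exponent θ may be chosen separately where π rises and where
it falls; this gives `upperGain` and `lowerGain`, combined in `accepted_drift_le`.

Acceptance rate: regular contours provide, from every point, increments of uniformly positive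
probability that do not lower π by more than a fixed factor. Unit mean of the weights then gives
acceptance of order at least 1/w for large w, and the negative moment gives order one for small w.

`exists_polynomialDrift` joins these in three regimes. If w exceeds both a constant and ŵ(x),
acceptance removes order V/w, which dominates V^((β-1)/β) because w^β ≤ V, while the gains
contribute only order w^(β-1-κ). If |x| is large and w ≤ ŵ(x), both gains are small against a
uniform acceptance rate. If |x| is bounded and w is tiny, w^(-α) beats the smaller powers of 1/w in
the accepted part. What is left is the set C.

For the non-uniform moment bounds, superlevel sets of π are comparable to balls: π decreases along
expanding logarithmic spirals (in dimension one, comparable contours are assumed instead). Hence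
every y with π(y) ≥ π(x)/c(x) has |y| ≤ b|x| and moment at most M_W(b|x|). Splitting the gains along
D_x leaves the terms of condition 3 and, for deep drops of π, the rejection balance.

For the simple conditions, both gains are bounded by `levelIntegral`, an integral concentrated near
the level set of π through x. Averaging over dilations y ↦ s y makes it small: along a ray log π
falls with slope at least |y|^ρ, so little time is spent near any level.

Every constant is chosen before the weight laws, which enter only through the bounds they satisfy.
-/

/-! ### Slopes of log π along curves and rays. -/

theorem hasDerivAt_log_density_comp {d : ℕ} {π : Space d → ℝ} (hπ : SuperExpRegularTarget π)
    {γ : ℝ → Space d} {v : Space d} {t : ℝ} (hγ : HasDerivAt γ v t) :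
    HasDerivAt (fun s => Real.log (π (γ s)))
      (inner ℝ v (gradient (fun y => Real.log (π y)) (γ t))) t := by
  have hd : DifferentiableAt ℝ (fun y => Real.log (π y)) (γ t) :=
    ((hπ.contDiff.differentiable one_ne_zero) (γ t)).log (hπ.pos _).ne'
  have h := hd.hasGradientAt.hasFDerivAt.comp_hasDerivAt t hγ
  have e : inner ℝ v (gradient (fun y => Real.log (π y)) (γ t)) =
    (InnerProductSpace.toDual ℝ (Space d)) (gradient (fun y => Real.log (π y)) (γ t)) v := by
    rw [InnerProductSpace.toDual_apply_apply, real_inner_comm]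
  rw [e]
  exact h

/-- A bound on the derivative of `log π` along a curve integrates up. -/
theorem log_density_sub_le {d : ℕ} {π : Space d → ℝ} (hπ : SuperExpRegularTarget π)
    {γ γ' : ℝ → Space d} (hγ : ∀ t, HasDerivAt γ (γ' t) t) {a b C : ℝ} (hab : a ≤ b)
    (hC : ∀ t ∈ Set.Ioo a b,
      inner ℝ (γ' t) (gradient (fun y => Real.log (π y)) (γ t)) ≤ C) :
    Real.log (π (γ b)) - Real.log (π (γ a)) ≤ C * (b - a) := by
  have h : ∀ t, HasDerivAt (fun s => Real.log (π (γ s)))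
      (inner ℝ (γ' t) (gradient (fun y => Real.log (π y)) (γ t))) t :=
    fun t => hasDerivAt_log_density_comp hπ (hγ t)
  have hdiff : Differentiable ℝ (fun s => Real.log (π (γ s))) :=
    fun t => (h t).differentiableAt
  refine Convex.image_sub_le_mul_sub_of_deriv_le (convex_Icc a b) hdiff.continuous.continuousOn
    hdiff.differentiableOn (fun t ht => ?_) a ⟨le_rfl, hab⟩ b ⟨hab, le_rfl⟩ hab
  rw [interior_Icc] at ht
  rw [(h t).deriv]
  exact hC t ht

theorem exists_norm_of_eventually_cobounded {E : Type*} [SeminormedAddCommGroup E] {p : E → Prop}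
    (h : ∀ᶠ x in Bornology.cobounded E, p x) : ∃ R : ℝ, 0 < R ∧ ∀ x, R ≤ ‖x‖ → p x := by
  rw [← comap_norm_atTop, eventually_comap] at h
  obtain ⟨R, hR⟩ := eventually_atTop.1 h
  exact ⟨max R 1, by positivity, fun x hx => hR ‖x‖ (le_trans (le_max_left _ _) hx) x rfl⟩

/-- The radial derivative of `log π` is eventually below any linear function of the norm. -/
theorem SuperExpRegularTarget.inner_gradient_le {d : ℕ} {π : Space d → ℝ}
    (hπ : SuperExpRegularTarget π) (L : ℝ) :
    ∃ R : ℝ, 0 < R ∧ ∀ x, R ≤ ‖x‖ →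
      inner ℝ x (gradient (fun y => Real.log (π y)) x) ≤ -L * ‖x‖ := by
  obtain ⟨R, hR0, hR⟩ := exists_norm_of_eventually_cobounded
    (hπ.super_exp.eventually (eventually_le_atBot (-L)))
  refine ⟨R, hR0, fun x hx => ?_⟩
  have h := hR x hx
  have hx0 : 0 < ‖x‖ := hR0.trans_le hx
  rw [real_inner_smul_left, inv_mul_le_iff₀ hx0] at h
  linarith

/-- The strengthened radial condition in the form used along rays. -/
theorem StrongSuperExp.inner_gradient_le {d : ℕ} {π : Space d → ℝ} {ρ : ℝ}
    (hπ : StrongSuperExp π ρ) (L : ℝ) :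
    ∃ R : ℝ, 0 < R ∧ ∀ x, R ≤ ‖x‖ →
      inner ℝ x (gradient (fun y => Real.log (π y)) x) ≤ -L * ‖x‖ ^ ρ := by
  obtain ⟨R, hR0, hR⟩ := exists_norm_of_eventually_cobounded
    (Tendsto.eventually hπ (eventually_le_atBot (-L)))
  refine ⟨R, hR0, fun x hx => ?_⟩
  have h := hR x hx
  have hx0 : 0 < ‖x‖ ^ ρ := Real.rpow_pos_of_pos (hR0.trans_le hx) _
  rw [real_inner_smul_left, inv_mul_le_iff₀ hx0] at h
  linarith

/-- Far out, the gradient of `log π` makes an angle bounded away from `π / 2` with `-x`. -/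
theorem SuperExpRegularTarget.inner_gradient_le_norm {d : ℕ} {π : Space d → ℝ}
    (hπ : SuperExpRegularTarget π) :
    ∃ ε R : ℝ, 0 < ε ∧ ε ≤ 1 ∧ 0 < R ∧ ∀ x, R ≤ ‖x‖ →
      inner ℝ x (gradient (fun y => Real.log (π y)) x) ≤
        -ε * ‖x‖ * ‖gradient (fun y => Real.log (π y)) x‖ := by
  -- A real limsup carries information only for functions bounded above; Cauchy–Schwarz supplies the
  -- bound.
  have hb : IsBoundedUnder (· ≤ ·) (Bornology.cobounded (Space d))
      (fun x : Space d => inner ℝ (‖x‖⁻¹ • x) (‖gradient π x‖⁻¹ • gradient π x)) := by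
    refine isBoundedUnder_of ⟨1, fun x => ?_⟩
    refine (real_inner_le_norm _ _).trans ?_
    have h1 : ∀ v : Space d, ‖‖v‖⁻¹ • v‖ ≤ 1 := by
      intro v
      rw [norm_smul, norm_inv, norm_norm]
      exact inv_mul_le_one
    exact mul_le_one₀ (h1 _) (norm_nonneg _) (h1 _)
  set l := limsup (fun x : Space d => inner ℝ (‖x‖⁻¹ • x) (‖gradient π x‖⁻¹ • gradient π x))
    (Bornology.cobounded (Space d)) with hl
  have hl0 : l < 0 := hπ.regular_contours
  obtain ⟨R, hR0, hR⟩ := exists_norm_of_eventually_cobounded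
    (eventually_lt_of_limsup_lt (show l < l / 2 by linarith) hb)
  refine ⟨min (-l / 2) 1, R, lt_min (by linarith) one_pos, min_le_right _ _, hR0,
    fun x hx => ?_⟩
  have h := (hR x hx).le
  have hx0 : 0 < ‖x‖ := hR0.trans_le hx
  have hg : gradient (fun y => Real.log (π y)) x = (π x)⁻¹ • gradient π x := by
    have hd : DifferentiableAt ℝ π x := (hπ.contDiff.differentiable one_ne_zero) x
    have h2 := hd.hasGradientAt.hasFDerivAt.log (hπ.pos x).ne'
    refine HasGradientAt.gradient ?_
    rw [hasGradientAt_iff_hasFDerivAt]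
    simpa using h2
  have h3 : inner ℝ x (gradient π x) ≤ (l / 2) * ‖x‖ * ‖gradient π x‖ := by
    rcases (norm_nonneg (gradient π x)).eq_or_lt with h0 | h0
    · rw [← h0, norm_eq_zero.1 h0.symm]; simp
    · rw [real_inner_smul_left, real_inner_smul_right, inv_mul_le_iff₀ hx0,
        inv_mul_le_iff₀ h0] at h
      linarith
  rw [hg, real_inner_smul_right, norm_smul, norm_inv, Real.norm_of_nonneg (hπ.pos x).le]
  have hp := inv_pos.2 (hπ.pos x)
  have h4 : (l / 2) * ‖x‖ * ‖gradient π x‖ ≤ -min (-l / 2) 1 * ‖x‖ * ‖gradient π x‖ := by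
    have := min_le_left (-l / 2) 1
    gcongr
    linarith
  calc (π x)⁻¹ * inner ℝ x (gradient π x)
      ≤ (π x)⁻¹ * (-min (-l / 2) 1 * ‖x‖ * ‖gradient π x‖) := by gcongr; linarith
    _ = _ := by ring

/-- Radial decay: `log π` decreases at least linearly with any slope along rays. -/
theorem SuperExpRegularTarget.log_smul_le {d : ℕ} {π : Space d → ℝ}
    (hπ : SuperExpRegularTarget π) (L : ℝ) :
    ∃ R : ℝ, 0 < R ∧ ∀ (x : Space d) (t : ℝ), R ≤ ‖x‖ → 1 ≤ t →
      Real.log (π (t • x)) - Real.log (π x) ≤ -L * ‖x‖ * (t - 1) := by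
  obtain ⟨R, hR0, hR⟩ := hπ.inner_gradient_le L
  refine ⟨R, hR0, fun x t hx ht => ?_⟩
  have hγ : ∀ s : ℝ, HasDerivAt (fun s : ℝ => s • x) x s := by
    intro s
    simpa using (hasDerivAt_id s).smul_const x
  have h := log_density_sub_le hπ hγ (C := -L * ‖x‖) ht (fun s hs => ?_)
  · simpa using h
  · have hs1 : 0 < s := one_pos.trans hs.1
    have hn : ‖s • x‖ = s * ‖x‖ := by rw [norm_smul, Real.norm_of_nonneg hs1.le]
    have h1 := hR (s • x) (by rw [hn]; nlinarith [hs.1, norm_nonneg x])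
    rw [real_inner_smul_left, hn] at h1
    nlinarith

/-- Each far point lies on a ray through the sphere of radius R, where π is bounded by compactness,
and π decays exponentially along the ray. -/
theorem SuperExpRegularTarget.tendsto_zero {d : ℕ} {π : Space d → ℝ}
    (hπ : SuperExpRegularTarget π) : Tendsto π (Bornology.cobounded (Space d)) (𝓝 0) := by
  obtain ⟨R, hR0, hR⟩ := hπ.log_smul_le 1
  obtain ⟨C, hC⟩ := (isCompact_sphere (0 : Space d) R).bddAbove_image
    (f := π) hπ.contDiff.continuous.continuousOn
  have hle : ∀ᶠ x in Bornology.cobounded (Space d), π x ≤ C * Real.exp (-(‖x‖ - R)) := by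
    have h1 : ∀ᶠ x in Bornology.cobounded (Space d), R ≤ ‖x‖ :=
      tendsto_norm_cobounded_atTop.eventually_ge_atTop R
    filter_upwards [h1] with x hx
    have hx0 : 0 < ‖x‖ := hR0.trans_le hx
    set y : Space d := (R / ‖x‖) • x with hy
    have hyn : ‖y‖ = R := by
      rw [hy, norm_smul, Real.norm_of_nonneg (by positivity)]; field_simp
    have hyx : (‖x‖ / R) • y = x := by
      rw [hy, smul_smul]
      have : ‖x‖ / R * (R / ‖x‖) = 1 := by field_simp
      rw [this, one_smul]
    have h2 := hR y (‖x‖ / R) hyn.ge (by rwa [one_le_div hR0])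
    rw [hyx, hyn] at h2
    have h3 : Real.log (π x) ≤ Real.log (π y) + -(‖x‖ - R) := by
      have : -1 * R * (‖x‖ / R - 1) = -(‖x‖ - R) := by field_simp
      linarith
    have h4 : π x ≤ π y * Real.exp (-(‖x‖ - R)) := by
      rw [← Real.exp_log (hπ.pos x), ← Real.exp_log (hπ.pos y), ← Real.exp_add]
      simpa using h3
    refine h4.trans ?_
    gcongr
    exact hC ⟨y, by simp [hyn], rfl⟩
  refine squeeze_zero' (Eventually.of_forall fun x => (hπ.pos x).le) hle ?_
  have h5 : Tendsto (fun x : Space d => -(‖x‖ - R)) (Bornology.cobounded (Space d)) atBot :=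
    tendsto_neg_atTop_atBot.comp (tendsto_atTop_add_const_right _ (-R)
      tendsto_norm_cobounded_atTop)
  simpa using (Real.tendsto_exp_atBot.comp h5).const_mul C

theorem SuperExpRegularTarget.bddAbove {d : ℕ} {π : Space d → ℝ}
    (hπ : SuperExpRegularTarget π) : BddAbove (Set.range π) := by
  obtain ⟨R, hR0, hR⟩ := exists_norm_of_eventually_cobounded
    (hπ.tendsto_zero.eventually (eventually_le_nhds one_pos))
  obtain ⟨C, hC⟩ := (isCompact_closedBall (0 : Space d) R).bddAbove_image
    (f := π) hπ.contDiff.continuous.continuousOn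
  refine ⟨max C 1, ?_⟩
  rintro _ ⟨x, rfl⟩
  rcases le_total R ‖x‖ with h | h
  · exact (hR x h).trans (le_max_right _ _)
  · exact (hC ⟨x, by simpa using h, rfl⟩).trans (le_max_left _ _)

/-- The target is bounded below on balls. -/
theorem SuperExpRegularTarget.exists_lower {d : ℕ} {π : Space d → ℝ}
    (hπ : SuperExpRegularTarget π) (R : ℝ) : ∃ p > 0, ∀ x, ‖x‖ ≤ R → p ≤ π x := by
  rcases (Metric.closedBall (0 : Space d) R).eq_empty_or_nonempty with h | h
  · refine ⟨1, one_pos, fun x hx => ?_⟩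
    have : x ∈ Metric.closedBall (0 : Space d) R := by simpa using hx
    simp [h] at this
  · obtain ⟨x, -, hx⟩ := (isCompact_closedBall (0 : Space d) R).exists_isMinOn h
      hπ.contDiff.continuous.continuousOn
    exact ⟨π x, hπ.pos x, fun y hy => hx (by simpa using hy)⟩

/-! ### Inward increments. -/

/-- From far out, a set of increments of probability bounded below leads inwards, along which
`log π` gains at least a fixed multiple of its radial slope. -/
theorem exists_inward_increments {d : ℕ} {π q : Space d → ℝ} (hπ : SuperExpRegularTarget π)
    (hq : SymmetricIncrement q) :
    ∃ (t δ R : ℝ) (S : Space d → Set (Space d)), 0 < t ∧ 0 < δ ∧ 0 < R ∧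
      ∀ x, R ≤ ‖x‖ → MeasurableSet (S x) ∧ ENNReal.ofReal δ ≤ incrementProb q (S x) ∧
        ∀ z ∈ S x, ‖z‖ ≤ 1 ∧ ∀ L : ℝ, 0 ≤ L → (∀ y, ‖x‖ - 1 ≤ ‖y‖ →
          inner ℝ y (gradient (fun y => Real.log (π y)) y) ≤ -L * ‖y‖) →
          Real.log (π x) + t * L ≤ Real.log (π (x + z)) := by
  obtain ⟨ε, R, hε, hε1, hR0, hR⟩ := hπ.inner_gradient_le_norm
  obtain ⟨εq, hεq, rq, hrq, hqr⟩ := hq.pos_near_zero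
  set r := min rq 1 with hr
  have hr0 : 0 < r := lt_min hrq one_pos
  have hr1 : r ≤ 1 := min_le_right _ _
  have hrrq : r ≤ rq := min_le_left _ _
  set vol := volume (Metric.ball (0 : Space d) (ε / 8 * r)) with hvol
  have hvol0 : vol ≠ 0 := (Metric.measure_ball_pos _ _ (by positivity)).ne'
  have hvolt : vol ≠ ⊤ := measure_ball_lt_top.ne
  -- The increments form a small ball around the inward step of length r/2. Its radius is a multiple
  -- of ε, so deviations from the radial direction cannot undo the guaranteed radial slope; |x| ≥
  -- 6/ε makes the curvature error negligible.
  refine ⟨r / 8, εq * vol.toReal, max (R + 1) (6 / ε),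
    fun x => Metric.ball (-(r / 2 / ‖x‖) • x) (ε / 8 * r), by positivity,
    mul_pos hεq (ENNReal.toReal_pos hvol0 hvolt), by positivity, fun x hx => ?_⟩
  have hxR : R + 1 ≤ ‖x‖ := (le_max_left _ _).trans hx
  have hxε : 6 / ε ≤ ‖x‖ := (le_max_right _ _).trans hx
  have hx0 : 0 < ‖x‖ := by linarith
  have hx6 : 6 ≤ ‖x‖ * ε := (div_le_iff₀ hε).1 hxε
  have hcen : ‖-(r / 2 / ‖x‖) • x‖ = r / 2 := by
    rw [norm_smul, norm_neg, Real.norm_of_nonneg (by positivity)]; field_simp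
  have hzr : ∀ z ∈ Metric.ball (-(r / 2 / ‖x‖) • x) (ε / 8 * r), ‖z‖ < r := by
    intro z hz
    rw [Metric.mem_ball, dist_eq_norm] at hz
    have := norm_le_norm_add_norm_sub' z (-(r / 2 / ‖x‖) • x)
    rw [hcen] at this
    nlinarith
  refine ⟨measurableSet_ball, ?_, fun z hz => ⟨(hzr z hz).le.trans hr1, fun L hL hgrad => ?_⟩⟩
  · unfold incrementProb
    calc ENNReal.ofReal (εq * vol.toReal)
        = ∫⁻ _ in Metric.ball (-(r / 2 / ‖x‖) • x) (ε / 8 * r), ENNReal.ofReal εq := by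
          rw [setLIntegral_const, ENNReal.ofReal_mul hεq.le, ENNReal.ofReal_toReal hvolt,
            Measure.addHaar_ball_center]
      _ ≤ _ := setLIntegral_mono' measurableSet_ball fun z hz =>
          ENNReal.ofReal_le_ofReal (hqr z ((hzr z hz).trans_le hrrq))
  · have hz1 := (hzr z hz).le.trans hr1
    -- The segment is run from x + z back to x, so an upper bound on the slope becomes a lower bound
    -- on the gain.
    have hγ : ∀ s : ℝ, HasDerivAt (fun s : ℝ => (x + z) - s • z) (-z) s := by
      intro s
      simpa using ((hasDerivAt_id s).smul_const z).const_sub (x + z)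
    have h := log_density_sub_le hπ hγ (C := -(r / 8 * L)) zero_le_one (fun s hs => ?_)
    · simp only [one_smul, add_sub_cancel_right, zero_smul, sub_zero, mul_one] at h
      linarith
    · set y := (x + z) - s • z with hy
      set g := gradient (fun y => Real.log (π y)) y with hg
      have hyx : y = x + (1 - s) • z := by rw [hy]; module
      have hsz : ‖(1 - s) • z‖ ≤ 1 := by
        rw [norm_smul, Real.norm_of_nonneg (by linarith [hs.2])]
        exact mul_le_one₀ (by linarith [hs.1]) (norm_nonneg _) hz1
      have hyn : ‖x‖ - 1 ≤ ‖y‖ := by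
        have := norm_sub_norm_le x (-((1 - s) • z))
        rw [norm_neg, sub_neg_eq_add, ← hyx] at this
        linarith
      have hyg := hR y (by linarith)
      have hyL := hgrad y hyn
      rw [← hg] at hyg hyL
      have hG := norm_nonneg g
      set e := z - (-(r / 2 / ‖x‖) • x) with he
      have hen : ‖e‖ ≤ ε / 8 * r := by
        rw [Metric.mem_ball, dist_eq_norm] at hz
        exact hz.le
      have hze : z = -(r / 2 / ‖x‖) • x + e := by rw [he]; module
      have hxy : x = y - (1 - s) • z := by rw [hyx]; module
      have h1 : inner ℝ x g ≤ inner ℝ y g + ‖g‖ := by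
        rw [hxy, inner_sub_left]
        have := abs_le.1 (abs_real_inner_le_norm ((1 - s) • z) g)
        nlinarith
      have h2 : -(ε / 8 * r) * ‖g‖ ≤ inner ℝ e g := by
        have := abs_le.1 (abs_real_inner_le_norm e g)
        nlinarith
      have h3 : inner ℝ (-z) g = r / 2 / ‖x‖ * inner ℝ x g - inner ℝ e g := by
        rw [hze, inner_neg_left, inner_add_left, real_inner_smul_left]; ring
      rw [h3]
      set N := inner ℝ y g with hN
      -- Half of the radial slope absorbs both errors, replacing x by y and deviating from the axis
      -- by e. The other half yields the gain proportional to L.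
      have h4 : ‖g‖ * (1 + ε / 4 * ‖x‖) ≤ -N / 2 := by
        have : ε * (‖x‖ - 1) * ‖g‖ ≤ -N := by
          have : ε * (‖x‖ - 1) * ‖g‖ ≤ ε * ‖y‖ * ‖g‖ := by gcongr
          linarith
        have h5 : (1 + ε / 4 * ‖x‖) * ‖g‖ ≤ (ε * (‖x‖ - 1)) / 2 * ‖g‖ := by
          gcongr; nlinarith
        linarith
      have h5 : L * ‖x‖ / 2 ≤ -N := by
        have : ‖x‖ / 2 ≤ ‖y‖ := by nlinarith
        nlinarith
      have h6 : r / 2 / ‖x‖ * inner ℝ x g ≤ r / 2 / ‖x‖ * (N + ‖g‖) := by gcongr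
      have h7 : r / 2 / ‖x‖ * (N + ‖g‖) + ε / 8 * r * ‖g‖
          = r / 2 / ‖x‖ * (N + ‖g‖ * (1 + ε / 4 * ‖x‖)) := by field_simp; ring
      have h8 : r / 2 / ‖x‖ * (N + ‖g‖ * (1 + ε / 4 * ‖x‖)) ≤
          r / 2 / ‖x‖ * (-(L * ‖x‖ / 4)) := by
        gcongr; linarith
      have h9 : r / 2 / ‖x‖ * (-(L * ‖x‖ / 4)) = -(r / 8 * L) := by field_simp; ring
      linarith

/-! ### Superlevel sets of π are comparable to balls. -/

theorem exists_unit_orthogonal {d : ℕ} (hd : 2 ≤ d) (u : Space d) :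
    ∃ e : Space d, ‖e‖ = 1 ∧ inner ℝ u e = 0 := by
  have h1 : Module.finrank ℝ (Submodule.span ℝ {u}) ≤ 1 := by
    simpa using finrank_span_le_card (R := ℝ) ({u} : Set (Space d))
  have h2 := Submodule.finrank_add_finrank_orthogonal (Submodule.span ℝ {u})
  rw [finrank_euclideanSpace_fin] at h2
  have h3 : 0 < Module.finrank ℝ (Submodule.span ℝ {u})ᗮ := by omega
  have := Module.finrank_pos_iff.1 h3
  obtain ⟨v, hv⟩ := exists_ne (0 : (Submodule.span ℝ {u})ᗮ)
  have hv0 : (v : Space d) ≠ 0 := by simpa using hv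
  refine ⟨‖(v : Space d)‖⁻¹ • (v : Space d), norm_smul_inv_norm (𝕜 := ℝ) hv0, ?_⟩
  rw [real_inner_smul_right, Submodule.mem_orthogonal_singleton_iff_inner_right.1 v.2, mul_zero]

/-- Polar decomposition of a unit vector with respect to another one. -/
theorem exists_eq_cos_smul_add_sin_smul {d : ℕ} (hd : 2 ≤ d) {u v : Space d} (hu : ‖u‖ = 1)
    (hv : ‖v‖ = 1) : ∃ (e : Space d) (θ : ℝ), ‖e‖ = 1 ∧ inner ℝ u e = 0 ∧ 0 ≤ θ ∧ θ ≤ Real.pi ∧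
      v = Real.cos θ • u + Real.sin θ • e := by
  have hc := InnerProductGeometry.cos_angle u v
  set θ := InnerProductGeometry.angle u v with hθ
  have h0 : 0 ≤ θ := InnerProductGeometry.angle_nonneg _ _
  have h1 : θ ≤ Real.pi := InnerProductGeometry.angle_le_pi _ _
  rw [hu, hv, mul_one, div_one] at hc
  have hn : ‖v - Real.cos θ • u‖ = Real.sin θ := by
    rw [← sq_eq_sq₀ (norm_nonneg _) (Real.sin_nonneg_of_nonneg_of_le_pi h0 h1),
      norm_sub_sq_real, real_inner_smul_right, norm_smul, hu, hv, real_inner_comm, ← hc,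
      mul_one, Real.norm_eq_abs, sq_abs]
    nlinarith [Real.sin_sq_add_cos_sq θ]
  rcases eq_or_ne (Real.sin θ) 0 with hs | hs
  · obtain ⟨e, he, hue⟩ := exists_unit_orthogonal hd u
    refine ⟨e, θ, he, hue, h0, h1, ?_⟩
    rw [hs] at hn
    rw [hs, zero_smul, add_zero, ← sub_eq_zero, ← norm_eq_zero, hn]
  · refine ⟨(Real.sin θ)⁻¹ • (v - Real.cos θ • u), θ, ?_, ?_, h0, h1, ?_⟩
    · rw [norm_smul, hn, norm_inv, Real.norm_of_nonneg
        (Real.sin_nonneg_of_nonneg_of_le_pi h0 h1), inv_mul_cancel₀ hs]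
    · rw [real_inner_smul_right, inner_sub_right, real_inner_smul_right, ← hc,
        real_inner_self_eq_norm_sq, hu]
      ring
    · rw [smul_smul, mul_inv_cancel₀ hs, one_smul]; abel

/-- `log π` decreases along logarithmic spirals that open quickly enough. -/
theorem SuperExpRegularTarget.spiral_le {d : ℕ} {π : Space d → ℝ}
    (hπ : SuperExpRegularTarget π) :
    ∃ κ R : ℝ, 0 < κ ∧ 0 < R ∧ ∀ (x f : Space d) (θ : ℝ), R ≤ ‖x‖ → ‖f‖ = ‖x‖ →
      inner ℝ x f = 0 → 0 ≤ θ →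
      π (Real.exp (κ * θ) • (Real.cos θ • x + Real.sin θ • f)) ≤ π x := by
  obtain ⟨ε, R, hε, hε1, hR0, hR⟩ := hπ.inner_gradient_le_norm
  -- At opening rate 1/ε the radial part of the velocity contributes at most -|γ||∇ log π|, which
  -- cancels the worst case of the tangential part.
  refine ⟨1 / ε, R, by positivity, hR0, fun x f θ hx hf hxf hθ => ?_⟩
  have hnorm : ∀ a b : ℝ, a ^ 2 + b ^ 2 = 1 → ‖a • x + b • f‖ = ‖x‖ := by
    intro a b hab
    rw [← sq_eq_sq₀ (norm_nonneg _) (norm_nonneg _), norm_add_sq_real, norm_smul, norm_smul,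
      real_inner_smul_left, real_inner_smul_right, hxf, hf, mul_pow, mul_pow, Real.norm_eq_abs,
      Real.norm_eq_abs, sq_abs, sq_abs]
    linear_combination ‖x‖ ^ 2 * hab
  have hγ : ∀ s : ℝ, HasDerivAt
      (fun s : ℝ => Real.exp (1 / ε * s) • (Real.cos s • x + Real.sin s • f))
      (Real.exp (1 / ε * s) • ((-Real.sin s) • x + Real.cos s • f) +
        (1 / ε) • (Real.exp (1 / ε * s) • (Real.cos s • x + Real.sin s • f))) s := by
    intro s
    have h1 : HasDerivAt (fun s : ℝ => Real.exp (1 / ε * s)) (Real.exp (1 / ε * s) * (1 / ε)) s := by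
      simpa using ((hasDerivAt_id s).const_mul (1 / ε)).exp
    have h2 := ((Real.hasDerivAt_cos s).smul_const x).add ((Real.hasDerivAt_sin s).smul_const f)
    refine (h1.smul h2).congr_deriv ?_
    simp only [Pi.add_apply]
    module
  have h := log_density_sub_le hπ hγ (C := 0) hθ (fun s hs => ?_)
  · simp only [mul_zero, Real.exp_zero, Real.cos_zero, Real.sin_zero, one_smul, zero_smul,
      add_zero, zero_mul, sub_nonpos] at h
    exact (Real.log_le_log_iff (hπ.pos _) (hπ.pos _)).1 h
  · set γ := Real.exp (1 / ε * s) • (Real.cos s • x + Real.sin s • f) with hγdef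
    have hexp : 1 ≤ Real.exp (1 / ε * s) := Real.one_le_exp (by have := hs.1; positivity)
    have hn1 : ‖γ‖ = Real.exp (1 / ε * s) * ‖x‖ := by
      rw [hγdef, norm_smul, hnorm _ _ (Real.cos_sq_add_sin_sq s),
        Real.norm_of_nonneg (Real.exp_pos _).le]
    have hn2 : ‖Real.exp (1 / ε * s) • ((-Real.sin s) • x + Real.cos s • f)‖ = ‖γ‖ := by
      rw [hn1, norm_smul, hnorm _ _ (by rw [neg_sq]; exact Real.sin_sq_add_cos_sq s),
        Real.norm_of_nonneg (Real.exp_pos _).le]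
    have h1 := hR γ (by rw [hn1]; nlinarith [norm_nonneg x])
    rw [inner_add_left, real_inner_smul_left _ _ (1 / ε)]
    have h2 := real_inner_le_norm (Real.exp (1 / ε * s) • ((-Real.sin s) • x + Real.cos s • f))
      (gradient (fun y => Real.log (π y)) γ)
    rw [hn2] at h2
    have h3 : 1 / ε * inner ℝ γ (gradient (fun y => Real.log (π y)) γ) ≤
        1 / ε * (-ε * ‖γ‖ * ‖gradient (fun y => Real.log (π y)) γ‖) := by gcongr
    have h4 : 1 / ε * (-ε * ‖γ‖ * ‖gradient (fun y => Real.log (π y)) γ‖) =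
      -(‖γ‖ * ‖gradient (fun y => Real.log (π y)) γ‖) := by field_simp
    linarith

/-- Superlevel sets of `π` are comparable to balls. -/
theorem SuperExpRegularTarget.exists_norm_le_of_le {d : ℕ} {π : Space d → ℝ}
    (hπ : SuperExpRegularTarget π) (hd : d = 1 → ComparableContours π) :
    ∃ B : ℝ, 1 < B ∧ ∀ x y : Space d, π x ≤ π y → ‖y‖ ≤ B * max ‖x‖ 1 := by
  -- For bounded x, π(x) is at least some p > 0, and π < p outside a ball, so only large |x| needs
  -- an argument.
  suffices h : ∃ B R : ℝ, ∀ x y : Space d, R ≤ ‖x‖ → π x ≤ π y → ‖y‖ ≤ B * ‖x‖ by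
    obtain ⟨B, R, hB⟩ := h
    obtain ⟨p, hp, hpR⟩ := hπ.exists_lower R
    obtain ⟨R', hR'0, hR'⟩ := exists_norm_of_eventually_cobounded
      (hπ.tendsto_zero.eventually (eventually_lt_nhds hp))
    refine ⟨max (max B R') 2, by simp, fun x y hxy => ?_⟩
    rcases le_total R ‖x‖ with hx | hx
    · refine (hB x y hx hxy).trans ?_
      gcongr
      · exact (le_max_left _ _).trans (le_max_left _ _)
      · exact le_max_left _ _
    · have : ‖y‖ < R' := by
        by_contra hc
        have h1 := hR' y (not_lt.1 hc)
        have h2 := hpR x hx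
        linarith
      calc ‖y‖ ≤ R' * 1 := by linarith
        _ ≤ _ := by
          gcongr
          · exact (le_max_right _ _).trans (le_max_left _ _)
          · exact le_max_right _ _
  rcases lt_or_ge d 2 with hd2 | hd2
  · have h01 : d = 0 ∨ d = 1 := by omega
    rcases h01 with h0 | h1
    · subst h0
      exact ⟨1, 0, fun x y _ _ => by rw [Subsingleton.elim y x, one_mul]⟩
    · obtain ⟨b, M, hbM⟩ := hd h1
      refine ⟨b, max M 1, fun x y hx hxy => ?_⟩
      have hxM := (le_max_left M 1).trans hx
      have hx1 := (le_max_right M 1).trans hx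
      rcases eq_or_ne y 0 with hy | hy
      · have := hbM x x hxM rfl
        rw [hy, norm_zero]
        exact (norm_nonneg _).trans this
      · have hy0 : 0 < ‖y‖ := norm_pos_iff.2 hy
        obtain ⟨R', hR'0, hR'⟩ := exists_norm_of_eventually_cobounded
          (hπ.tendsto_zero.eventually (eventually_lt_nhds (hπ.pos x)))
        have ht : 1 ≤ 1 + R' / ‖y‖ := by
          have : 0 < R' / ‖y‖ := by positivity
          linarith
        have hcont : Continuous (fun t : ℝ => π (t • y)) :=
          hπ.contDiff.continuous.comp (continuous_id.smul continuous_const)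
        have hend : π ((1 + R' / ‖y‖) • y) ≤ π x := by
          refine (hR' _ ?_).le
          rw [norm_smul, Real.norm_of_nonneg (by linarith), add_mul, div_mul_cancel₀ _ hy0.ne']
          linarith
        -- Moving outwards from y, π must come down to the value π(x); that point is on the contour
        -- of x and is no closer to the origin than y.
        obtain ⟨t, ht1, ht2⟩ := intermediate_value_Icc' ht hcont.continuousOn
          (show π x ∈ _ from ⟨hend, by simpa using hxy⟩)
        have h2 := hbM x (t • y) hxM ht2
        rw [norm_smul, Real.norm_of_nonneg (by linarith [ht1.1])] at h2
        nlinarith [ht1.1]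
  · obtain ⟨κ, R, hκ, hR0, hR⟩ := hπ.spiral_le
    obtain ⟨R1, hR1, hlog⟩ := hπ.log_smul_le 1
    -- At most half a turn of the spiral from x reaches the ray of y, at a point p with |p| ≤ e^(κ ·
    -- half turn)|x|. If y were further out than this bound, π would strictly drop from p to y,
    -- contradicting π(y) ≥ π(x) ≥ π(p).
    refine ⟨Real.exp (κ * Real.pi), max R R1, fun x y hx hxy => ?_⟩
    by_contra hlt
    push Not at hlt
    have hxR := (le_max_left R R1).trans hx
    have hxR1 := (le_max_right R R1).trans hx
    have hx0 : 0 < ‖x‖ := hR0.trans_le hxR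
    have hexp : 1 ≤ Real.exp (κ * Real.pi) := Real.one_le_exp (by positivity)
    have hy0 : 0 < ‖y‖ := by nlinarith
    obtain ⟨e, θ, he, hxe, h0, h1, hv⟩ := exists_eq_cos_smul_add_sin_smul hd2
      (norm_smul_inv_norm (𝕜 := ℝ) (norm_pos_iff.1 hx0))
      (norm_smul_inv_norm (𝕜 := ℝ) (norm_pos_iff.1 hy0))
    simp only [RCLike.ofReal_real_eq_id, id] at hv hxe
    have hxe' : inner ℝ x (‖x‖ • e) = 0 := by
      rw [real_inner_smul_left] at hxe
      rw [real_inner_smul_right]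
      rcases mul_eq_zero.1 hxe with h | h
      · simp at h; simp [h]
      · rw [h, mul_zero]
    have h2 := hR x (‖x‖ • e) θ hxR (by rw [norm_smul, he, norm_norm, mul_one]) hxe' h0
    set p := Real.exp (κ * θ) • (Real.cos θ • x + Real.sin θ • ‖x‖ • e) with hp
    have hpy : p = (Real.exp (κ * θ) * ‖x‖ / ‖y‖) • y := by
      have h3 : Real.cos θ • x + Real.sin θ • ‖x‖ • e = ‖x‖ • (‖y‖⁻¹ • y) := by
        rw [hv, smul_add, smul_smul, smul_smul, smul_smul, smul_smul, mul_comm (Real.sin θ)]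
        congr 2
        field_simp
      rw [hp, h3, smul_smul, smul_smul, div_eq_mul_inv]
    have hexpθ : Real.exp (κ * θ) ≤ Real.exp (κ * Real.pi) := by gcongr
    have hexpθ1 : 1 ≤ Real.exp (κ * θ) := Real.one_le_exp (by positivity)
    have hpn : ‖p‖ = Real.exp (κ * θ) * ‖x‖ := by
      rw [hpy, norm_smul, Real.norm_of_nonneg (by positivity)]; field_simp
    have hpx : ‖x‖ ≤ ‖p‖ := by rw [hpn]; nlinarith
    have hpylt : ‖p‖ < ‖y‖ := by rw [hpn]; nlinarith
    have hp0 : 0 < ‖p‖ := hx0.trans_le hpx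
    have hyp : (‖y‖ / ‖p‖) • p = y := by
      rw [hpn, hpy, smul_smul]
      have : ‖y‖ / (Real.exp (κ * θ) * ‖x‖) * (Real.exp (κ * θ) * ‖x‖ / ‖y‖) = 1 := by field_simp
      rw [this, one_smul]
    have hone : 1 < ‖y‖ / ‖p‖ := by rwa [one_lt_div hp0]
    have h4 := hlog p (‖y‖ / ‖p‖) (hxR1.trans hpx) hone.le
    rw [hyp] at h4
    have h5 := Real.log_le_log (hπ.pos _) h2
    have h6 := Real.log_le_log (hπ.pos _) hxy
    nlinarith

/-! ### Integrals against the kernel and the accepted part of the drift. -/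

/-- The part of `∫ (π(y)/π(x))^κ m_y q(y-x) dy` over the points at which `π` is at least `π x`. -/
def upperGain {d : ℕ} (π q : Space d → ℝ) (Q : Kernel (Space d) Weight) (a b κ : ℝ)
    (x : Space d) : ℝ≥0∞ :=
  ∫⁻ y in {y | π x ≤ π y},
    ENNReal.ofReal (q (y - x)) * (ENNReal.ofReal ((π y / π x) ^ κ) * moment Q a b y)

/-- The part of `∫ (π(y)/π(x))^κ m_y q(y-x) dy` over the points at which `π` is below `π x`. -/
def lowerGain {d : ℕ} (π q : Space d → ℝ) (Q : Kernel (Space d) Weight) (a b κ : ℝ)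
    (x : Space d) : ℝ≥0∞ :=
  ∫⁻ y in {y | π y < π x},
    ENNReal.ofReal (q (y - x)) * (ENNReal.ofReal ((π y / π x) ^ κ) * moment Q a b y)

/-- The acceptance rate of the pseudo-marginal kernel. -/
def acceptRate {d : ℕ} (π q : Space d → ℝ) (Q : Kernel (Space d) Weight)
    (s : Space d × Weight) : ℝ≥0∞ :=
  ∫⁻ y, ENNReal.ofReal (q (y - s.1)) * ∫⁻ u, accProb π s (y, u) ∂(Q y)

theorem measurable_weight_coe : Measurable (fun u : Weight => (u : ℝ)) := measurable_subtype_coe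

theorem measurable_moment_integrand (a b : ℝ) :
    Measurable (fun u : Weight => ENNReal.ofReal (max ((u : ℝ) ^ (-a)) ((u : ℝ) ^ b))) :=
  ((measurable_weight_coe.pow_const _).max (measurable_weight_coe.pow_const _)).ennreal_ofReal

theorem measurable_moment {d : ℕ} (Q : Kernel (Space d) Weight) (a b : ℝ) :
    Measurable (moment Q a b) :=
  (measurable_moment_integrand a b).lintegral_kernel

theorem measurable_accProb {d : ℕ} {π : Space d → ℝ} (hπ : Measurable π)
    (s : Space d × Weight) : Measurable (accProb π s) := by
  refine Measurable.ennreal_ofReal (measurable_const.min ?_)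
  exact ((hπ.comp measurable_fst).div_const _).mul
    ((measurable_weight_coe.comp measurable_snd).div_const _)

theorem measurable_driftFn {d : ℕ} {π : Space d → ℝ} (hπ : Measurable π) (η α β : ℝ) :
    Measurable (driftFn π η α β) := by
  refine Measurable.mul (((hπ.comp measurable_fst).pow_const _).const_mul _) ?_
  exact ((measurable_weight_coe.comp measurable_snd).pow_const _).max
    ((measurable_weight_coe.comp measurable_snd).pow_const _)

theorem SymmetricIncrement.measurable_shift {d : ℕ} {q : Space d → ℝ} (hq : SymmetricIncrement q)
    (x : Space d) : Measurable (fun y => ENNReal.ofReal (q (y - x))) :=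
  (hq.measurable.comp (measurable_id.sub_const x)).ennreal_ofReal

theorem lintegral_proposal {d : ℕ} {q : Space d → ℝ} (hq : SymmetricIncrement q)
    (Q : Kernel (Space d) Weight) [IsMarkovKernel Q] (x : Space d)
    {f : Space d × Weight → ℝ≥0∞} (hf : Measurable f) :
    ∫⁻ t, f t ∂(proposal q Q x) =
      ∫⁻ y, ENNReal.ofReal (q (y - x)) * ∫⁻ u, f (y, u) ∂(Q y) := by
  unfold proposal
  rw [Measure.lintegral_compProd hf,
    lintegral_withDensity_eq_lintegral_mul _ (hq.measurable_shift x) hf.lintegral_kernel_prod_right']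
  rfl

theorem lintegral_pseudoMarginal {d : ℕ} {π q : Space d → ℝ} (hπ : Measurable π)
    (hq : SymmetricIncrement q) (Q : Kernel (Space d) Weight) [IsMarkovKernel Q]
    (s : Space d × Weight) {f : Space d × Weight → ℝ≥0∞} (hf : Measurable f) :
    ∫⁻ t, f t ∂(pseudoMarginal π q Q s) =
      (∫⁻ y, ENNReal.ofReal (q (y - s.1)) * ∫⁻ u, accProb π s (y, u) * f (y, u) ∂(Q y)) +
        (1 - acceptRate π q Q s) * f s := by
  unfold pseudoMarginal
  rw [lintegral_add_measure, lintegral_smul_measure, lintegral_dirac' _ hf,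
    lintegral_withDensity_eq_lintegral_mul _ (measurable_accProb hπ s) hf,
    lintegral_proposal hq Q _ ((measurable_accProb hπ s).mul hf),
    lintegral_proposal hq Q _ (measurable_accProb hπ s)]
  rfl

theorem setLIntegral_shift_eq_incrementProb {d : ℕ} {q : Space d → ℝ}
    (S : Set (Space d)) (hS : MeasurableSet S) (x : Space d) :
    ∫⁻ y in {y | y - x ∈ S}, ENNReal.ofReal (q (y - x)) = incrementProb q S := by
  unfold incrementProb
  have hm : MeasurableSet {y | y - x ∈ S} := hS.preimage (measurable_id.sub_const x)
  rw [← lintegral_indicator hm, ← lintegral_indicator hS,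
    ← lintegral_sub_right_eq_self (S.indicator fun z => ENNReal.ofReal (q z)) x]
  rfl

theorem SymmetricIncrement.lintegral_shift {d : ℕ} {q : Space d → ℝ} (hq : SymmetricIncrement q)
    (x : Space d) : ∫⁻ y, ENNReal.ofReal (q (y - x)) = 1 := by
  rw [lintegral_sub_right_eq_self (fun z => ENNReal.ofReal (q z)) x, hq.lintegral_eq_one]

/-- The weighted profile `u^θ (u^{-α} ∨ u^β)` is dominated by `u^{-α'} ∨ u^{β'}`. -/
theorem rpow_mul_max_rpow_le {α β α' β' θ u : ℝ} (hα : 0 < α) (hα' : α ≤ α') (hβ : 0 < β)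
    (hθ : 0 ≤ θ) (hθβ : θ ≤ β' - β) (hu : 0 < u) :
    u ^ θ * max (u ^ (-α)) (u ^ β) ≤ max (u ^ (-α')) (u ^ β') := by
  rcases le_total u 1 with h | h
  · have h1 : u ^ β ≤ u ^ (-α) := Real.rpow_le_rpow_of_exponent_ge hu h (by linarith)
    rw [max_eq_left h1, ← Real.rpow_add hu]
    exact le_max_of_le_left (Real.rpow_le_rpow_of_exponent_ge hu h (by linarith))
  · have h1 : u ^ (-α) ≤ u ^ β := Real.rpow_le_rpow_of_exponent_le h (by linarith)
    rw [max_eq_right h1, ← Real.rpow_add hu]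
    exact le_max_of_le_right (Real.rpow_le_rpow_of_exponent_le h (by linarith))

theorem min_one_le_rpow {θ t : ℝ} (hθ : 0 ≤ θ) (hθ1 : θ ≤ 1) (ht : 0 < t) : min 1 t ≤ t ^ θ := by
  rcases le_total t 1 with h | h
  · refine (min_le_right _ _).trans ?_
    nth_rw 1 [← Real.rpow_one t]
    exact Real.rpow_le_rpow_of_exponent_ge ht h hθ1
  · exact (min_le_left _ _).trans (Real.one_le_rpow h hθ)

/-- Replacing min{1, t} by t^θ separates the variables: w keeps w^(-θ), the factor u^θ is absorbed
by the spare moment β' - β, and the density ratio has exponent θ - η. A negative exponent suits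
points where π rises, a positive one points where it falls. -/
theorem accProb_mul_driftFn_le {d : ℕ} {π : Space d → ℝ} (hπ : SuperExpRegularTarget π)
    {η α β α' β' θ : ℝ} (hα : 0 < α) (hα' : α ≤ α') (hβ : 0 < β)
    (hθ : 0 ≤ θ) (hθ1 : θ ≤ 1) (hθβ : θ ≤ β' - β) (x y : Space d) (w u : Weight) :
    accProb π (x, w) (y, u) * ENNReal.ofReal (driftFn π η α β (y, u)) ≤
      ENNReal.ofReal ((⨆ z, π z) ^ η * π x ^ (-η) * (w : ℝ) ^ (-θ)) *
        (ENNReal.ofReal ((π y / π x) ^ (θ - η)) *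
          ENNReal.ofReal (max ((u : ℝ) ^ (-α')) ((u : ℝ) ^ β'))) := by
  have hw : 0 < (w : ℝ) := w.2
  have hu : 0 < (u : ℝ) := u.2
  have hx := hπ.pos x
  have hy := hπ.pos y
  have hr : 0 < π y / π x := div_pos hy hx
  have hc : 0 ≤ (⨆ z, π z) ^ η := Real.rpow_nonneg (Real.iSup_nonneg fun z => (hπ.pos z).le) _
  have hxη : 0 < π x ^ (-η) := Real.rpow_pos_of_pos hx _
  have hwθ : 0 < (w : ℝ) ^ (-θ) := Real.rpow_pos_of_pos hw _
  have hrθ : 0 < (π y / π x) ^ (θ - η) := Real.rpow_pos_of_pos hr _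
  unfold accProb driftFn
  simp only
  rw [← ENNReal.ofReal_mul (le_min zero_le_one (by positivity)),
    ← ENNReal.ofReal_mul hrθ.le, ← ENNReal.ofReal_mul (by positivity)]
  refine ENNReal.ofReal_le_ofReal ?_
  have h1 := min_one_le_rpow hθ hθ1 (show 0 < π y / π x * ((u : ℝ) / w) by positivity)
  have h2 := rpow_mul_max_rpow_le hα hα' hβ hθ hθβ hu
  have hy2 : π y ^ (-η) = (π y / π x) ^ (-η) * π x ^ (-η) := by
    rw [← Real.mul_rpow hr.le hx.le, div_mul_cancel₀ _ hx.ne']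
  have hm : 0 ≤ max ((u : ℝ) ^ (-α)) ((u : ℝ) ^ β) := le_max_of_le_left (by positivity)
  calc min 1 (π y / π x * ((u : ℝ) / w)) *
        ((⨆ z, π z) ^ η * π y ^ (-η) * max ((u : ℝ) ^ (-α)) ((u : ℝ) ^ β))
      ≤ (π y / π x * ((u : ℝ) / w)) ^ θ *
        ((⨆ z, π z) ^ η * π y ^ (-η) * max ((u : ℝ) ^ (-α)) ((u : ℝ) ^ β)) := by gcongr
    _ = (⨆ z, π z) ^ η * π x ^ (-η) * (w : ℝ) ^ (-θ) * ((π y / π x) ^ (θ - η) *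
        ((u : ℝ) ^ θ * max ((u : ℝ) ^ (-α)) ((u : ℝ) ^ β))) := by
      rw [Real.mul_rpow hr.le (by positivity), Real.div_rpow hu.le hw.le, hy2, sub_eq_add_neg,
        Real.rpow_add hr, Real.rpow_neg hw.le θ]
      field_simp
    _ ≤ _ := by gcongr

theorem lintegral_accProb_mul_driftFn_le {d : ℕ} {π : Space d → ℝ}
    (hπ : SuperExpRegularTarget π) (Q : Kernel (Space d) Weight)
    {η α β α' β' θ : ℝ} (hα : 0 < α) (hα' : α ≤ α') (hβ : 0 < β)
    (hθ : 0 ≤ θ) (hθ1 : θ ≤ 1) (hθβ : θ ≤ β' - β) (x y : Space d) (w : Weight) :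
    ∫⁻ u, accProb π (x, w) (y, u) * ENNReal.ofReal (driftFn π η α β (y, u)) ∂(Q y) ≤
      ENNReal.ofReal ((⨆ z, π z) ^ η * π x ^ (-η) * (w : ℝ) ^ (-θ)) *
        (ENNReal.ofReal ((π y / π x) ^ (θ - η)) * moment Q α' β' y) := by
  unfold moment
  rw [← lintegral_const_mul _ (measurable_moment_integrand _ _), ← lintegral_const_mul]
  · exact lintegral_mono fun u => accProb_mul_driftFn_le hπ hα hα' hβ hθ hθ1 hθβ x y w u
  · exact (measurable_moment_integrand _ _).const_mul _

/-- The accepted part of the drift is controlled by the two gains, with separate exponents. -/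
theorem accepted_drift_le {d : ℕ} {π q : Space d → ℝ}
    (hπ : SuperExpRegularTarget π) (hq : SymmetricIncrement q) (Q : Kernel (Space d) Weight)
    {η α β α' β' θ₁ θ₂ : ℝ} (hα : 0 < α) (hα' : α ≤ α') (hβ : 0 < β)
    (h₁ : 0 ≤ θ₁) (h₁1 : θ₁ ≤ 1) (h₁β : θ₁ ≤ β' - β)
    (h₂ : 0 ≤ θ₂) (h₂1 : θ₂ ≤ 1) (h₂β : θ₂ ≤ β' - β) (x : Space d) (w : Weight)
    {X₁ X₂ : ℝ} (hX₁ : 0 ≤ X₁) (hX₂ : 0 ≤ X₂)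
    (hu : upperGain π q Q α' β' (θ₁ - η) x ≤ ENNReal.ofReal X₁)
    (hl : lowerGain π q Q α' β' (θ₂ - η) x ≤ ENNReal.ofReal X₂) :
    ∫⁻ y, ENNReal.ofReal (q (y - x)) *
        ∫⁻ u, accProb π (x, w) (y, u) * ENNReal.ofReal (driftFn π η α β (y, u)) ∂(Q y) ≤
      ENNReal.ofReal ((⨆ z, π z) ^ η * π x ^ (-η) *
        ((w : ℝ) ^ (-θ₁) * X₁ + (w : ℝ) ^ (-θ₂) * X₂)) := by
  have hw : 0 < (w : ℝ) := w.2
  have hm : Measurable π := hπ.contDiff.continuous.measurable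
  have hS : MeasurableSet {y | π x ≤ π y} := measurableSet_le measurable_const hm
  have hc : 0 ≤ (⨆ z, π z) ^ η * π x ^ (-η) :=
    mul_nonneg (Real.rpow_nonneg (Real.iSup_nonneg fun z => (hπ.pos z).le) _)
      (Real.rpow_nonneg (hπ.pos x).le _)
  have hcompl : {y | π x ≤ π y}ᶜ = {y | π y < π x} := by ext; simp
  have hmeas : ∀ κ : ℝ, Measurable fun y =>
      ENNReal.ofReal (q (y - x)) * (ENNReal.ofReal ((π y / π x) ^ κ) * moment Q α' β' y) :=
    fun κ => (hq.measurable_shift x).mul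
      ((((hm.div_const _).pow_const _).ennreal_ofReal).mul (measurable_moment Q _ _))
  have key : ∀ θ : ℝ, 0 ≤ θ → θ ≤ 1 → θ ≤ β' - β → ∀ S : Set (Space d),
      ∫⁻ y in S, ENNReal.ofReal (q (y - x)) *
        ∫⁻ u, accProb π (x, w) (y, u) * ENNReal.ofReal (driftFn π η α β (y, u)) ∂(Q y) ≤
      ENNReal.ofReal ((⨆ z, π z) ^ η * π x ^ (-η) * (w : ℝ) ^ (-θ)) *
        ∫⁻ y in S, ENNReal.ofReal (q (y - x)) *
          (ENNReal.ofReal ((π y / π x) ^ (θ - η)) * moment Q α' β' y) := by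
    intro θ h0 h1 hβ' S
    rw [← lintegral_const_mul _ (hmeas _)]
    refine lintegral_mono fun y => ?_
    rw [mul_left_comm]
    gcongr
    exact lintegral_accProb_mul_driftFn_le hπ Q hα hα' hβ h0 h1 hβ' x y w
  rw [← lintegral_add_compl _ hS, hcompl, mul_add,
    ENNReal.ofReal_add (by positivity) (by positivity), ← mul_assoc, ← mul_assoc,
    ENNReal.ofReal_mul (q := X₁) (by positivity), ENNReal.ofReal_mul (q := X₂) (by positivity)]
  refine add_le_add ?_ ?_
  · exact (key θ₁ h₁ h₁1 h₁β _).trans (by gcongr; exact hu)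
  · exact (key θ₂ h₂ h₂1 h₂β _).trans (by gcongr; exact hl)

/-- A bound on the accepted part and a lower bound on the acceptance rate give a drift bound. -/
theorem lintegral_driftFn_le {d : ℕ} {π q : Space d → ℝ} (hπ : SuperExpRegularTarget π)
    (hq : SymmetricIncrement q) (Q : Kernel (Space d) Weight) [IsMarkovKernel Q]
    {η α β : ℝ} (s : Space d × Weight) {E a : ℝ} (hE0 : 0 ≤ E) (ha0 : 0 ≤ a) (ha1 : a ≤ 1)
    (hE : ∫⁻ y, ENNReal.ofReal (q (y - s.1)) *
        ∫⁻ u, accProb π s (y, u) * ENNReal.ofReal (driftFn π η α β (y, u)) ∂(Q y) ≤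
      ENNReal.ofReal E)
    (ha : ENNReal.ofReal a ≤ acceptRate π q Q s) (hV : 0 ≤ driftFn π η α β s) :
    ∫⁻ t, ENNReal.ofReal (driftFn π η α β t) ∂(pseudoMarginal π q Q s) ≤
      ENNReal.ofReal (E + (1 - a) * driftFn π η α β s) := by
  have hm : Measurable π := hπ.contDiff.continuous.measurable
  rw [lintegral_pseudoMarginal hm hq Q s (measurable_driftFn hm η α β).ennreal_ofReal,
    ENNReal.ofReal_add hE0 (mul_nonneg (by linarith) hV), ENNReal.ofReal_mul (by linarith),
    ENNReal.ofReal_sub _ ha0, ENNReal.ofReal_one]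
  gcongr

/-! ### Lower bounds on the acceptance rate. -/

/-- Markov's inequality for u^(-α'): a proposal with r u ≥ w is accepted surely, and otherwise (w/(r
u))^α' ≥ 1. The additive form avoids subtraction of extended reals. -/
theorem one_le_lintegral_accProb_add {d : ℕ} {π : Space d → ℝ}
    (hπ : SuperExpRegularTarget π) (Q : Kernel (Space d) Weight) [IsMarkovKernel Q]
    {α' β' r : ℝ} (hα' : 0 < α') (hr : 0 < r) (x y : Space d) (w : Weight)
    (hxy : r * π x ≤ π y) :
    1 ≤ ∫⁻ u, accProb π (x, w) (y, u) ∂(Q y) +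
      ENNReal.ofReal (((w : ℝ) / r) ^ α') * moment Q α' β' y := by
  have hw : 0 < (w : ℝ) := w.2
  have hx := hπ.pos x
  have hm : Measurable π := hπ.contDiff.continuous.measurable
  unfold moment
  rw [← lintegral_const_mul _ (measurable_moment_integrand _ _),
    ← lintegral_add_right _ ((measurable_moment_integrand _ _).const_mul _)]
  calc (1 : ℝ≥0∞) = ∫⁻ _, 1 ∂(Q y) := by simp
    _ ≤ _ := lintegral_mono fun u => ?_
  have hu : 0 < (u : ℝ) := u.2
  rcases le_total (w : ℝ) (r * u) with h | h
  · have h1 : 1 ≤ π y / π x * ((u : ℝ) / w) := by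
      have h2 : r ≤ π y / π x := by rwa [le_div_iff₀ hx]
      calc 1 ≤ r * ((u : ℝ) / w) := by rwa [← mul_div_assoc, one_le_div hw]
        _ ≤ _ := by gcongr
    have h2 : accProb π (x, w) (y, u) = 1 := by
      unfold accProb
      simp only
      rw [min_eq_left h1, ENNReal.ofReal_one]
    rw [h2]
    exact le_self_add
  · refine le_add_left ?_
    rw [← ENNReal.ofReal_mul (by positivity), ← ENNReal.ofReal_one]
    refine ENNReal.ofReal_le_ofReal ?_
    calc (1 : ℝ) ≤ ((w : ℝ) / r / u) ^ α' := by
          refine Real.one_le_rpow ?_ hα'.le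
          rw [one_le_div hu, le_div_iff₀ hr, mul_comm]
          exact h
      _ = ((w : ℝ) / r) ^ α' * (u : ℝ) ^ (-α') := by
          rw [Real.div_rpow (by positivity) hu.le, Real.rpow_neg hu.le]; rfl
      _ ≤ _ := by gcongr; exact le_max_left _ _

/-- The unit mean of u is split at w. Below w the acceptance probability is at least r u/w; above w,
u ≤ w^(1-β') u^β'. When the moment term is at most 1/2, acceptance is of order 1/w. -/
theorem one_le_mul_lintegral_accProb_add {d : ℕ} {π : Space d → ℝ}
    (hπ : SuperExpRegularTarget π) (Q : Kernel (Space d) Weight) [IsMarkovKernel Q]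
    (hQ : UnitMean Q)
    {α' β' r : ℝ} (hβ' : 1 < β') (hr : 0 < r) (hr1 : r ≤ 1) (x y : Space d) (w : Weight)
    (hxy : r * π x ≤ π y) :
    1 ≤ ENNReal.ofReal ((w : ℝ) / r) * ∫⁻ u, accProb π (x, w) (y, u) ∂(Q y) +
      ENNReal.ofReal ((w : ℝ) ^ (1 - β')) * moment Q α' β' y := by
  have hw : 0 < (w : ℝ) := w.2
  have hx := hπ.pos x
  have hm : Measurable π := hπ.contDiff.continuous.measurable
  have hacc : Measurable fun u => accProb π (x, w) (y, u) :=
    (measurable_accProb hm (x, w)).comp measurable_prodMk_left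
  unfold moment
  rw [← lintegral_const_mul _ (measurable_moment_integrand _ _), ← lintegral_const_mul _ hacc,
    ← lintegral_add_right _ ((measurable_moment_integrand _ _).const_mul _), ← hQ y]
  refine lintegral_mono fun u => ?_
  have hu : 0 < (u : ℝ) := u.2
  rcases le_total (u : ℝ) w with h | h
  · refine le_add_right ?_
    unfold accProb
    simp only
    rw [← ENNReal.ofReal_mul (by positivity)]
    refine ENNReal.ofReal_le_ofReal ?_
    have h2 : r ≤ π y / π x := by rwa [le_div_iff₀ hx]
    have h3 : r * ((u : ℝ) / w) ≤ min 1 (π y / π x * ((u : ℝ) / w)) := by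
      refine le_min ?_ (by gcongr)
      have : (u : ℝ) / w ≤ 1 := by rwa [div_le_one hw]
      nlinarith [div_pos hu hw]
    calc (u : ℝ) = (w : ℝ) / r * (r * ((u : ℝ) / w)) := by field_simp
      _ ≤ _ := by gcongr
  · refine le_add_left ?_
    rw [← ENNReal.ofReal_mul (by positivity)]
    refine ENNReal.ofReal_le_ofReal ?_
    calc (u : ℝ) = (u : ℝ) ^ (1 - β') * (u : ℝ) ^ β' := by
          rw [← Real.rpow_add hu]; simp
      _ ≤ (w : ℝ) ^ (1 - β') * (u : ℝ) ^ β' := by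
          gcongr ?_ * _
          exact Real.rpow_le_rpow_of_nonpos hw h (by linarith)
      _ ≤ _ := by gcongr; exact le_max_right _ _

/-- Acceptance rates are bounded below through a set of increments. -/
theorem le_acceptRate {d : ℕ} {π q : Space d → ℝ} (Q : Kernel (Space d) Weight)
    {x : Space d} {w : Weight} {S : Set (Space d)} (hS : MeasurableSet S) (hq : SymmetricIncrement q)
    {δ k : ℝ} (hk : 0 ≤ k) (hδ : ENNReal.ofReal δ ≤ incrementProb q S)
    (h : ∀ᵐ y, y - x ∈ S → ENNReal.ofReal k ≤ ∫⁻ u, accProb π (x, w) (y, u) ∂(Q y)) :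
    ENNReal.ofReal (k * δ) ≤ acceptRate π q Q (x, w) := by
  have hm : MeasurableSet {y | y - x ∈ S} := hS.preimage (measurable_id.sub_const x)
  calc ENNReal.ofReal (k * δ) ≤ ENNReal.ofReal k * incrementProb q S := by
        rw [ENNReal.ofReal_mul hk]; gcongr
    _ = ∫⁻ y in {y | y - x ∈ S}, ENNReal.ofReal k * ENNReal.ofReal (q (y - x)) := by
        rw [lintegral_const_mul _ (hq.measurable_shift x),
          setLIntegral_shift_eq_incrementProb S hS x]
    _ ≤ ∫⁻ y in {y | y - x ∈ S}, ENNReal.ofReal (q (y - x)) *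
          ∫⁻ u, accProb π (x, w) (y, u) ∂(Q y) := by
        refine lintegral_mono_ae ?_
        rw [ae_restrict_iff' hm]
        filter_upwards [h] with y hy hyS
        rw [mul_comm]
        gcongr
        exact hy hyS
    _ ≤ _ := setLIntegral_le_lintegral _ _

/-- From every point, increments of uniformly positive probability keep `π` from dropping by more
than a fixed factor. -/
theorem exists_increments_ge {d : ℕ} {π q : Space d → ℝ} (hπ : SuperExpRegularTarget π)
    (hq : SymmetricIncrement q) :
    ∃ (r δ : ℝ) (S : Space d → Set (Space d)), 0 < r ∧ r ≤ 1 ∧ 0 < δ ∧ δ ≤ 1 ∧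
      ∀ x, MeasurableSet (S x) ∧ ENNReal.ofReal δ ≤ incrementProb q (S x) ∧
        ∀ z ∈ S x, ‖z‖ ≤ 1 ∧ r * π x ≤ π (x + z) := by
  obtain ⟨t, δ, R, S, ht, hδ, hR, hS⟩ := exists_inward_increments hπ hq
  obtain ⟨R', hR'0, hR'⟩ := hπ.inner_gradient_le 0
  obtain ⟨ε, hε, r, hr, hqr⟩ := hq.pos_near_zero
  set R₀ := max R (R' + 1)
  obtain ⟨p, hp, hpR⟩ := hπ.exists_lower (R₀ + 1)
  obtain ⟨c, hc⟩ := hπ.bddAbove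
  have hc0 : 0 < c := (hπ.pos 0).trans_le (hc ⟨0, rfl⟩)
  set vol := volume (Metric.ball (0 : Space d) (min r 1)) with hvol
  have hvol0 : vol ≠ 0 := (Metric.measure_ball_pos _ _ (by positivity)).ne'
  have hvolt : vol ≠ ⊤ := measure_ball_lt_top.ne
  have hv : 0 < ε * vol.toReal := mul_pos hε (ENNReal.toReal_pos hvol0 hvolt)
  classical
  -- Far out the inward increments do not decrease π at all. On the remaining ball small increments
  -- suffice, since there π ranges between p > 0 and its global bound c.
  refine ⟨min 1 (p / c), min 1 (min δ (ε * vol.toReal)),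
    fun x => if R₀ ≤ ‖x‖ then S x else Metric.ball 0 (min r 1), by positivity, min_le_left _ _,
    by positivity, min_le_left _ _, fun x => ?_⟩
  have hx := hπ.pos x
  rcases le_or_gt R₀ ‖x‖ with h | h
  · simp only [if_pos h]
    obtain ⟨h1, h2, h3⟩ := hS x ((le_max_left _ _).trans h)
    refine ⟨h1, le_trans (ENNReal.ofReal_le_ofReal ((min_le_right _ _).trans (min_le_left _ _))) h2,
      fun z hz => ⟨(h3 z hz).1, ?_⟩⟩
    have h4 := (h3 z hz).2 0 le_rfl fun y hy => by
      have h5 : R' + 1 ≤ ‖x‖ := (le_max_right _ _).trans h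
      exact hR' y (by linarith)
    rw [mul_zero, add_zero, Real.log_le_log_iff hx (hπ.pos _)] at h4
    have := min_le_left 1 (p / c)
    nlinarith
  · simp only [if_neg h.not_ge]
    refine ⟨measurableSet_ball, ?_, fun z hz => ?_⟩
    · refine le_trans (ENNReal.ofReal_le_ofReal ((min_le_right _ _).trans (min_le_right _ _))) ?_
      unfold incrementProb
      calc ENNReal.ofReal (ε * vol.toReal)
          = ∫⁻ _ in Metric.ball (0 : Space d) (min r 1), ENNReal.ofReal ε := by
            rw [setLIntegral_const, ENNReal.ofReal_mul hε.le, ENNReal.ofReal_toReal hvolt]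
        _ ≤ _ := setLIntegral_mono' measurableSet_ball fun z hz =>
            ENNReal.ofReal_le_ofReal (hqr z (by
              rw [mem_ball_zero_iff] at hz
              exact hz.trans_le (min_le_left _ _)))
    · rw [mem_ball_zero_iff] at hz
      have hz1 : ‖z‖ ≤ 1 := hz.le.trans (min_le_right _ _)
      refine ⟨hz1, ?_⟩
      have h1 : p ≤ π (x + z) := hpR _ ((norm_add_le _ _).trans (by linarith))
      have h2 : π x ≤ c := hc ⟨x, rfl⟩
      calc min 1 (p / c) * π x ≤ p / c * c := by gcongr; exact min_le_right _ _
        _ = p := by field_simp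
        _ ≤ _ := h1

/-! ### The uniform drift criterion. -/

theorem one_le_max_rpow {α β w : ℝ} (hα : 0 < α) (hβ : 0 < β) (hw : 0 < w) :
    1 ≤ max (w ^ (-α)) (w ^ β) := by
  rcases le_total w 1 with h | h
  · exact le_max_of_le_left (Real.one_le_rpow_of_pos_of_le_one_of_nonpos hw h (by linarith))
  · exact le_max_of_le_right (Real.one_le_rpow h hβ.le)

theorem rpow_neg_le_max_rpow {α β θ w : ℝ} (hα : 0 < α) (hβ : 0 < β) (hθ : 0 ≤ θ) (hθα : θ ≤ α)
    (hw : 0 < w) : w ^ (-θ) ≤ max (w ^ (-α)) (w ^ β) := by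
  rcases le_total w 1 with h | h
  · exact le_max_of_le_left (Real.rpow_le_rpow_of_exponent_ge hw h (by linarith))
  · exact (Real.rpow_le_one_of_one_le_of_nonpos h (by linarith)).trans (one_le_max_rpow hα hβ hw)

theorem SuperExpRegularTarget.one_le_prefactor {d : ℕ} {π : Space d → ℝ}
    (hπ : SuperExpRegularTarget π) {η : ℝ} (hη : 0 ≤ η) (x : Space d) :
    1 ≤ (⨆ z, π z) ^ η * π x ^ (-η) := by
  have hx := hπ.pos x
  rw [Real.rpow_neg hx.le, ← div_eq_mul_inv, one_le_div (Real.rpow_pos_of_pos hx _)]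
  exact Real.rpow_le_rpow hx.le (le_ciSup hπ.bddAbove x) hη

theorem one_le_driftFn {d : ℕ} {π : Space d → ℝ}
    (hπ : SuperExpRegularTarget π) {η α β : ℝ} (hη : 0 ≤ η) (hα : 0 < α) (hβ : 0 < β)
    (s : Space d × Weight) : 1 ≤ driftFn π η α β s :=
  one_le_mul_of_one_le_of_one_le (hπ.one_le_prefactor hη _) (one_le_max_rpow hα hβ s.2.2)

theorem rpow_div_le_self {V β : ℝ} (hV : 1 ≤ V) (hβ : 0 < β) : V ^ ((β - 1) / β) ≤ V := by
  conv_rhs => rw [← Real.rpow_one V]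
  refine Real.rpow_le_rpow_of_exponent_le hV ?_
  rw [div_le_one hβ]
  linarith

/-- This is why acceptance of order 1/w is enough for large weights: the polynomial decrement
V^(1-1/β) is V divided by V^(1/β), and V^(1/β) ≥ w. -/
theorem rpow_div_le_div {V β w : ℝ} (hβ : 0 < β) (hw : 0 < w) (hV : w ^ β ≤ V) :
    V ^ ((β - 1) / β) ≤ V / w := by
  have hV0 : 0 < V := (Real.rpow_pos_of_pos hw _).trans_le hV
  have h1 : (β - 1) / β = 1 - 1 / β := by field_simp
  rw [h1, Real.rpow_sub hV0, Real.rpow_one]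
  gcongr
  calc w = (w ^ β) ^ (1 / β) := by
        rw [← Real.rpow_mul hw.le, mul_one_div_cancel hβ.ne', Real.rpow_one]
    _ ≤ _ := by gcongr

/-- Acceptance at rate 2k removes 2kV: one half pays for the accepted part, the other for the
decrement. -/
theorem drift_of_rate {d : ℕ} {π q : Space d → ℝ} (hπ : SuperExpRegularTarget π)
    (hq : SymmetricIncrement q) (Q : Kernel (Space d) Weight) [IsMarkovKernel Q]
    {η α β : ℝ} (hη : 0 ≤ η) (hα : 0 < α) (hβ : 0 < β) (x : Space d) (w : Weight) {k a Y : ℝ}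
    (hk : 0 ≤ k) (hk1 : 2 * k ≤ 1) (hY : 0 ≤ Y)
    (hA : ENNReal.ofReal (2 * k) ≤ acceptRate π q Q (x, w))
    (hE : ∫⁻ y, ENNReal.ofReal (q (y - x)) *
        ∫⁻ u, accProb π (x, w) (y, u) * ENNReal.ofReal (driftFn π η α β (y, u)) ∂(Q y) ≤
      ENNReal.ofReal ((⨆ z, π z) ^ η * π x ^ (-η) * Y))
    (hYk : Y ≤ k * max ((w : ℝ) ^ (-α)) ((w : ℝ) ^ β))
    (ha : a * driftFn π η α β (x, w) ^ ((β - 1) / β) ≤ k * driftFn π η α β (x, w)) :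
    ∫⁻ t, ENNReal.ofReal (driftFn π η α β t) ∂(pseudoMarginal π q Q (x, w)) ≤
      ENNReal.ofReal (driftFn π η α β (x, w) -
        a * driftFn π η α β (x, w) ^ ((β - 1) / β)) := by
  have hp : 0 ≤ (⨆ z, π z) ^ η * π x ^ (-η) := zero_le_one.trans (hπ.one_le_prefactor hη x)
  have hV := one_le_driftFn hπ hη hα hβ (x, w)
  refine (lintegral_driftFn_le hπ hq Q (x, w) (mul_nonneg hp hY) (by linarith) hk1 hE hA
    (by linarith)).trans (ENNReal.ofReal_le_ofReal ?_)
  have h1 : (⨆ z, π z) ^ η * π x ^ (-η) * Y ≤ k * driftFn π η α β (x, w) := by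
    unfold driftFn
    calc (⨆ z, π z) ^ η * π x ^ (-η) * Y ≤ (⨆ z, π z) ^ η * π x ^ (-η) *
          (k * max ((w : ℝ) ^ (-α)) ((w : ℝ) ^ β)) := by gcongr
      _ = _ := by ring
  linarith

/-- Drift when both gains are small compared with the acceptance rate. -/
theorem drift_of_vanishing {d : ℕ} {π q : Space d → ℝ} (hπ : SuperExpRegularTarget π)
    (hq : SymmetricIncrement q) (Q : Kernel (Space d) Weight) [IsMarkovKernel Q]
    {η α β α' β' θ δ₁ a : ℝ} (hη : 0 ≤ η) (hα : 0 < α) (hα' : α ≤ α') (hβ : 0 < β)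
    (hθ : 0 ≤ θ) (hθ1 : θ ≤ 1) (hθβ : θ ≤ β' - β) (hθα : θ ≤ α) (x : Space d) (w : Weight)
    (hδ₁ : 0 < δ₁) (hδ₁1 : δ₁ ≤ 1) (ha : a ≤ δ₁ / 2)
    (hv1 : upperGain π q Q α' β' (0 - η) x ≤ ENNReal.ofReal (δ₁ / 4))
    (hv2 : lowerGain π q Q α' β' (θ - η) x ≤ ENNReal.ofReal (δ₁ / 4))
    (hA : ENNReal.ofReal δ₁ ≤ acceptRate π q Q (x, w)) :
    ∫⁻ t, ENNReal.ofReal (driftFn π η α β t) ∂(pseudoMarginal π q Q (x, w)) ≤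
      ENNReal.ofReal (driftFn π η α β (x, w) -
        a * driftFn π η α β (x, w) ^ ((β - 1) / β)) := by
  have hw : 0 < (w : ℝ) := w.2
  have hV1 := one_le_driftFn hπ hη hα hβ (x, w)
  refine drift_of_rate hπ hq Q hη hα hβ x w (k := δ₁ / 2) (by positivity)
    (by linarith) (Y := (w : ℝ) ^ (-(0 : ℝ)) * (δ₁ / 4) + (w : ℝ) ^ (-θ) * (δ₁ / 4))
    (by positivity) ?_
    (accepted_drift_le hπ hq Q hα hα' hβ le_rfl zero_le_one (hθ.trans hθβ) hθ hθ1 hθβ x w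
      (by positivity) (by positivity) hv1 hv2) ?_ ?_
  · rwa [mul_div_cancel₀ _ two_ne_zero]
  · have h1 := mul_le_mul_of_nonneg_right (rpow_neg_le_max_rpow hα hβ le_rfl hα.le hw)
      (show 0 ≤ δ₁ / 4 by positivity)
    have h2 := mul_le_mul_of_nonneg_right (rpow_neg_le_max_rpow hα hβ hθ hθα hw)
      (show 0 ≤ δ₁ / 4 by positivity)
    exact (add_le_add h1 h2).trans_eq (by ring)
  · have := rpow_div_le_self hV1 hβ
    gcongr

theorem half_le_of_one_le_add {I T : ℝ≥0∞} (h : 1 ≤ I + T) (hT : T ≤ ENNReal.ofReal (1 / 2)) :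
    ENNReal.ofReal (1 / 2) ≤ I := by
  have h2 : ENNReal.ofReal (1 / 2) + ENNReal.ofReal (1 / 2) ≤ I + ENNReal.ofReal (1 / 2) := by
    rw [← ENNReal.ofReal_add (by norm_num) (by norm_num), add_halves, ENNReal.ofReal_one]
    exact h.trans (by gcongr)
  exact (ENNReal.add_le_add_iff_right ENNReal.ofReal_ne_top).1 h2

theorem half_le_of_one_le_add_mul {I m : ℝ≥0∞} {t X : ℝ} (ht : 0 ≤ t)
    (h : 1 ≤ I + ENNReal.ofReal t * m) (hm : m ≤ ENNReal.ofReal X) (htX : t * X ≤ 1 / 2) :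
    ENNReal.ofReal (1 / 2) ≤ I :=
  half_le_of_one_le_add h <| calc
    ENNReal.ofReal t * m ≤ ENNReal.ofReal t * ENNReal.ofReal X := by gcongr
    _ = ENNReal.ofReal (t * X) := (ENNReal.ofReal_mul ht).symm
    _ ≤ _ := ENNReal.ofReal_le_ofReal htX

set_option maxHeartbeats 1000000 in
/-- Uniform drift criterion: the two gains vanish at infinity and grow slowly in `ŵ`, the moments
are controlled by `ŵ`, and weights below `ŵ` are accepted at a uniform rate far out. -/
theorem exists_polynomialDrift {d : ℕ} {π q : Space d → ℝ} (hπ : SuperExpRegularTarget π)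
    (hq : SymmetricIncrement q) {η α β α' β' θ θ₁ θ₂ κ ξ C δ₁ R : ℝ} {what : Space d → ℝ}
    (hη : 0 < η) (hα : 0 < α) (hα' : α ≤ α') (hβ : 0 < β) (hβ' : 1 < β')
    (hθ : 0 ≤ θ) (hθ1 : θ ≤ 1) (hθβ : θ ≤ β' - β) (hθα : θ ≤ α)
    (h₁ : 0 ≤ θ₁) (h₁1 : θ₁ ≤ 1) (h₁β : θ₁ ≤ β' - β) (h₁α : θ₁ < α)
    (h₂ : 0 ≤ θ₂) (h₂1 : θ₂ ≤ 1) (h₂β : θ₂ ≤ β' - β) (h₂α : θ₂ < α)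
    (hκ : 0 < κ) (h₁κ : 0 ≤ β + θ₁ - 1 - κ) (h₂κ : 0 ≤ β + θ₂ - 1 - κ)
    (hξ : 0 ≤ ξ) (hξβ : ξ < β' - 1) (hC : 0 < C) (hδ₁ : 0 < δ₁) (hδ₁1 : δ₁ ≤ 1)
    (hwhat : LocallyBoundedGeOne what)
    (hwhat' : Tendsto what (Bornology.cobounded (Space d)) atTop)
    {𝒬 : Kernel (Space d) Weight → Prop}
    (hvanish : ∀ Q, IsMarkovKernel Q → 𝒬 Q → ∀ x, R ≤ ‖x‖ →
      upperGain π q Q α' β' (0 - η) x ≤ ENNReal.ofReal (δ₁ / 4) ∧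
      lowerGain π q Q α' β' (θ - η) x ≤ ENNReal.ofReal (δ₁ / 4))
    (hgrow : ∀ Q, IsMarkovKernel Q → 𝒬 Q → ∀ x,
      upperGain π q Q α' β' (θ₁ - η) x ≤ ENNReal.ofReal (C * what x ^ (β + θ₁ - 1 - κ)) ∧
      lowerGain π q Q α' β' (θ₂ - η) x ≤ ENNReal.ofReal (C * what x ^ (β + θ₂ - 1 - κ)))
    (hmoment : ∀ Q, IsMarkovKernel Q → 𝒬 Q → ∀ x, ∀ᵐ y, ‖y‖ ≤ ‖x‖ + 1 →
      moment Q α' β' y ≤ ENNReal.ofReal (C * what x ^ ξ))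
    (haccept : ∀ Q, IsMarkovKernel Q → 𝒬 Q → ∀ (x : Space d) (w : Weight), R ≤ ‖x‖ →
      (w : ℝ) ≤ what x → ENNReal.ofReal δ₁ ≤ acceptRate π q Q (x, w)) :
    ∃ M wlo whi b δ : ℝ, 1 ≤ M ∧ 0 < wlo ∧ wlo ≤ 1 ∧ 1 ≤ whi ∧ 1 ≤ b ∧ 0 < δ ∧
      ∀ (Q : Kernel (Space d) Weight) [IsMarkovKernel Q], UnitMean Q → 𝒬 Q →
        PolynomialDrift π q Q η α β M wlo whi b δ := by
  obtain ⟨r, δ₀, S, hr, hr1, hδ₀, hδ₀1, hS⟩ := exists_increments_ge hπ hq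
  have hwhat0 : ∀ x, 0 < what x := fun x => one_pos.trans_le (hwhat.1 x)
  -- the threshold for large weights
  obtain ⟨w₀, hw₀1, hw₀⟩ : ∃ w₀ : ℝ, 1 ≤ w₀ ∧ ∀ w, w₀ ≤ w →
      2 * C * w ^ (-κ) ≤ δ₀ * r / 4 ∧ C * w ^ (-(β' - 1 - ξ)) ≤ 1 / 2 := by
    have t1 : Tendsto (fun w : ℝ => 2 * C * w ^ (-κ)) atTop (𝓝 0) := by
      simpa using (tendsto_rpow_neg_atTop hκ).const_mul (2 * C)
    have t2 : Tendsto (fun w : ℝ => C * w ^ (-(β' - 1 - ξ))) atTop (𝓝 0) := by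
      simpa using (tendsto_rpow_neg_atTop (show 0 < β' - 1 - ξ by linarith)).const_mul C
    obtain ⟨w₀, h⟩ := eventually_atTop.1 ((t1.eventually (eventually_le_nhds
      (show 0 < δ₀ * r / 4 by positivity))).and (t2.eventually (eventually_le_nhds
      (show (0 : ℝ) < 1 / 2 by norm_num))))
    exact ⟨max 1 w₀, le_max_left _ _, fun w hw => h w ((le_max_right _ _).trans hw)⟩
  -- the radius
  obtain ⟨M', hM'0, hM'⟩ := exists_norm_of_eventually_cobounded (hwhat'.eventually_ge_atTop w₀)
  set M := max (max R M') 1 with hM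
  obtain ⟨K', hK'⟩ := hwhat.2 _ (isCompact_closedBall (0 : Space d) M)
  set K := max K' 1 with hK
  have hK1 : 1 ≤ K := le_max_right _ _
  have hwK : ∀ x, ‖x‖ ≤ M → what x ≤ K := fun x hx =>
    (hK' ⟨x, by simpa using hx, rfl⟩).trans (le_max_left _ _)
  -- the threshold for small weights
  obtain ⟨wlo, hwlo0, hwlo1, hwlo⟩ : ∃ wlo : ℝ, 0 < wlo ∧ wlo ≤ 1 ∧ ∀ w, 0 < w → w < wlo →
      w ^ (α - θ₁) * (C * K ^ (β + θ₁ - 1 - κ)) ≤ δ₀ / 8 ∧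
      w ^ (α - θ₂) * (C * K ^ (β + θ₂ - 1 - κ)) ≤ δ₀ / 8 ∧
      (w / r) ^ α' * (C * K ^ ξ) ≤ 1 / 2 := by
    have t : ∀ e c D : ℝ, 0 < e → 0 < c →
        Tendsto (fun w : ℝ => (w / c) ^ e * D) (𝓝 0) (𝓝 0) := by
      intro e c D he hc
      have h1 : Tendsto (fun w : ℝ => (w / c) ^ e) (𝓝 0) (𝓝 0) := by
        have h2 := (Real.continuous_rpow_const he.le).tendsto (0 : ℝ)
        rw [Real.zero_rpow he.ne'] at h2
        refine h2.comp ?_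
        simpa using (tendsto_id (α := ℝ) (x := 𝓝 0)).div_const c
      simpa using h1.mul_const D
    have t1 := t (α - θ₁) 1 (C * K ^ (β + θ₁ - 1 - κ)) (by linarith) one_pos
    have t2 := t (α - θ₂) 1 (C * K ^ (β + θ₂ - 1 - κ)) (by linarith) one_pos
    have t3 := t α' r (C * K ^ ξ) (by linarith) hr
    simp only [div_one] at t1 t2
    have h8 : 0 < δ₀ / 8 := by positivity
    obtain ⟨ε, hε, h⟩ := Metric.eventually_nhds_iff.1 ((t1.eventually (eventually_le_nhds h8)).and
      ((t2.eventually (eventually_le_nhds h8)).and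
        (t3.eventually (eventually_le_nhds (show (0 : ℝ) < 1 / 2 by norm_num)))))
    refine ⟨min ε 1, by positivity, min_le_right _ _, fun w hw hwε => h ?_⟩
    rw [Real.dist_0_eq_abs, abs_of_pos hw]
    exact hwε.trans_le (min_le_left _ _)
  -- K bounds ŵ on the ball of radius M. A weight in [w₀, ŵ(x)] with |x| < M therefore belongs to C.
  set whi := max w₀ K with hwhi
  obtain ⟨p, hp, hpM⟩ := hπ.exists_lower M
  have hcπ : 0 ≤ (⨆ z, π z) ^ η :=
    Real.rpow_nonneg (Real.iSup_nonneg fun z => (hπ.pos z).le) _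
  set b₀ := (⨆ z, π z) ^ η * p ^ (-η) *
    (wlo ^ (-θ₁) * (C * K ^ (β + θ₁ - 1 - κ)) + wlo ^ (-θ₂) * (C * K ^ (β + θ₂ - 1 - κ))) +
    (⨆ z, π z) ^ η * p ^ (-η) * max (wlo ^ (-α)) (whi ^ β) with hb₀
  -- The first entry is the rate available at large weights after multiplication by w, the second
  -- the rate far out. The small-weight rate δ₀/4 exceeds the first.
  set δ := min (δ₀ * r / 4) (δ₁ / 2) with hδ
  refine ⟨M, wlo, whi, max b₀ 1, δ, le_max_right _ _, hwlo0, hwlo1,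
    hw₀1.trans (le_max_left _ _), le_max_right _ _, by positivity, ?_⟩
  rintro Q hQM hQ h𝒬 ⟨x, w⟩
  have hw : 0 < (w : ℝ) := w.2
  have hV1 := one_le_driftFn hπ hη.le hα hβ (x, w)
  -- The free bounds e₁ and e₂ become powers of w where w ≥ ŵ(x), and powers of K near the origin.
  have hE : ∀ e₁ e₂ : ℝ, what x ^ (β + θ₁ - 1 - κ) ≤ e₁ → what x ^ (β + θ₂ - 1 - κ) ≤ e₂ →
      ∫⁻ y, ENNReal.ofReal (q (y - x)) *
        ∫⁻ u, accProb π (x, w) (y, u) * ENNReal.ofReal (driftFn π η α β (y, u)) ∂(Q y) ≤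
      ENNReal.ofReal ((⨆ z, π z) ^ η * π x ^ (-η) *
        ((w : ℝ) ^ (-θ₁) * (C * e₁) + (w : ℝ) ^ (-θ₂) * (C * e₂))) := by
    intro e₁ e₂ he₁ he₂
    have hpos : ∀ e : ℝ, 0 < what x ^ e := fun e => Real.rpow_pos_of_pos (hwhat0 x) _
    have he₁0 := (hpos _).le.trans he₁
    have he₂0 := (hpos _).le.trans he₂
    refine accepted_drift_le hπ hq Q hα hα' hβ h₁ h₁1 h₁β h₂ h₂1 h₂β x w (by positivity)
      (by positivity) ((hgrow Q hQM h𝒬 x).1.trans (ENNReal.ofReal_le_ofReal ?_))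
      ((hgrow Q hQM h𝒬 x).2.trans (ENNReal.ofReal_le_ofReal ?_))
    · gcongr
    · gcongr
  obtain ⟨hSm, hSδ, hSz⟩ := hS x
  have hSy : ∀ y, y - x ∈ S x → ‖y‖ ≤ ‖x‖ + 1 ∧ r * π x ≤ π y := by
    intro y hy
    obtain ⟨h1, h2⟩ := hSz _ hy
    rw [add_sub_cancel] at h2
    refine ⟨?_, h2⟩
    have := norm_add_le x (y - x)
    rw [add_sub_cancel] at this
    linarith
  constructor
  · intro hs
    rcases le_or_gt w₀ w with hw0 | hw0
    · rcases le_or_gt (what x) w with hwx | hwx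
      · -- large weights
        have hw1 : 1 ≤ (w : ℝ) := hw₀1.trans hw0
        obtain ⟨hwκ, hwξ⟩ := hw₀ w hw0
        have hacc : ENNReal.ofReal (r / w * (1 / 2) * δ₀) ≤ acceptRate π q Q (x, w) := by
          refine le_acceptRate Q hSm hq (by positivity) hSδ ?_
          filter_upwards [hmoment Q hQM h𝒬 x] with y hy hyS
          have h1 := one_le_mul_lintegral_accProb_add hπ Q hQ (α' := α') hβ' hr hr1 x y w
            (hSy y hyS).2
          have h2 := half_le_of_one_le_add_mul (by positivity) h1 (hy (hSy y hyS).1) (by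
            calc (w : ℝ) ^ (1 - β') * (C * what x ^ ξ)
                ≤ (w : ℝ) ^ (1 - β') * (C * (w : ℝ) ^ ξ) := by
                  have := hwhat0 x
                  gcongr
              _ = C * (w : ℝ) ^ (-(β' - 1 - ξ)) := by
                  rw [mul_left_comm, ← Real.rpow_add hw]; ring_nf
              _ ≤ _ := hwξ)
          calc ENNReal.ofReal (r / w * (1 / 2))
              = ENNReal.ofReal (r / w) * ENNReal.ofReal (1 / 2) := ENNReal.ofReal_mul (by positivity)
            _ ≤ ENNReal.ofReal (r / w) * (ENNReal.ofReal ((w : ℝ) / r) *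
                ∫⁻ u, accProb π (x, w) (y, u) ∂(Q y)) := by gcongr
            _ = _ := by
                rw [← mul_assoc, ← ENNReal.ofReal_mul (by positivity)]
                have : r / w * ((w : ℝ) / r) = 1 := by field_simp
                rw [this, ENNReal.ofReal_one, one_mul]
        have hk : r / w * (1 / 2) * δ₀ = 2 * (δ₀ * r / 4 / w) := by field_simp; ring
        rw [hk] at hacc
        have hk1 : δ₀ * r / 4 / w ≤ 1 / 2 := by
          rw [div_le_iff₀ hw]
          nlinarith
        refine drift_of_rate hπ hq Q hη.le hα hβ x w (k := δ₀ * r / 4 / w) (by positivity)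
          (by linarith) (Y := (w : ℝ) ^ (-θ₁) * (C * (w : ℝ) ^ (β + θ₁ - 1 - κ)) +
            (w : ℝ) ^ (-θ₂) * (C * (w : ℝ) ^ (β + θ₂ - 1 - κ))) (by positivity) hacc
          (hE _ _ ?_ ?_) ?_ ?_
        · exact Real.rpow_le_rpow (hwhat0 x).le hwx h₁κ
        · exact Real.rpow_le_rpow (hwhat0 x).le hwx h₂κ
        -- Both terms reduce to the same order w^(β-1-κ) whatever the exponent θ; the spare w^(-κ)
        -- makes them small against w^(β-1), the order of what acceptance removes.
        · have e1 : ∀ t : ℝ, (w : ℝ) ^ (-t) * (C * (w : ℝ) ^ (β + t - 1 - κ)) =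
              C * (w : ℝ) ^ (-κ) * (w : ℝ) ^ (β - 1) := by
            intro t
            rw [mul_left_comm, ← Real.rpow_add hw, mul_assoc, ← Real.rpow_add hw]
            ring_nf
          rw [e1, e1]
          calc C * (w : ℝ) ^ (-κ) * (w : ℝ) ^ (β - 1) + C * (w : ℝ) ^ (-κ) * (w : ℝ) ^ (β - 1)
              = 2 * C * (w : ℝ) ^ (-κ) * (w : ℝ) ^ (β - 1) := by ring
            _ ≤ δ₀ * r / 4 * (w : ℝ) ^ (β - 1) := by gcongr
            _ = δ₀ * r / 4 / w * (w : ℝ) ^ β := by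
              rw [Real.rpow_sub hw, Real.rpow_one]; field_simp
            _ ≤ _ := by gcongr; exact le_max_right _ _
        · have hVw : (w : ℝ) ^ β ≤ driftFn π η α β (x, w) := by
            unfold driftFn
            calc (w : ℝ) ^ β ≤ 1 * max ((w : ℝ) ^ (-α)) ((w : ℝ) ^ β) := by
                  rw [one_mul]; exact le_max_right _ _
              _ ≤ _ := by
                  gcongr
                  exact hπ.one_le_prefactor hη.le x
          have h3 := rpow_div_le_div hβ hw hVw
          calc δ * driftFn π η α β (x, w) ^ ((β - 1) / β)
              ≤ δ₀ * r / 4 * (driftFn π η α β (x, w) / w) := by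
                gcongr
                exact min_le_left _ _
            _ = _ := by ring
      · -- moderate weights far out
        have hxM : M ≤ ‖x‖ := by
          by_contra hc
          have h1 := hwK x (not_le.1 hc).le
          have h2 : (w : ℝ) ≤ whi := hwx.le.trans (h1.trans (le_max_right _ _))
          exact hs ⟨(not_le.1 hc).le, (hwlo1.trans hw₀1).trans hw0, h2⟩
        have hxR : R ≤ ‖x‖ := ((le_max_left _ _).trans (le_max_left _ _)).trans hxM
        obtain ⟨hv1, hv2⟩ := hvanish Q hQM h𝒬 x hxR
        exact drift_of_vanishing hπ hq Q hη.le hα hα' hβ hθ hθ1 hθβ hθα x w hδ₁ hδ₁1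
          (min_le_right _ _) hv1 hv2 (haccept Q hQM h𝒬 x w hxR hwx.le)
    · rcases le_or_gt M ‖x‖ with hxM | hxM
      · have hxR : R ≤ ‖x‖ := ((le_max_left _ _).trans (le_max_left _ _)).trans hxM
        have hwx : (w : ℝ) ≤ what x :=
          hw0.le.trans (hM' x (((le_max_right _ _).trans (le_max_left _ _)).trans hxM))
        obtain ⟨hv1, hv2⟩ := hvanish Q hQM h𝒬 x hxR
        exact drift_of_vanishing hπ hq Q hη.le hα hα' hβ hθ hθ1 hθβ hθα x w hδ₁ hδ₁1
          (min_le_right _ _) hv1 hv2 (haccept Q hQM h𝒬 x w hxR hwx)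
      · -- small weights near the origin
        have hwl : (w : ℝ) < wlo := by
          by_contra hc
          exact hs ⟨hxM.le, not_lt.1 hc, hw0.le.trans (le_max_left _ _)⟩
        obtain ⟨hl1, hl2, hl3⟩ := hwlo w hw hwl
        have hKx := hwK x hxM.le
        have hacc : ENNReal.ofReal (1 / 2 * δ₀) ≤ acceptRate π q Q (x, w) := by
          refine le_acceptRate Q hSm hq (by norm_num) hSδ ?_
          filter_upwards [hmoment Q hQM h𝒬 x] with y hy hyS
          refine half_le_of_one_le_add_mul (by positivity)
            (one_le_lintegral_accProb_add hπ Q (α' := α') (β' := β') (by linarith) hr x y w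
              (hSy y hyS).2)
            (hy (hSy y hyS).1) (le_trans ?_ hl3)
          have := hwhat0 x
          gcongr
        refine drift_of_rate hπ hq Q hη.le hα hβ x w (k := δ₀ / 4) (by positivity)
          (by linarith) (Y := (w : ℝ) ^ (-θ₁) * (C * K ^ (β + θ₁ - 1 - κ)) +
            (w : ℝ) ^ (-θ₂) * (C * K ^ (β + θ₂ - 1 - κ))) (by positivity) ?_
          (hE _ _ ?_ ?_) ?_ ?_
        · rw [show 2 * (δ₀ / 4) = 1 / 2 * δ₀ by ring]
          exact hacc
        · exact Real.rpow_le_rpow (hwhat0 x).le hKx h₁κ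
        · exact Real.rpow_le_rpow (hwhat0 x).le hKx h₂κ
        -- Factoring out w^(-α) leaves positive powers of w, small below the threshold because θ₁
        -- and θ₂ are less than α.
        · have e1 : ∀ t D : ℝ, (w : ℝ) ^ (-t) * D = (w : ℝ) ^ (-α) * ((w : ℝ) ^ (α - t) * D) := by
            intro t D
            rw [← mul_assoc, ← Real.rpow_add hw]
            ring_nf
          rw [e1 θ₁, e1 θ₂, ← mul_add]
          calc (w : ℝ) ^ (-α) * _ ≤ (w : ℝ) ^ (-α) * (δ₀ / 8 + δ₀ / 8) := by gcongr
            _ = δ₀ / 4 * (w : ℝ) ^ (-α) := by ring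
            _ ≤ _ := by gcongr; exact le_max_left _ _
        · have h1 := rpow_div_le_self hV1 hβ
          have h2 : δ ≤ δ₀ / 4 := (min_le_left _ _).trans (by nlinarith)
          gcongr
  · rintro ⟨hxM, hwl, hwh⟩
    simp only at hxM hwl hwh
    have hKx := hwK x hxM
    have h1 := lintegral_driftFn_le hπ hq Q (η := η) (α := α) (β := β) (x, w) (a := 0)
      (by have := hπ.pos x; positivity) le_rfl zero_le_one
      (hE _ _ (Real.rpow_le_rpow (hwhat0 x).le hKx h₁κ) (Real.rpow_le_rpow (hwhat0 x).le hKx h₂κ))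
      (by simp) (by linarith)
    refine h1.trans (ENNReal.ofReal_le_ofReal (le_max_of_le_left ?_))
    have hpx : π x ^ (-η) ≤ p ^ (-η) :=
      Real.rpow_le_rpow_of_nonpos hp (hpM x hxM) (by linarith)
    have hwl' : ∀ t : ℝ, 0 ≤ t → (w : ℝ) ^ (-t) ≤ wlo ^ (-t) := fun t ht =>
      Real.rpow_le_rpow_of_nonpos hwlo0 hwl (by linarith)
    have hwβ : (w : ℝ) ^ β ≤ whi ^ β := Real.rpow_le_rpow hw.le hwh hβ.le
    have hx := hπ.pos x
    unfold driftFn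
    rw [hb₀, sub_zero, one_mul]
    simp only
    have q1 := hwl' θ₁ h₁
    have q2 := hwl' θ₂ h₂
    have q3 := hwl' α hα.le
    have hm0 : 0 ≤ max ((w : ℝ) ^ (-α)) ((w : ℝ) ^ β) := le_max_of_le_left (by positivity)
    gcongr

/-! ### Drift under non-uniform moment bounds. -/

/-- The factors g(x) cancel in the product of suprema. The resulting bound controls the moment at y
after a drop of π, however far away y is. -/
theorem RejectionBalance.exists_le {d : ℕ} {π : Space d → ℝ} (hπ : SuperExpRegularTarget π)
    {ψ : ℝ → ℝ} (hψ : GrowthProfile ψ) {what : Space d → ℝ} (hwhat : LocallyBoundedGeOne what)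
    {ξ : ℝ} (h : RejectionBalance π ψ what ξ) :
    ∃ C : ℝ, 0 ≤ C ∧ ∀ x y, π y < π x → (π y / π x) ^ ξ * ψ (π y) ≤ C * what x ^ ξ := by
  unfold RejectionBalance at h
  set T := ⨆ x : Space d, ENNReal.ofReal (ψ (π x) / what x ^ ξ) *
    ⨆ z ∈ rejectRegion π x,
      ENNReal.ofReal ((π (x + z) / π x) ^ ξ * (ψ (π (x + z)) / ψ (π x))) with hT
  refine ⟨T.toReal, ENNReal.toReal_nonneg, fun x y hxy => ?_⟩
  have hx := hπ.pos x
  have hψx : 0 < ψ (π x) := one_pos.trans_le (hψ.one_le _ hx)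
  have hw : 0 < what x ^ ξ := Real.rpow_pos_of_pos (one_pos.trans_le (hwhat.1 x)) _
  have hz : y - x ∈ rejectRegion π x := by
    change π (x + (y - x)) / π x < 1
    rwa [add_sub_cancel, div_lt_one hx]
  have h1 : ENNReal.ofReal ((π y / π x) ^ ξ * (ψ (π y) / ψ (π x))) ≤
      ⨆ z ∈ rejectRegion π x,
      ENNReal.ofReal ((π (x + z) / π x) ^ ξ * (ψ (π (x + z)) / ψ (π x))) := by
    refine le_trans ?_ (le_iSup₂ (y - x) hz)
    rw [add_sub_cancel]
  have h2 : ENNReal.ofReal (ψ (π x) / what x ^ ξ) *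
      ENNReal.ofReal ((π y / π x) ^ ξ * (ψ (π y) / ψ (π x))) ≤ ENNReal.ofReal T.toReal := by
    rw [ENNReal.ofReal_toReal h.ne]
    exact (mul_le_mul_right h1 _).trans (le_iSup (fun x : Space d =>
      ENNReal.ofReal (ψ (π x) / what x ^ ξ) * ⨆ z ∈ rejectRegion π x,
      ENNReal.ofReal ((π (x + z) / π x) ^ ξ * (ψ (π (x + z)) / ψ (π x)))) x)
  rw [← ENNReal.ofReal_mul (by positivity),
    ENNReal.ofReal_le_ofReal_iff ENNReal.toReal_nonneg] at h2
  calc (π y / π x) ^ ξ * ψ (π y)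
      = ψ (π x) / what x ^ ξ * ((π y / π x) ^ ξ * (ψ (π y) / ψ (π x))) * what x ^ ξ := by
        field_simp
    _ ≤ _ := by gcongr

theorem ae_moment_le_localMoment {d : ℕ} (Q : Kernel (Space d) Weight) (a b r : ℝ) :
    ∀ᵐ y, ‖y‖ ≤ r → moment Q a b y ≤ localMoment Q a b r := by
  have h : ∀ᵐ y ∂(volume.restrict (Metric.closedBall (0 : Space d) r)),
      moment Q a b y ≤ localMoment Q a b r := ENNReal.ae_le_essSup _
  rw [ae_restrict_iff' Metric.isClosed_closedBall.measurableSet] at h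
  filter_upwards [h] with y hy hyr
  exact hy (by simpa using hyr)

theorem one_le_moment {d : ℕ} (Q : Kernel (Space d) Weight) [IsMarkovKernel Q] {a b : ℝ}
    (ha : 0 < a) (hb : 0 < b) (x : Space d) : 1 ≤ moment Q a b x :=
  calc (1 : ℝ≥0∞) = ∫⁻ _, 1 ∂(Q x) := by simp
    _ ≤ _ := lintegral_mono fun u => by
      rw [← ENNReal.ofReal_one]
      exact ENNReal.ofReal_le_ofReal (one_le_max_rpow ha hb u.2)

/-- Lets smallness of M_W(b|x|) q(D_x) imply smallness of q(D_x) itself. -/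
theorem one_le_localMoment {d : ℕ} (Q : Kernel (Space d) Weight) [IsMarkovKernel Q] {a b r : ℝ}
    (ha : 0 < a) (hb : 0 < b) (hr : 0 < r) : 1 ≤ localMoment Q a b r := by
  have hne : volume.restrict (Metric.closedBall (0 : Space d) r) ≠ 0 := by
    rw [Ne, Measure.restrict_eq_zero]
    exact (Metric.measure_closedBall_pos _ _ hr).ne'
  have : (ae (volume.restrict (Metric.closedBall (0 : Space d) r))).NeBot := ae_neBot.2 hne
  have h : ∀ᵐ y ∂(volume.restrict (Metric.closedBall (0 : Space d) r)),
      moment Q a b y ≤ localMoment Q a b r := ENNReal.ae_le_essSup _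
  obtain ⟨y, hy⟩ := h.exists
  exact (one_le_moment Q ha hb y).trans hy

theorem measurableSet_annulus {d : ℕ} {π : Space d → ℝ} (hπ : SuperExpRegularTarget π)
    (c : Space d → ℝ) (x : Space d) : MeasurableSet (annulus π c x) := by
  have h : Measurable fun z => π (x + z) / π x :=
    (hπ.contDiff.continuous.measurable.comp (measurable_const_add x)).div_const _
  exact (measurableSet_le measurable_const h).inter (measurableSet_le h measurable_const)

/-- Points at which `π` has dropped at most by an exponentially large factor stay within a fixed
multiple of `‖x‖`. -/
theorem exists_norm_le_of_div_le {d : ℕ} {π : Space d → ℝ} (hπ : SuperExpRegularTarget π)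
    (hd : d = 1 → ComparableContours π) {c : Space d → ℝ} (hc1 : ∀ x, 1 ≤ c x)
    (hc : limsup (fun x => ENNReal.ofReal (c x * Real.exp (-‖x‖)))
      (Bornology.cobounded (Space d)) < ⊤) :
    ∃ b R : ℝ, 1 ≤ b ∧ 0 < R ∧ ∀ x y, R ≤ ‖x‖ → π x / c x ≤ π y → ‖y‖ ≤ b * ‖x‖ := by
  obtain ⟨B, hB1, hB⟩ := hπ.exists_norm_le_of_le hd
  obtain ⟨T, hT1, hT2⟩ := exists_between hc
  obtain ⟨R, hR0, hR⟩ := exists_norm_of_eventually_cobounded (eventually_lt_of_limsup_lt hT1)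
  obtain ⟨R', hR'0, hR'⟩ := hπ.log_smul_le 2
  refine ⟨B * 2, max (max R R') (max 1 (Real.log (max T.toReal 1))), by linarith,
    by positivity, fun x y hx hxy => ?_⟩
  have hxR := ((le_max_left _ _).trans (le_max_left _ _)).trans hx
  have hxR' := ((le_max_right _ _).trans (le_max_left _ _)).trans hx
  have hx1 := ((le_max_left _ _).trans (le_max_right _ _)).trans hx
  have hxT := ((le_max_right _ _).trans (le_max_right _ _)).trans hx
  -- Doubling x lowers log π by at least 2|x|, hence by more than c(x) can compensate: π(2x) ≤
  -- π(x)/c(x) ≤ π(y). Comparing superlevel sets at 2x then bounds |y|.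
  have hcx : c x ≤ Real.exp (2 * ‖x‖) := by
    have h1 : c x * Real.exp (-‖x‖) ≤ T.toReal := by
      rw [← ENNReal.ofReal_le_ofReal_iff ENNReal.toReal_nonneg, ENNReal.ofReal_toReal hT2.ne]
      exact (hR x hxR).le
    have h2 : T.toReal ≤ Real.exp ‖x‖ := by
      refine (le_max_left _ 1).trans ?_
      rwa [← Real.log_le_iff_le_exp (by positivity)]
    calc c x = c x * Real.exp (-‖x‖) * Real.exp ‖x‖ := by
          rw [mul_assoc, ← Real.exp_add]; simp
      _ ≤ Real.exp ‖x‖ * Real.exp ‖x‖ := by gcongr; exact h1.trans h2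
      _ = _ := by rw [← Real.exp_add]; ring_nf
  have h3 := hR' x 2 hxR' one_le_two
  have h4 : π ((2 : ℝ) • x) ≤ π y := by
    refine le_trans ?_ hxy
    have hcp := one_pos.trans_le (hc1 x)
    rw [le_div_iff₀ hcp]
    calc π ((2 : ℝ) • x) * c x ≤ π ((2 : ℝ) • x) * Real.exp (2 * ‖x‖) := by
          have := hπ.pos ((2 : ℝ) • x)
          gcongr
      _ = Real.exp (Real.log (π ((2 : ℝ) • x)) + 2 * ‖x‖) := by
          rw [Real.exp_add, Real.exp_log (hπ.pos _)]
      _ ≤ Real.exp (Real.log (π x)) := by gcongr; linarith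
      _ = π x := Real.exp_log (hπ.pos x)
  have h5 := hB _ _ h4
  rw [norm_smul, Real.norm_two, max_eq_left (by linarith)] at h5
  linarith

/-- The split along D_x: a crude bound M is paid only with the probability of D, while N is paid
everywhere and uses that q has mass one. -/
theorem setLIntegral_increment_le {d : ℕ} {q : Space d → ℝ} (hq : SymmetricIncrement q)
    (x : Space d) {S D : Set (Space d)} (hS : MeasurableSet S) (hD : MeasurableSet D)
    {F : Space d → ℝ≥0∞} {M N : ℝ≥0∞}
    (h : ∀ᵐ y, y ∈ S → F y ≤ {y | y - x ∈ D}.indicator (fun _ => M) y + N) :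
    ∫⁻ y in S, ENNReal.ofReal (q (y - x)) * F y ≤ M * incrementProb q D + N := by
  have hm : MeasurableSet {y | y - x ∈ D} := hD.preimage (measurable_id.sub_const x)
  have hqm := hq.measurable_shift x
  calc ∫⁻ y in S, ENNReal.ofReal (q (y - x)) * F y
      ≤ ∫⁻ y in S, ENNReal.ofReal (q (y - x)) *
          ({y | y - x ∈ D}.indicator (fun _ => M) y + N) := by
        refine lintegral_mono_ae ?_
        rw [ae_restrict_iff' hS]
        filter_upwards [h] with y hy hyS
        gcongr
        exact hy hyS
    _ ≤ ∫⁻ y, ENNReal.ofReal (q (y - x)) * ({y | y - x ∈ D}.indicator (fun _ => M) y + N) :=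
        setLIntegral_le_lintegral _ _
    _ = ∫⁻ y, ({y | y - x ∈ D}.indicator (fun y => M * ENNReal.ofReal (q (y - x))) y +
          N * ENNReal.ofReal (q (y - x))) := by
        refine lintegral_congr fun y => ?_
        by_cases hy : y ∈ {y | y - x ∈ D}
        · simp only [Set.indicator_of_mem hy]; ring
        · simp only [Set.indicator_of_notMem hy]; ring
    _ = M * incrementProb q D + N := by
        rw [lintegral_add_right _ (hqm.const_mul _), lintegral_indicator hm,
          lintegral_const_mul _ hqm, lintegral_const_mul _ hqm,
          setLIntegral_shift_eq_incrementProb D hD x, hq.lintegral_shift, mul_one]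

theorem setLIntegral_increment_le_of_le {d : ℕ} {q : Space d → ℝ} (hq : SymmetricIncrement q)
    (x : Space d) {S : Set (Space d)} (hS : MeasurableSet S) {F : Space d → ℝ≥0∞} {N : ℝ≥0∞}
    (h : ∀ᵐ y, y ∈ S → F y ≤ N) :
    ∫⁻ y in S, ENNReal.ofReal (q (y - x)) * F y ≤ N := by
  have := setLIntegral_increment_le hq x hS MeasurableSet.empty (F := F) (M := 0) (N := N)
    (by simpa using h)
  simpa using this

theorem localMoment_le_of_iSup_le {d : ℕ} {Q : Kernel (Space d) Weight} {a b b' ξ : ℝ}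
    {what : Space d → ℝ} (hwhat : LocallyBoundedGeOne what) {K : ℝ≥0}
    (h : (⨆ x : Space d, localMoment Q a b (b' * max ‖x‖ 1) / ENNReal.ofReal (what x ^ ξ)) ≤ K)
    (x : Space d) : localMoment Q a b (b' * max ‖x‖ 1) ≤ ENNReal.ofReal (K * what x ^ ξ) := by
  have hw : 0 < what x ^ ξ := Real.rpow_pos_of_pos (one_pos.trans_le (hwhat.1 x)) _
  have h1 := (le_iSup (fun x : Space d =>
    localMoment Q a b (b' * max ‖x‖ 1) / ENNReal.ofReal (what x ^ ξ)) x).trans h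
  rw [ENNReal.div_le_iff (by simpa using hw) ENNReal.ofReal_ne_top] at h1
  rwa [ENNReal.ofReal_mul K.coe_nonneg, ENNReal.ofReal_coe_nnreal]

theorem ae_moment_le_of_essSup_le {d : ℕ} {Q : Kernel (Space d) Weight} {a b : ℝ}
    {g : Space d → ℝ} (hg : ∀ x, 0 < g x)
    (h : essSup (fun x => moment Q a b x / ENNReal.ofReal (g x)) volume ≤ 1) :
    ∀ᵐ y, moment Q a b y ≤ ENNReal.ofReal (g y) := by
  filter_upwards [ENNReal.ae_le_essSup (μ := volume)
    (fun x => moment Q a b x / ENNReal.ofReal (g x))] with y hy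
  have h1 := hy.trans h
  rwa [ENNReal.div_le_iff (by simpa using hg y) ENNReal.ofReal_ne_top, one_mul] at h1

set_option maxHeartbeats 1000000 in
/-- Polynomial drift under non-uniform moment bounds. -/
theorem exists_polynomialDrift_of_nonuniform {d : ℕ} {π q : Space d → ℝ}
    (hπ : SuperExpRegularTarget π) (hq : SymmetricIncrement q)
    (hd : d = 1 → ComparableContours π) {α' β' ξw ξπ : ℝ} {ψ : ℝ → ℝ} {what : Space d → ℝ}
    (hα' : 0 < α') (hβ' : 1 < β') (hξw : 0 < ξw) (hξwβ : ξw < β' - 1) (hξπ : 0 < ξπ)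
    (hψ : GrowthProfile ψ) (hwhat : LocallyBoundedGeOne what)
    (hwhat' : Tendsto what (Bornology.cobounded (Space d)) atTop)
    (hbal : RejectionBalance π ψ what ξπ) {η α β : ℝ} (hη : 0 < η)
    (hηα' : η < min α' (min (β' - 1 - ξw) (1 - ξπ))) (hηα : η < α) (hαα' : α ≤ α')
    (hβ : 1 + ξw - η < β)
    {c : Space d → ℝ} {ξc : ℝ} (hc : LocallyBoundedGeOne c)
    (hcexp : limsup (fun x => ENNReal.ofReal (c x * Real.exp (-‖x‖)))
      (Bornology.cobounded (Space d)) < ⊤)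
    (hξc : 0 < ξc) (hξc' : ξc < min (β' - β) (min α 1) - η - ξπ)
    (hwc : limsup (fun x => ENNReal.ofReal (what x ^ ξπ / c x ^ ξc))
      (Bornology.cobounded (Space d)) = 0)
    (K : ℝ → ℝ≥0) (ε : ℝ → Space d → ℝ≥0∞)
    (hε : ∀ b, 1 ≤ b → limsup (ε b) (Bornology.cobounded (Space d)) = 0) :
    ∃ M wlo whi b δ : ℝ, 1 ≤ M ∧ 0 < wlo ∧ wlo ≤ 1 ∧ 1 ≤ whi ∧ 1 ≤ b ∧ 0 < δ ∧
      ∀ (Q : Kernel (Space d) Weight) [IsMarkovKernel Q], UnitMean Q →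
        (essSup (fun x => moment Q α' β' x / ENNReal.ofReal (ψ (π x))) volume ≤ 1 ∧
        (∀ b', 1 < b' →
          (⨆ x : Space d, localMoment Q α' β' (b' * max ‖x‖ 1) /
            ENNReal.ofReal (what x ^ ξw)) ≤ K b') ∧
        (∀ b', 1 ≤ b' → ∀ x, tailQuantity π q Q what c α' β' η b' x ≤ ε b' x)) →
        PolynomialDrift π q Q η α β M wlo whi b δ := by
  have hα : 0 < α := hη.trans hηα
  have hη1 : η < 1 - ξπ := hηα'.trans_le ((min_le_right _ _).trans (min_le_right _ _))
  have hθθ : 0 < min (β' - β) (min α 1) - η - ξπ := hξc.trans hξc'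
  set θ := min (β' - β) (min α 1) with hθdef
  have hθβ : θ ≤ β' - β := min_le_left _ _
  have hθα : θ ≤ α := (min_le_right _ _).trans (min_le_left _ _)
  have hθ1 : θ ≤ 1 := (min_le_right _ _).trans (min_le_right _ _)
  have hwhat0 : ∀ x, 0 < what x := fun x => one_pos.trans_le (hwhat.1 x)
  have hc0 : ∀ x, 0 < c x := fun x => one_pos.trans_le (hc.1 x)
  have hm : Measurable π := hπ.contDiff.continuous.measurable
  obtain ⟨B, hB1, hB⟩ := hπ.exists_norm_le_of_le hd
  obtain ⟨b, Rb, hb1, hRb0, hRb⟩ := exists_norm_le_of_div_le hπ hd hc.1 hcexp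
  obtain ⟨Cb, hCb0, hCb⟩ := hbal.exists_le hπ hψ hwhat
  obtain ⟨t, δ, Rs, S, ht, hδ, hRs0, hS⟩ := exists_inward_increments hπ hq
  obtain ⟨Rg, hRg0, hRg⟩ := hπ.inner_gradient_le 0
  -- One factor 1/2 is lost by removing D_x from the inward increments, another because acceptance
  -- there is only at least 1/2.
  set δ₁ := min (δ / 4) 1 with hδ₁
  have hδ₁0 : 0 < δ₁ := by positivity
  have hδ₁8 : 0 < δ₁ / 8 := by positivity
  obtain ⟨Rε, hRε0, hRε⟩ := exists_norm_of_eventually_cobounded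
    (eventually_lt_of_limsup_lt (by
      rw [hε b hb1]; simpa using hδ₁8 : limsup (ε b) _ < ENNReal.ofReal (δ₁ / 8)))
  obtain ⟨Rw, hRw0, hRw⟩ := exists_norm_of_eventually_cobounded
    (eventually_lt_of_limsup_lt (by
      rw [hwc]; simp only [ENNReal.ofReal_pos]; positivity :
        limsup (fun x => ENNReal.ofReal (what x ^ ξπ / c x ^ ξc)) _ <
          ENNReal.ofReal (δ₁ / 8 / (Cb + 1))))
  -- K is needed at two radii only: B covers superlevel sets, and 2 covers increments of length at
  -- most one.
  set C := max (max (K B : ℝ) (K 2)) (Cb + 1) with hC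
  have hC0 : 0 < C := lt_max_of_lt_right (by linarith)
  -- consequences of the tail condition
  have htail : ∀ Q, IsMarkovKernel Q →
      (∀ b', 1 ≤ b' → ∀ x, tailQuantity π q Q what c α' β' η b' x ≤ ε b' x) →
      ∀ x, Rε ≤ ‖x‖ →
        localMoment Q α' β' (b * ‖x‖) * incrementProb q (annulus π c x) ≤ ENNReal.ofReal (δ₁ / 8) ∧
        ENNReal.ofReal (1 / c x ^ η) * localMoment Q α' β' (b * ‖x‖) ≤ ENNReal.ofReal (δ₁ / 8) ∧
        ENNReal.ofReal ((what x / c x) ^ α') * localMoment Q α' β' (b * ‖x‖) ≤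
          ENNReal.ofReal (δ₁ / 8) := by
    intro Q _ h3 x hx
    have h := (h3 b hb1 x).trans (hRε x hx).le
    unfold tailQuantity at h
    refine ⟨le_trans ?_ h, le_trans ?_ h, le_trans ?_ h⟩
    · gcongr; exact le_max_left _ _
    · rw [mul_comm]; gcongr; exact (le_max_left _ _).trans (le_max_right _ _)
    · rw [mul_comm]; gcongr; exact (le_max_right _ _).trans (le_max_right _ _)
  -- With θ₁ = η the upper exponent is zero and the gain is just M_W, of order ŵ^ξw; κ is fixed by β
  -- + θ₁ - 1 - κ = ξw. With θ₂ = η + ξπ the lower exponent is ξπ, the one in the rejection balance.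
  have key := exists_polynomialDrift hπ hq (η := η) (α := α) (β := β) (α' := α') (β' := β')
    (θ := θ) (θ₁ := η) (θ₂ := η + ξπ) (κ := β + η - 1 - ξw) (ξ := ξw) (C := C) (δ₁ := δ₁)
    (R := max (max Rb Rε) (max Rw (max Rs (Rg + 1)))) (what := what) hη hα hαα' (by linarith) hβ'
    (by linarith) hθ1 hθβ hθα hη.le (by linarith) (by linarith) hηα (by linarith) (by linarith)
    (by linarith) (by linarith) (by linarith) (by linarith) (by linarith) hξw.le hξwβ hC0 hδ₁0
    (min_le_right _ _) hwhat hwhat'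
    (𝒬 := fun Q => essSup (fun x => moment Q α' β' x / ENNReal.ofReal (ψ (π x))) volume ≤ 1 ∧
        (∀ b', 1 < b' →
          (⨆ x : Space d, localMoment Q α' β' (b' * max ‖x‖ 1) /
            ENNReal.ofReal (what x ^ ξw)) ≤ K b') ∧
        (∀ b', 1 ≤ b' → ∀ x, tailQuantity π q Q what c α' β' η b' x ≤ ε b' x))
    ?_ ?_ ?_ ?_
  · exact key
  · rintro Q hQM ⟨h1, h2, h3⟩ x hx
    have hxb : Rb ≤ ‖x‖ := ((le_max_left _ _).trans (le_max_left _ _)).trans hx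
    have hxε : Rε ≤ ‖x‖ := ((le_max_right _ _).trans (le_max_left _ _)).trans hx
    have hxw : Rw ≤ ‖x‖ := ((le_max_left _ _).trans (le_max_right _ _)).trans hx
    obtain ⟨t1, t2, -⟩ := htail Q hQM h3 x hxε
    have hx0 := hπ.pos x
    have hcx := hc0 x
    have h8 : ENNReal.ofReal (δ₁ / 8) + ENNReal.ofReal (δ₁ / 8) = ENNReal.ofReal (δ₁ / 4) := by
      rw [← ENNReal.ofReal_add hδ₁8.le hδ₁8.le]; ring_nf
    constructor
    · refine (setLIntegral_increment_le hq x (measurableSet_le measurable_const hm)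
        (measurableSet_annulus hπ c x) (M := localMoment Q α' β' (b * ‖x‖))
        (N := ENNReal.ofReal (1 / c x ^ η) * localMoment Q α' β' (b * ‖x‖)) ?_).trans
        ((add_le_add t1 t2).trans_eq h8)
      filter_upwards [ae_moment_le_localMoment Q α' β' (b * ‖x‖)] with y hy hyS
      have hyS : π x ≤ π y := hyS
      have hr1 : 1 ≤ π y / π x := by rwa [one_le_div hx0]
      have hmy := hy (hRb x y hxb ((div_le_self hx0.le (hc.1 x)).trans hyS))
      by_cases hyD : y - x ∈ annulus π c x
      · refine le_add_right ?_
        rw [Set.indicator_of_mem (by exact hyD)]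
        refine (mul_le_mul' ?_ hmy).trans_eq (one_mul _)
        rw [← ENNReal.ofReal_one]
        exact ENNReal.ofReal_le_ofReal (Real.rpow_le_one_of_one_le_of_nonpos hr1 (by linarith))
      · refine le_add_left ?_
        have hrc : c x ≤ π y / π x := by
          by_contra hcon
          refine hyD ⟨?_, ?_⟩
          · rw [add_sub_cancel]
            exact le_trans ((div_le_one hcx).2 (hc.1 x)) hr1
          · rw [add_sub_cancel]
            exact (not_le.1 hcon).le
        gcongr
        rw [zero_sub, one_div, ← Real.rpow_neg hcx.le]
        exact Real.rpow_le_rpow_of_nonpos hcx hrc (by linarith)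
    · have hN : ENNReal.ofReal (Cb * (what x ^ ξπ / c x ^ ξc)) ≤ ENNReal.ofReal (δ₁ / 8) := by
        refine ENNReal.ofReal_le_ofReal ?_
        have h4 : what x ^ ξπ / c x ^ ξc ≤ δ₁ / 8 / (Cb + 1) := by
          rw [← ENNReal.ofReal_le_ofReal_iff (by positivity)]
          exact (hRw x hxw).le
        calc Cb * (what x ^ ξπ / c x ^ ξc) ≤ (Cb + 1) * (δ₁ / 8 / (Cb + 1)) := by
              have := hwhat0 x
              gcongr
              linarith
          _ = _ := by field_simp
      refine (setLIntegral_increment_le hq x (measurableSet_lt hm measurable_const)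
        (measurableSet_annulus hπ c x) (M := localMoment Q α' β' (b * ‖x‖))
        (N := ENNReal.ofReal (Cb * (what x ^ ξπ / c x ^ ξc))) ?_).trans
        ((add_le_add t1 hN).trans_eq h8)
      filter_upwards [ae_moment_le_localMoment Q α' β' (b * ‖x‖),
        ae_moment_le_of_essSup_le (fun x => one_pos.trans_le (hψ.one_le _ (hπ.pos x))) h1]
        with y hy hyψ hyS
      have hyS : π y < π x := hyS
      have hr0 : 0 < π y / π x := div_pos (hπ.pos y) hx0
      have hr1 : π y / π x ≤ 1 := (div_le_one hx0).2 hyS.le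
      by_cases hyD : y - x ∈ annulus π c x
      · refine le_add_right ?_
        rw [Set.indicator_of_mem (by exact hyD)]
        have hyc : π x / c x ≤ π y := by
          have h4 := hyD.1
          rw [add_sub_cancel, div_le_div_iff₀ hcx hx0, one_mul] at h4
          rwa [div_le_iff₀ hcx]
        refine (mul_le_mul' ?_ (hy (hRb x y hxb hyc))).trans_eq (one_mul _)
        rw [← ENNReal.ofReal_one]
        exact ENNReal.ofReal_le_ofReal (Real.rpow_le_one hr0.le hr1 (by linarith))
      · refine le_add_left ?_
        have hrc : π y / π x ≤ 1 / c x := by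
          by_contra hcon
          refine hyD ⟨?_, ?_⟩
          · rw [add_sub_cancel]
            exact (not_le.1 hcon).le
          · rw [add_sub_cancel]
            exact hr1.trans (hc.1 x)
        refine (mul_le_mul' le_rfl hyψ).trans ?_
        rw [← ENNReal.ofReal_mul (by positivity)]
        refine ENNReal.ofReal_le_ofReal ?_
        have h5 := hCb x y hyS
        have hψ0 : 0 < ψ (π y) := one_pos.trans_le (hψ.one_le _ (hπ.pos y))
        -- Off D_x a drop of π is by a factor at least c(x). The exponent left after reserving ξπ
        -- for the rejection balance exceeds ξc.
        have h6 : (π y / π x) ^ (θ - η - ξπ) ≤ 1 / c x ^ ξc := by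
          calc (π y / π x) ^ (θ - η - ξπ) ≤ (π y / π x) ^ ξc :=
                Real.rpow_le_rpow_of_exponent_ge hr0 hr1 hξc'.le
            _ ≤ (1 / c x) ^ ξc := Real.rpow_le_rpow hr0.le hrc hξc.le
            _ = _ := by rw [Real.div_rpow zero_le_one hcx.le, Real.one_rpow]
        calc (π y / π x) ^ (θ - η) * ψ (π y)
            = (π y / π x) ^ (θ - η - ξπ) * ((π y / π x) ^ ξπ * ψ (π y)) := by
              rw [← mul_assoc, ← Real.rpow_add hr0]; ring_nf
          _ ≤ 1 / c x ^ ξc * (Cb * what x ^ ξπ) := by gcongr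
          _ = _ := by ring
  · rintro Q hQM ⟨h1, h2, h3⟩ x
    have hx0 := hπ.pos x
    have hwx := hwhat0 x
    constructor
    · refine setLIntegral_increment_le_of_le hq x (measurableSet_le measurable_const hm) ?_
      filter_upwards [ae_moment_le_localMoment Q α' β' (B * max ‖x‖ 1)] with y hy hyS
      rw [sub_self, Real.rpow_zero, ENNReal.ofReal_one, one_mul]
      refine (hy (hB x y hyS)).trans ((localMoment_le_of_iSup_le hwhat (h2 B hB1) x).trans ?_)
      refine ENNReal.ofReal_le_ofReal ?_
      rw [show β + η - 1 - (β + η - 1 - ξw) = ξw by ring]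
      gcongr
      exact (le_max_left _ _).trans (le_max_left _ _)
    · refine setLIntegral_increment_le_of_le hq x (measurableSet_lt hm measurable_const) ?_
      filter_upwards [ae_moment_le_of_essSup_le
        (fun x => one_pos.trans_le (hψ.one_le _ (hπ.pos x))) h1] with y hyψ hyS
      have hr0 : 0 < π y / π x := div_pos (hπ.pos y) hx0
      refine (mul_le_mul' le_rfl hyψ).trans ?_
      rw [← ENNReal.ofReal_mul (by positivity)]
      refine ENNReal.ofReal_le_ofReal ?_
      rw [show η + ξπ - η = ξπ by ring,
        show β + (η + ξπ) - 1 - (β + η - 1 - ξw) = ξw + ξπ by ring]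
      calc (π y / π x) ^ ξπ * ψ (π y) ≤ Cb * what x ^ ξπ := hCb x y hyS
        _ ≤ C * what x ^ (ξw + ξπ) := by
          gcongr
          · exact le_trans (by linarith) (le_max_right _ _)
          · exact hwhat.1 x
          · linarith
  · rintro Q hQM ⟨h1, h2, h3⟩ x
    have hwx := hwhat0 x
    filter_upwards [ae_moment_le_localMoment Q α' β' (2 * max ‖x‖ 1)] with y hy hyx
    have h4 : ‖y‖ ≤ 2 * max ‖x‖ 1 := by
      have := le_max_left ‖x‖ 1
      have := le_max_right ‖x‖ 1
      linarith
    refine (hy h4).trans ((localMoment_le_of_iSup_le hwhat (h2 2 one_lt_two) x).trans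
      (ENNReal.ofReal_le_ofReal ?_))
    gcongr
    exact (le_max_right _ _).trans (le_max_left _ _)
  · rintro Q hQM ⟨h1, h2, h3⟩ x w hx hwx
    have hxb : Rb ≤ ‖x‖ := ((le_max_left _ _).trans (le_max_left _ _)).trans hx
    have hxε : Rε ≤ ‖x‖ := ((le_max_right _ _).trans (le_max_left _ _)).trans hx
    have hxs : Rs ≤ ‖x‖ := ((le_max_left Rs (Rg + 1)).trans
      ((le_max_right _ _).trans (le_max_right _ _))).trans hx
    have hxg : Rg + 1 ≤ ‖x‖ := ((le_max_right Rs (Rg + 1)).trans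
      ((le_max_right _ _).trans (le_max_right _ _))).trans hx
    obtain ⟨t1, -, t3⟩ := htail Q hQM h3 x hxε
    obtain ⟨hSm, hSδ, hSz⟩ := hS x hxs
    have hx0 := hπ.pos x
    have hcx := hc0 x
    have hw : 0 < (w : ℝ) := w.2
    have hDm := measurableSet_annulus hπ c x
    have hxpos : 0 < ‖x‖ := hRb0.trans_le hxb
    have hM1 : 1 ≤ localMoment Q α' β' (b * ‖x‖) :=
      one_le_localMoment Q hα' (by linarith) (by positivity)
    have hδ18 : δ₁ / 8 ≤ δ / 2 := by
      have := min_le_left (δ / 4) 1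
      linarith
    have hD : incrementProb q (annulus π c x) ≤ ENNReal.ofReal (δ / 2) := by
      calc incrementProb q (annulus π c x)
          ≤ localMoment Q α' β' (b * ‖x‖) * incrementProb q (annulus π c x) :=
            le_mul_of_one_le_left' hM1
        _ ≤ _ := t1.trans (ENNReal.ofReal_le_ofReal hδ18)
    -- Inward increments outside D_x raise π by at least the factor c(x), which compensates any
    -- weight up to ŵ(x) by condition 3.
    have hSD : ENNReal.ofReal (δ / 2) ≤ incrementProb q (S x \ annulus π c x) := by
      have h4 : incrementProb q (S x) ≤
          incrementProb q (S x \ annulus π c x) + incrementProb q (annulus π c x) := by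
        unfold incrementProb
        refine le_trans ?_ (lintegral_union_le _ _ _)
        exact lintegral_mono_set (by rw [Set.sdiff_union_self]; exact Set.subset_union_left)
      have h5 : ENNReal.ofReal (δ / 2) + ENNReal.ofReal (δ / 2) ≤
          incrementProb q (S x \ annulus π c x) + ENNReal.ofReal (δ / 2) := by
        rw [← ENNReal.ofReal_add (by positivity) (by positivity), add_halves]
        exact (hSδ.trans h4).trans (by gcongr)
      exact (ENNReal.add_le_add_iff_right ENNReal.ofReal_ne_top).1 h5
    have h6 := le_acceptRate (π := π) Q (w := w) (hSm.diff hDm) hq (k := 1 / 2) (by norm_num) hSD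
      (x := x) ?_
    · refine le_trans (ENNReal.ofReal_le_ofReal ?_) h6
      have := min_le_left (δ / 4) 1
      linarith
    · filter_upwards [ae_moment_le_localMoment Q α' β' (b * ‖x‖)] with y hy hyS
      obtain ⟨hyS, hyD⟩ := hyS
      have h7 := (hSz _ hyS).2 0 le_rfl fun y hy => hRg y (by linarith)
      rw [mul_zero, add_zero, Real.log_le_log_iff hx0 (hπ.pos _), add_sub_cancel] at h7
      have hr1 : 1 ≤ π y / π x := by rwa [one_le_div hx0]
      have hrc : c x ≤ π y / π x := by
        by_contra hcon
        refine hyD ⟨?_, ?_⟩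
        · rw [add_sub_cancel]
          exact le_trans ((div_le_one hcx).2 (hc.1 x)) hr1
        · rw [add_sub_cancel]
          exact (not_le.1 hcon).le
      have hmy := hy (hRb x y hxb ((div_le_self hx0.le (hc.1 x)).trans h7))
      refine half_le_of_one_le_add (one_le_lintegral_accProb_add hπ Q (α' := α') (β' := β') hα' hcx
        x y w (by rwa [le_div_iff₀ hx0] at hrc)) ?_
      refine (mul_le_mul' (ENNReal.ofReal_le_ofReal ?_) hmy).trans (t3.trans
        (ENNReal.ofReal_le_ofReal ?_))
      · gcongr
      · have := min_le_right (δ / 4) 1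
        linarith

/-! ### Mass near a level set, by averaging over dilations. -/

theorem lintegral_exp_neg_mul_abs_sub_le {b : ℝ} (hb : 0 < b) (t₀ : ℝ) :
    ∫⁻ s : ℝ, ENNReal.ofReal (Real.exp (-(b * |s - t₀|))) ≤ ENNReal.ofReal (2 / b) := by
  rw [lintegral_sub_right_eq_self (fun s : ℝ => ENNReal.ofReal (Real.exp (-(b * |s|)))) t₀,
    ← lintegral_add_compl _ (measurableSet_Iic (a := (0 : ℝ))), Set.compl_Iic]
  have h1 : ∫⁻ s : ℝ in Set.Iic 0, ENNReal.ofReal (Real.exp (-(b * |s|))) =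
      ENNReal.ofReal (1 / b) := by
    rw [setLIntegral_congr_fun (g := fun s => ENNReal.ofReal (Real.exp (b * s)))
      measurableSet_Iic (fun s hs => by
        simp only
        rw [abs_of_nonpos hs, mul_neg, neg_neg]),
      ← ofReal_integral_eq_lintegral_ofReal (integrableOn_exp_mul_Iic hb 0)
        (ae_of_all _ fun _ => (Real.exp_pos _).le), integral_exp_mul_Iic hb]
    simp
  have h2 : ∫⁻ s : ℝ in Set.Ioi 0, ENNReal.ofReal (Real.exp (-(b * |s|))) =
      ENNReal.ofReal (1 / b) := by
    rw [setLIntegral_congr_fun (g := fun s => ENNReal.ofReal (Real.exp (-b * s)))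
      measurableSet_Ioi (fun s hs => by
        simp only
        rw [abs_of_pos hs, neg_mul]),
      ← ofReal_integral_eq_lintegral_ofReal (integrableOn_exp_mul_Ioi (neg_neg_of_pos hb) 0)
        (ae_of_all _ fun _ => (Real.exp_pos _).le), integral_exp_mul_Ioi (neg_neg_of_pos hb)]
    simp
  rw [h1, h2, ← ENNReal.ofReal_add (by positivity) (by positivity)]
  exact (ENNReal.ofReal_le_ofReal (by rw [← add_div]; norm_num))

/-- A function of one variable decreasing at rate at least `L` spends little time near a level. -/
theorem setLIntegral_exp_neg_mul_abs_le {g : ℝ → ℝ} {a b L κ c : ℝ} (hab : a ≤ b) (hL : 0 < L)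
    (hκ : 0 < κ) (hg : ContinuousOn g (Set.Icc a b))
    (hdrop : ∀ s ∈ Set.Icc a b, ∀ s' ∈ Set.Icc a b, s ≤ s' → L * (s' - s) ≤ g s - g s') :
    ∫⁻ s in Set.Icc a b, ENNReal.ofReal (Real.exp (-(κ * |g s - c|))) ≤
      ENNReal.ofReal (2 / (κ * L)) := by
  have ha : a ∈ Set.Icc a b := ⟨le_rfl, hab⟩
  have hb : b ∈ Set.Icc a b := ⟨hab, le_rfl⟩
  -- t₀ is the time at which the level is crossed, or the nearer endpoint if it is not attained. The
  -- distance to the level grows at least like L|s - t₀|.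
  obtain ⟨t₀, ht₀⟩ : ∃ t₀, ∀ s ∈ Set.Icc a b, L * |s - t₀| ≤ |g s - c| := by
    rcases le_total (g a) c with h | h
    · refine ⟨a, fun s hs => ?_⟩
      have h1 := hdrop a ha s hs hs.1
      rw [abs_of_nonneg (sub_nonneg.2 hs.1), abs_sub_comm]
      exact le_trans (by linarith) (le_abs_self _)
    · rcases le_total c (g b) with h' | h'
      · refine ⟨b, fun s hs => ?_⟩
        have h1 := hdrop s hs b hb hs.2
        rw [abs_sub_comm, abs_of_nonneg (sub_nonneg.2 hs.2)]
        exact le_trans (by linarith) (le_abs_self _)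
      · obtain ⟨t₀, ht, rfl⟩ := intermediate_value_Icc' hab hg ⟨h', h⟩
        refine ⟨t₀, fun s hs => ?_⟩
        rcases le_total s t₀ with hst | hst
        · rw [abs_sub_comm, abs_of_nonneg (sub_nonneg.2 hst)]
          exact (hdrop s hs t₀ ht hst).trans (le_abs_self _)
        · rw [abs_of_nonneg (sub_nonneg.2 hst), abs_sub_comm]
          exact (hdrop t₀ ht s hs hst).trans (le_abs_self _)
  calc ∫⁻ s in Set.Icc a b, ENNReal.ofReal (Real.exp (-(κ * |g s - c|)))
      ≤ ∫⁻ s in Set.Icc a b, ENNReal.ofReal (Real.exp (-(κ * L * |s - t₀|))) := by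
        refine setLIntegral_mono' measurableSet_Icc fun s hs => ?_
        refine ENNReal.ofReal_le_ofReal (Real.exp_le_exp.2 ?_)
        rw [mul_assoc]
        have := ht₀ s hs
        gcongr
    _ ≤ ∫⁻ s, ENNReal.ofReal (Real.exp (-(κ * L * |s - t₀|))) := setLIntegral_le_lintegral _ _
    _ ≤ _ := lintegral_exp_neg_mul_abs_sub_le (by positivity) _

theorem lintegral_comp_smul_space {d : ℕ} {f : Space d → ℝ≥0∞} (hf : Measurable f) {s : ℝ}
    (hs : 0 < s) : ENNReal.ofReal (s ^ d) * ∫⁻ y, f (s • y) = ∫⁻ y, f y := by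
  rw [← lintegral_map hf (measurable_const_smul s), Measure.map_addHaar_smul _ hs.ne',
    lintegral_smul_measure, finrank_euclideanSpace_fin, smul_eq_mul, ← mul_assoc,
    ← ENNReal.ofReal_mul (by positivity), abs_of_pos (by positivity),
    mul_inv_cancel₀ (by positivity), ENNReal.ofReal_one, one_mul]

/-- Averaging over dilations: integrals concentrated near a level set of `π` are small when `log π`
drops quickly along rays. -/
theorem lintegral_level_le {d : ℕ} {π : Space d → ℝ} (hπ : SuperExpRegularTarget π)
    {k kstar : Space d → ℝ≥0∞} {L : Space d → ℝ} {h κ a : ℝ} (hk : Measurable k)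
    (hh : 0 < h) (hh1 : h ≤ 1) (hκ : 0 < κ)
    (hkk : ∀ (y : Space d) (s : ℝ), 1 ≤ s → s ≤ 1 + h → k (s • y) ≤ kstar y)
    (hdrop : ∀ y, kstar y ≠ 0 → 0 < L y ∧ ∀ s s' : ℝ, 1 ≤ s → s ≤ s' →
      L y * (s' - s) ≤ Real.log (π (s • y)) - Real.log (π (s' • y))) :
    ENNReal.ofReal h *
      ∫⁻ y, k y * ENNReal.ofReal (Real.exp (-(κ * |Real.log (π y) - a|))) ≤
    ENNReal.ofReal (2 ^ d) * ∫⁻ y, kstar y * ENNReal.ofReal (2 / (κ * L y)) := by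
  have hπm : Measurable π := hπ.contDiff.continuous.measurable
  have hlog : Continuous fun y => Real.log (π y) :=
    hπ.contDiff.continuous.log fun y => (hπ.pos y).ne'
  set G : Space d → ℝ≥0∞ := fun y =>
    ENNReal.ofReal (Real.exp (-(κ * |Real.log (π y) - a|))) with hG
  have hGm : Measurable G := by
    refine Continuous.measurable ?_
    exact ENNReal.continuous_ofReal.comp
      (Real.continuous_exp.comp (((hlog.sub continuous_const).abs.const_mul κ).neg))
  have hΦ : Measurable fun y => k y * G y := hk.mul hGm
  have hsm : Measurable fun z : ℝ × Space d => z.1 • z.2 :=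
    (continuous_fst.smul continuous_snd).measurable
  -- The integral is constant in s, so it equals its average after the substitution y ↦ s y, with
  -- Jacobian at most 2^d. Exchanging integrals puts the s-integral along each ray inside, where
  -- `setLIntegral_exp_neg_mul_abs_le` applies.
  calc ENNReal.ofReal h * ∫⁻ y, k y * G y
      = ∫⁻ _ in Set.Icc 1 (1 + h), (∫⁻ y, k y * G y) := by
        rw [setLIntegral_const, Real.volume_Icc, add_sub_cancel_left, mul_comm]
    _ ≤ ∫⁻ s in Set.Icc 1 (1 + h), ENNReal.ofReal (2 ^ d) * ∫⁻ y, k (s • y) * G (s • y) := by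
        refine setLIntegral_mono' measurableSet_Icc fun s hs => ?_
        rw [← lintegral_comp_smul_space hΦ (zero_lt_one.trans_le hs.1)]
        gcongr
        · linarith [hs.1]
        · linarith [hs.2]
    _ = ENNReal.ofReal (2 ^ d) *
          ∫⁻ s in Set.Icc 1 (1 + h), ∫⁻ y, k (s • y) * G (s • y) :=
        lintegral_const_mul _ (Measurable.lintegral_prod_right' (f := fun z : ℝ × Space d =>
          k (z.1 • z.2) * G (z.1 • z.2)) (hΦ.comp hsm))
    _ = ENNReal.ofReal (2 ^ d) *
          ∫⁻ y, ∫⁻ s in Set.Icc 1 (1 + h), k (s • y) * G (s • y) := by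
        rw [lintegral_lintegral_swap]
        exact (hΦ.comp hsm).aemeasurable
    _ ≤ _ := by
        gcongr with y
        rcases eq_or_ne (kstar y) 0 with h0 | h0
        · refine le_of_eq_of_le ?_ zero_le
          rw [setLIntegral_congr_fun (g := fun _ => 0) measurableSet_Icc fun s hs => ?_]
          · simp
          · have h1 := hkk y s hs.1 hs.2
            rw [h0, nonpos_iff_eq_zero] at h1
            simp [h1]
        · obtain ⟨hL, hd⟩ := hdrop y h0
          have hsy : Continuous fun s : ℝ => s • y := continuous_id.smul continuous_const
          calc ∫⁻ s in Set.Icc 1 (1 + h), k (s • y) * G (s • y)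
              ≤ ∫⁻ s in Set.Icc 1 (1 + h), kstar y * G (s • y) := by
                refine setLIntegral_mono' measurableSet_Icc fun s hs => ?_
                gcongr
                exact hkk y s hs.1 hs.2
            _ = kstar y * ∫⁻ s in Set.Icc 1 (1 + h), G (s • y) :=
                lintegral_const_mul _ (hGm.comp hsy.measurable)
            _ ≤ _ := by
                gcongr
                exact setLIntegral_exp_neg_mul_abs_le (by linarith) hL hκ
                  (hlog.comp hsy).continuousOn fun s hs s' _ hss => hd s s' hs.1 hss

/-- Since ρ > 1, the slope at s y in the direction y is even steeper than at y, so |y|^ρ serves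
along the whole outward ray. -/
theorem StrongSuperExp.log_smul_sub_ge {d : ℕ} {π : Space d → ℝ} (hπ : SuperExpRegularTarget π)
    {ρ : ℝ} (hρ : 1 < ρ) (hs : StrongSuperExp π ρ) :
    ∃ R : ℝ, 1 ≤ R ∧ ∀ y : Space d, R ≤ ‖y‖ → ∀ s s' : ℝ, 1 ≤ s → s ≤ s' →
      ‖y‖ ^ ρ * (s' - s) ≤ Real.log (π (s • y)) - Real.log (π (s' • y)) := by
  obtain ⟨R, hR0, hR⟩ := hs.inner_gradient_le 1
  refine ⟨max R 1, le_max_right _ _, fun y hy s s' hs hss => ?_⟩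
  have hγ : ∀ t : ℝ, HasDerivAt (fun t : ℝ => t • y) y t := by
    intro t
    simpa using (hasDerivAt_id t).smul_const y
  have hyR := (le_max_left R 1).trans hy
  have h := log_density_sub_le hπ hγ (C := -‖y‖ ^ ρ) hss (fun t ht => ?_)
  · linarith
  · have ht1 : 1 ≤ t := hs.trans ht.1.le
    have ht0 : 0 < t := zero_lt_one.trans_le ht1
    have hn : ‖t • y‖ = t * ‖y‖ := by rw [norm_smul, Real.norm_of_nonneg ht0.le]
    have h1 := hR (t • y) (by rw [hn]; nlinarith [norm_nonneg y])
    rw [real_inner_smul_left, hn, Real.mul_rpow ht0.le (norm_nonneg y)] at h1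
    have h2 : t ≤ t ^ ρ := Real.self_le_rpow_of_one_le ht1 hρ.le
    have h3 : 0 ≤ ‖y‖ ^ ρ := by positivity
    have h4 : t * inner ℝ y (gradient (fun y => Real.log (π y)) (t • y)) ≤ t * (-‖y‖ ^ ρ) := by
      nlinarith
    exact le_of_mul_le_mul_left h4 ht0

/-! ### Integrability of radial profiles. -/

/-- A radial profile dominating `q`, extended to the whole line. -/
theorem RadiallyDominated.exists_antitone {d : ℕ} {q : Space d → ℝ} (h : RadiallyDominated q) :
    ∃ p : ℝ → ℝ, Antitone p ∧ (∀ r, 0 ≤ p r) ∧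
      (∫⁻ z : Space d, ENNReal.ofReal (p ‖z‖) ≠ ⊤) ∧ ∀ z, q z ≤ p ‖z‖ := by
  obtain ⟨qb, h0, -, -, hanti, hint, hq⟩ := h
  have e : ∀ z : Space d, max ‖z‖ 0 = ‖z‖ := fun z => max_eq_left (norm_nonneg z)
  refine ⟨fun r => qb (max r 0), fun r s hrs => hanti (Set.mem_Ici.2 (le_max_right _ _))
    (Set.mem_Ici.2 (le_max_right _ _))
    (max_le_max_right 0 hrs), fun r => h0 _ (le_max_right _ _), ?_, fun z => ?_⟩
  · simp only [e]
    exact hint.ne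
  · simp only [e]
    exact hq z

theorem measurable_profile {d : ℕ} {p : ℝ → ℝ} (hp : Antitone p) {f : Space d → ℝ}
    (hf : Measurable f) : Measurable fun z => ENNReal.ofReal (p (f z)) :=
  (hp.measurable.comp hf).ennreal_ofReal

theorem lintegral_profile_mul_ne_top {d : ℕ} {p : ℝ → ℝ} (hp : Antitone p)
    (hint : ∫⁻ z : Space d, ENNReal.ofReal (p ‖z‖) ≠ ⊤) {a : ℝ} (ha : 0 < a) :
    ∫⁻ z : Space d, ENNReal.ofReal (p (a * ‖z‖)) ≠ ⊤ := by
  have h := lintegral_comp_smul_space (measurable_profile hp measurable_norm (d := d)) ha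
  rw [← h] at hint
  have e : ∀ z : Space d, ‖a • z‖ = a * ‖z‖ := fun z => by
    rw [norm_smul, Real.norm_of_nonneg ha.le]
  simp only [e] at hint
  intro htop
  rw [htop, ENNReal.mul_top (by simpa using pow_pos ha d)] at hint
  exact hint rfl

/-- Beyond radius 4, |z| - 2 ≥ |z|/2 and scaling applies; inside, the extended profile is bounded by
its value at -2. -/
theorem lintegral_profile_sub_ne_top {d : ℕ} {p : ℝ → ℝ} (hp : Antitone p)
    (hint : ∫⁻ z : Space d, ENNReal.ofReal (p ‖z‖) ≠ ⊤) :
    ∫⁻ z : Space d, ENNReal.ofReal (p (‖z‖ - 2)) ≠ ⊤ := by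
  have h2 := lintegral_profile_mul_ne_top hp hint (show (0 : ℝ) < 1 / 2 by norm_num)
  have hb : MeasurableSet (Metric.closedBall (0 : Space d) 4) :=
    Metric.isClosed_closedBall.measurableSet
  refine ne_top_of_le_ne_top (b := (∫⁻ z : Space d, ENNReal.ofReal (p (1 / 2 * ‖z‖))) +
    ENNReal.ofReal (p (-2)) * volume (Metric.closedBall (0 : Space d) 4))
    (ENNReal.add_ne_top.2 ⟨h2, ENNReal.mul_ne_top ENNReal.ofReal_ne_top
      measure_closedBall_lt_top.ne⟩) ?_
  rw [← lintegral_indicator_const hb,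
    ← lintegral_add_right _ (measurable_const.indicator hb)]
  refine lintegral_mono fun z => ?_
  rcases le_total ‖z‖ 4 with h | h
  · refine le_add_left ?_
    rw [Set.indicator_of_mem (by simpa using h)]
    exact ENNReal.ofReal_le_ofReal (hp (by linarith [norm_nonneg z]))
  · exact le_add_right (ENNReal.ofReal_le_ofReal (hp (by linarith)))

/-- A positive limit would be a constant lower bound, which is not integrable because the whole
space has infinite volume in positive dimension. -/
theorem profile_tendsto_zero {d : ℕ} (hd : 0 < d) {p : ℝ → ℝ} (hp : Antitone p)
    (hp0 : ∀ r, 0 ≤ p r) (hint : ∫⁻ z : Space d, ENNReal.ofReal (p ‖z‖) ≠ ⊤) :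
    Tendsto p atTop (𝓝 0) := by
  have hb : BddBelow (Set.range p) := ⟨0, by rintro _ ⟨r, rfl⟩; exact hp0 r⟩
  have h := tendsto_atTop_ciInf hp hb
  have h0 : 0 ≤ ⨅ r, p r := le_ciInf hp0
  rcases h0.eq_or_lt with h1 | h1
  · rwa [← h1] at h
  · exfalso
    have : Nonempty (Fin d) := ⟨⟨0, hd⟩⟩
    refine hint (top_unique ?_)
    calc (⊤ : ℝ≥0∞) = ∫⁻ _ : Space d, ENNReal.ofReal (⨅ r, p r) := by
          rw [lintegral_const, measure_univ_of_isAddLeftInvariant,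
            ENNReal.mul_top (ENNReal.ofReal_pos.2 h1).ne']
      _ ≤ _ := lintegral_mono fun z => ENNReal.ofReal_le_ofReal (ciInf_le hb _)

theorem SuperExpRegularTarget.dim_pos {d : ℕ} {π : Space d → ℝ}
    (hπ : SuperExpRegularTarget π) : 0 < d := by
  rcases Nat.eq_zero_or_pos d with h | h
  · subst h
    have h1 := hπ.regular_contours
    have h2 : Bornology.cobounded (Space 0) = ⊥ :=
      Bornology.cobounded_eq_bot_iff.2 inferInstance
    rw [h2] at h1
    -- In dimension zero there is no neighbourhood of infinity, and the real limsup along the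
    -- trivial filter takes the default value 0, which is not negative.
    simp [limsup, limsSup] at h1
  · exact h

/-! ### Level integrals vanish at infinity. -/

/-- The weight `e^{-κ |log π(y) - log π(x)|}` concentrating near the level set of `π` through `x`. -/
def levelWeight {d : ℕ} (π : Space d → ℝ) (κ : ℝ) (x y : Space d) : ℝ≥0∞ :=
  ENNReal.ofReal (Real.exp (-(κ * |Real.log (π y) - Real.log (π x)|)))

/-- The integral of `|y|^τ` against the proposal from `x`, concentrated near the level set of `π`
through `x`. -/
def levelIntegral {d : ℕ} (π q : Space d → ℝ) (κ τ : ℝ) (x : Space d) : ℝ≥0∞ :=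
  ∫⁻ y, ENNReal.ofReal (q (y - x)) * (levelWeight π κ x y * ENNReal.ofReal (max 1 ‖y‖ ^ τ))

/-- The radial profile at `y - x` times `|y|^τ`. -/
def profileWeight {d : ℕ} (p : ℝ → ℝ) (τ : ℝ) (x y : Space d) : ℝ≥0∞ :=
  ENNReal.ofReal (p ‖y - x‖) * ENNReal.ofReal (max 1 ‖y‖ ^ τ)

theorem measurable_profileWeight {d : ℕ} {p : ℝ → ℝ} (hp : Antitone p) (τ : ℝ) (x : Space d) :
    Measurable (profileWeight p τ x) :=
  (measurable_profile hp (measurable_id.sub_const x).norm).mul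
    ((measurable_const.max measurable_norm).pow_const _).ennreal_ofReal

theorem levelWeight_le_one {d : ℕ} (π : Space d → ℝ) {κ : ℝ} (hκ : 0 ≤ κ) (x y : Space d) :
    levelWeight π κ x y ≤ 1 := by
  unfold levelWeight
  rw [← ENNReal.ofReal_one]
  exact ENNReal.ofReal_le_ofReal (Real.exp_le_one_iff.2 (by simp; positivity))

theorem measurable_levelWeight {d : ℕ} {π : Space d → ℝ} (hπ : Measurable π) (κ : ℝ)
    (x : Space d) : Measurable (levelWeight π κ x) := by
  refine Measurable.ennreal_ofReal (Real.measurable_exp.comp (Measurable.neg ?_))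
  have h : Measurable fun y => Real.log (π y) - Real.log (π x) :=
    (Real.measurable_log.comp hπ).sub_const _
  exact (continuous_abs.measurable.comp h).const_mul κ

/-- Points comparable in norm to `x`. -/
def nearShell {d : ℕ} (x : Space d) : Set (Space d) := {y | ‖x‖ / 2 ≤ ‖y‖ ∧ ‖y‖ ≤ 2 * ‖x‖}

/-- Points of norm at least `M` whose distance to `x` is comparable to both norms. -/
def farRegion {d : ℕ} (M : ℝ) (x : Space d) : Set (Space d) :=
  {y | M ≤ ‖y‖ ∧ ‖x‖ / 2 ≤ ‖y - x‖ ∧ ‖y‖ / 3 ≤ ‖y - x‖}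

theorem measurableSet_nearShell {d : ℕ} (x : Space d) : MeasurableSet (nearShell x) :=
  (measurableSet_le measurable_const measurable_norm).inter
    (measurableSet_le measurable_norm measurable_const)

theorem measurableSet_farRegion {d : ℕ} (M : ℝ) (x : Space d) :
    MeasurableSet (farRegion M x) := by
  have h : Measurable fun y : Space d => ‖y - x‖ := (measurable_id.sub_const x).norm
  exact (measurableSet_le measurable_const measurable_norm).inter
    ((measurableSet_le measurable_const h).inter
      (measurableSet_le (measurable_norm.div_const _) h))

/-- Where |y| is comparable to |x|, dilations in [1, 1 + 1/|x|] move points by at most 2, so the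
profile survives with a shift by 2. The averaging costs |x|, the weight |x|^τ, and the slope gains
|x|^(-ρ). -/
theorem lintegral_near_le {d : ℕ} {π : Space d → ℝ} (hπ : SuperExpRegularTarget π) {p : ℝ → ℝ}
    (hp : Antitone p) {ρ τ κ M : ℝ} (hρ : 1 < ρ) (hτ : 0 ≤ τ) (hκ : 0 < κ) (hM : 1 ≤ M)
    (hdrop : ∀ y : Space d, M ≤ ‖y‖ → ∀ s s' : ℝ, 1 ≤ s → s ≤ s' →
      ‖y‖ ^ ρ * (s' - s) ≤ Real.log (π (s • y)) - Real.log (π (s' • y)))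
    {x : Space d} (hx : 4 * M ≤ ‖x‖) :
    ∫⁻ y, (nearShell x).indicator (profileWeight p τ x) y * levelWeight π κ x y ≤
      ENNReal.ofReal (2 ^ d * 2 ^ τ * 2 / κ * 4 ^ ρ * ‖x‖ ^ (-(ρ - 1 - τ))) *
        ∫⁻ z : Space d, ENNReal.ofReal (p (‖z‖ - 2)) := by
  have hx0 : 0 < ‖x‖ := by linarith
  have hx1 : 1 ≤ ‖x‖ := by linarith
  have hpm : Measurable fun y : Space d => ENNReal.ofReal (p (‖y - x‖ - 2)) :=
    measurable_profile hp ((measurable_id.sub_const x).norm.sub_const 2)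
  have h := lintegral_level_le hπ (a := Real.log (π x)) (κ := κ) (h := 1 / ‖x‖)
    (k := (nearShell x).indicator (profileWeight p τ x))
    (kstar := fun y => {y : Space d | ‖x‖ / 4 ≤ ‖y‖}.indicator
      (fun y => ENNReal.ofReal (p (‖y - x‖ - 2)) * ENNReal.ofReal ((2 * ‖x‖) ^ τ)) y)
    (L := fun _ => (‖x‖ / 4) ^ ρ)
    ((measurable_profileWeight hp τ x).indicator (measurableSet_nearShell x))
    (by positivity) (by rwa [div_le_one hx0]) hκ ?_ ?_
  · have h1 : ∫⁻ y, {y : Space d | ‖x‖ / 4 ≤ ‖y‖}.indicator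
        (fun y => ENNReal.ofReal (p (‖y - x‖ - 2)) * ENNReal.ofReal ((2 * ‖x‖) ^ τ)) y *
          ENNReal.ofReal (2 / (κ * (‖x‖ / 4) ^ ρ)) ≤
        ENNReal.ofReal ((2 * ‖x‖) ^ τ * (2 / (κ * (‖x‖ / 4) ^ ρ))) *
          ∫⁻ z : Space d, ENNReal.ofReal (p (‖z‖ - 2)) := by
      rw [← lintegral_sub_right_eq_self (fun z : Space d => ENNReal.ofReal (p (‖z‖ - 2))) x,
        ← lintegral_const_mul _ hpm]
      refine lintegral_mono fun y => ?_
      rw [ENNReal.ofReal_mul (by positivity), mul_assoc, mul_comm (ENNReal.ofReal (2 / _)),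
        ← mul_assoc]
      gcongr
      refine (Set.indicator_le_self _ _ _).trans_eq ?_
      rw [mul_comm]
    have h2 := h.trans (mul_le_mul_right h1 _)
    calc ∫⁻ y, (nearShell x).indicator (profileWeight p τ x) y * levelWeight π κ x y
        = ENNReal.ofReal ‖x‖ * (ENNReal.ofReal (1 / ‖x‖) *
          ∫⁻ y, (nearShell x).indicator (profileWeight p τ x) y * levelWeight π κ x y) := by
          rw [← mul_assoc, ← ENNReal.ofReal_mul hx0.le, mul_one_div_cancel hx0.ne',
            ENNReal.ofReal_one, one_mul]
      _ ≤ ENNReal.ofReal ‖x‖ * (ENNReal.ofReal (2 ^ d) *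
          (ENNReal.ofReal ((2 * ‖x‖) ^ τ * (2 / (κ * (‖x‖ / 4) ^ ρ))) *
          ∫⁻ z : Space d, ENNReal.ofReal (p (‖z‖ - 2)))) := by
          exact mul_le_mul_right h2 _
      _ = _ := by
          rw [← mul_assoc, ← mul_assoc, ← ENNReal.ofReal_mul hx0.le,
            ← ENNReal.ofReal_mul (by positivity)]
          congr 2
          rw [show -(ρ - 1 - τ) = 1 + τ + (-ρ) by ring, Real.rpow_add hx0, Real.rpow_add hx0,
            Real.rpow_one, Real.rpow_neg hx0.le, Real.mul_rpow two_pos.le hx0.le,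
            Real.div_rpow hx0.le (by norm_num)]
          field_simp
  · intro y s hs1 hs2
    by_cases hsy : s • y ∈ nearShell x
    · have hs0 : 0 < s := by linarith
      have hn : ‖s • y‖ = s * ‖y‖ := by rw [norm_smul, Real.norm_of_nonneg hs0.le]
      have hs2' : s ≤ 2 := by
        have : 1 / ‖x‖ ≤ 1 := by rwa [div_le_one hx0]
        linarith
      obtain ⟨h1, h2⟩ := hsy
      have hy1 : ‖x‖ / 4 ≤ ‖y‖ := by rw [hn] at h1; nlinarith [norm_nonneg y]
      have hy2 : ‖y‖ ≤ 2 * ‖x‖ := by rw [hn] at h2; nlinarith [norm_nonneg y]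
      have hdist : ‖y - x‖ - 2 ≤ ‖s • y - x‖ := by
        have e : y - x = (s • y - x) - (s - 1) • y := by module
        have h3 : ‖(s - 1) • y‖ ≤ 2 := by
          rw [norm_smul, Real.norm_of_nonneg (by linarith)]
          calc (s - 1) * ‖y‖ ≤ 1 / ‖x‖ * (2 * ‖x‖) := by gcongr; linarith
            _ = 2 := by field_simp
        have h4 := norm_sub_le (s • y - x) ((s - 1) • y)
        rw [← e] at h4
        linarith
      rw [Set.indicator_of_mem (show s • y ∈ nearShell x from ⟨h1, h2⟩),
        Set.indicator_of_mem (by exact hy1)]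
      unfold profileWeight
      gcongr
      · exact hp hdist
      · exact max_le (by linarith) h2
    · rw [Set.indicator_of_notMem hsy]
      exact zero_le
  · intro y hy
    have hy1 : y ∈ {y : Space d | ‖x‖ / 4 ≤ ‖y‖} := Set.mem_of_indicator_ne_zero hy
    rw [Set.mem_ofPred_eq] at hy1
    refine ⟨by positivity, fun s s' hs hss => le_trans ?_ (hdrop y (by linarith) s s' hs hss)⟩
    have : 0 ≤ s' - s := by linarith
    gcongr

/-- Here the profile is evaluated at distances comparable to both norms, so dilations by up to 2 are
harmless. The slope |y|^ρ absorbs |y|^τ, and smallness comes from the tail of the profile. -/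
theorem lintegral_far_le {d : ℕ} {π : Space d → ℝ} (hπ : SuperExpRegularTarget π) {p : ℝ → ℝ}
    (hp : Antitone p) {ρ τ κ M : ℝ} (hτ : 0 ≤ τ) (hτρ : τ ≤ ρ) (hκ : 0 < κ) (hM : 1 ≤ M)
    (hdrop : ∀ y : Space d, M ≤ ‖y‖ → ∀ s s' : ℝ, 1 ≤ s → s ≤ s' →
      ‖y‖ ^ ρ * (s' - s) ≤ Real.log (π (s • y)) - Real.log (π (s' • y)))
    (x : Space d) :
    ∫⁻ y, (farRegion (2 * M) x).indicator (profileWeight p τ x) y * levelWeight π κ x y ≤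
      ENNReal.ofReal (2 ^ d * 2 ^ τ * 2 / κ) *
        ∫⁻ y : Space d, ENNReal.ofReal (p (max (‖x‖ / 2) (‖y‖ / 3))) := by
  have hpm : Measurable fun y : Space d => ENNReal.ofReal (p (max (‖x‖ / 2) (‖y‖ / 3))) :=
    measurable_profile hp (measurable_const.max (measurable_norm.div_const _))
  have h := lintegral_level_le hπ (a := Real.log (π x)) (κ := κ) (h := 1)
    (k := (farRegion (2 * M) x).indicator (profileWeight p τ x))
    (kstar := fun y => {y : Space d | M ≤ ‖y‖}.indicator
      (fun y => ENNReal.ofReal (p (max (‖x‖ / 2) (‖y‖ / 3))) *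
        ENNReal.ofReal ((2 * ‖y‖) ^ τ)) y)
    (L := fun y => ‖y‖ ^ ρ)
    ((measurable_profileWeight hp τ x).indicator (measurableSet_farRegion _ x))
    one_pos le_rfl hκ ?_ ?_
  · rw [ENNReal.ofReal_one, one_mul] at h
    refine h.trans ?_
    have h1 : ∀ y : Space d, {y : Space d | M ≤ ‖y‖}.indicator
        (fun y => ENNReal.ofReal (p (max (‖x‖ / 2) (‖y‖ / 3))) *
          ENNReal.ofReal ((2 * ‖y‖) ^ τ)) y * ENNReal.ofReal (2 / (κ * ‖y‖ ^ ρ)) ≤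
        ENNReal.ofReal (2 ^ τ * 2 / κ) * ENNReal.ofReal (p (max (‖x‖ / 2) (‖y‖ / 3))) := by
      intro y
      by_cases hy : y ∈ {y : Space d | M ≤ ‖y‖}
      · rw [Set.indicator_of_mem hy, mul_assoc, mul_comm]
        gcongr
        have hy1 : 1 ≤ ‖y‖ := hM.trans hy
        have hy0 : 0 < ‖y‖ := by linarith
        rw [← ENNReal.ofReal_mul (by positivity)]
        refine ENNReal.ofReal_le_ofReal ?_
        rw [Real.mul_rpow two_pos.le hy0.le]
        calc (2 : ℝ) ^ τ * ‖y‖ ^ τ * (2 / (κ * ‖y‖ ^ ρ))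
            = 2 ^ τ * 2 / κ * (‖y‖ ^ τ / ‖y‖ ^ ρ) := by field_simp
          _ ≤ 2 ^ τ * 2 / κ * 1 := by
            gcongr
            rw [div_le_one (by positivity)]
            exact Real.rpow_le_rpow_of_exponent_le hy1 hτρ
          _ = _ := mul_one _
      · rw [Set.indicator_of_notMem hy, zero_mul]
        exact zero_le
    calc ENNReal.ofReal (2 ^ d) * _ ≤ ENNReal.ofReal (2 ^ d) * ∫⁻ y : Space d,
          ENNReal.ofReal (2 ^ τ * 2 / κ) * ENNReal.ofReal (p (max (‖x‖ / 2) (‖y‖ / 3))) := by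
          exact mul_le_mul_right (lintegral_mono h1) _
      _ = _ := by
          rw [lintegral_const_mul _ hpm, ← mul_assoc, ← ENNReal.ofReal_mul (by positivity)]
          congr 2
          ring
  · intro y s hs1 hs2
    by_cases hsy : s • y ∈ farRegion (2 * M) x
    · have hs0 : 0 < s := by linarith
      have hn : ‖s • y‖ = s * ‖y‖ := by rw [norm_smul, Real.norm_of_nonneg hs0.le]
      obtain ⟨h1, h2, h3⟩ := hsy
      have hy1 : M ≤ ‖y‖ := by rw [hn] at h1; nlinarith [norm_nonneg y]
      have hsy1 : ‖y‖ ≤ ‖s • y‖ := by rw [hn]; nlinarith [norm_nonneg y]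
      have hsy2 : ‖s • y‖ ≤ 2 * ‖y‖ := by rw [hn]; nlinarith [norm_nonneg y]
      rw [Set.indicator_of_mem (show s • y ∈ farRegion (2 * M) x from ⟨h1, h2, h3⟩),
        Set.indicator_of_mem (by exact hy1)]
      unfold profileWeight
      gcongr
      · exact hp (max_le h2 (le_trans (by linarith) h3))
      · exact max_le (by linarith) hsy2
    · rw [Set.indicator_of_notMem hsy]
      exact zero_le
  · intro y hy
    have hy1 : y ∈ {y : Space d | M ≤ ‖y‖} := Set.mem_of_indicator_ne_zero hy
    rw [Set.mem_ofPred_eq] at hy1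
    have hy0 : 0 < ‖y‖ := by linarith
    exact ⟨by positivity, hdrop y hy1⟩

theorem profile_max_tendsto_zero {d : ℕ} (hd : 0 < d) {p : ℝ → ℝ} (hp : Antitone p)
    (hp0 : ∀ r, 0 ≤ p r) (hint : ∫⁻ z : Space d, ENNReal.ofReal (p ‖z‖) ≠ ⊤) :
    Tendsto (fun R : ℝ => ∫⁻ y : Space d, ENNReal.ofReal (p (max (R / 2) (‖y‖ / 3))))
      atTop (𝓝 0) := by
  have h3 := lintegral_profile_mul_ne_top hp hint (show (0 : ℝ) < 1 / 3 by norm_num)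
  have hz := profile_tendsto_zero hd hp hp0 hint
  have h := tendsto_lintegral_filter_of_dominated_convergence (μ := (volume : Measure (Space d)))
    (l := (atTop : Filter ℝ)) (F := fun R y => ENNReal.ofReal (p (max (R / 2) (‖y‖ / 3))))
    (f := fun _ => 0) (fun z : Space d => ENNReal.ofReal (p (1 / 3 * ‖z‖)))
    (Eventually.of_forall fun R =>
      measurable_profile hp (measurable_const.max (measurable_norm.div_const _)))
    (Eventually.of_forall fun R => ae_of_all _ fun y => ENNReal.ofReal_le_ofReal
      (hp (by rw [one_div, inv_mul_eq_div]; exact le_max_right _ _))) h3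
    (ae_of_all _ fun y => ?_)
  · simpa using h
  · have h4 : Tendsto (fun R : ℝ => max (R / 2) (‖y‖ / 3)) atTop atTop :=
      tendsto_atTop_mono (fun R => le_max_left _ _) (tendsto_id.atTop_div_const two_pos)
    have h5 := (ENNReal.continuous_ofReal.tendsto 0).comp (hz.comp h4)
    rw [ENNReal.ofReal_zero] at h5
    exact h5

/-- The level integrals vanish at infinity and are bounded. -/
theorem levelIntegral_tendsto_zero {d : ℕ} {π q : Space d → ℝ} (hπ : SuperExpRegularTarget π)
    (hq : SymmetricIncrement q) {ρ τ κ : ℝ} (hρ : 1 < ρ) (hs : StrongSuperExp π ρ)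
    (hrad : RadiallyDominated q) (hτ : 0 ≤ τ) (hτρ : τ < ρ - 1) (hκ : 0 < κ) :
    Tendsto (levelIntegral π q κ τ) (Bornology.cobounded (Space d)) (𝓝 0) ∧
      ∃ D : ℝ, 0 ≤ D ∧ ∀ x, levelIntegral π q κ τ x ≤ ENNReal.ofReal D := by
  have hπm : Measurable π := hπ.contDiff.continuous.measurable
  obtain ⟨p, hp, hp0, hint, hqp⟩ := hrad.exists_antitone
  obtain ⟨M, hM1, hM⟩ := hs.log_smul_sub_ge hπ hρ
  have hfar := fun x => lintegral_far_le hπ hp hτ (show τ ≤ ρ by linarith) hκ hM1 hM x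
  have hNm : ∀ x : Space d, Measurable fun y =>
      (nearShell x).indicator (profileWeight p τ x) y * levelWeight π κ x y := fun x =>
    ((measurable_profileWeight hp τ x).indicator (measurableSet_nearShell x)).mul
      (measurable_levelWeight hπm κ x)
  have hFm : ∀ x : Space d, Measurable fun y =>
      (farRegion (2 * M) x).indicator (profileWeight p τ x) y * levelWeight π κ x y := fun x =>
    ((measurable_profileWeight hp τ x).indicator (measurableSet_farRegion _ x)).mul
      (measurable_levelWeight hπm κ x)
  have hbm : MeasurableSet (Metric.ball (0 : Space d) (2 * M)) := measurableSet_ball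
  have hle : ∀ x y : Space d, ENNReal.ofReal (q (y - x)) *
      (levelWeight π κ x y * ENNReal.ofReal (max 1 ‖y‖ ^ τ)) ≤
      profileWeight p τ x y * levelWeight π κ x y := by
    intro x y
    unfold profileWeight
    rw [mul_comm (levelWeight π κ x y), ← mul_assoc]
    gcongr
    exact hqp _
  have hbound : ∀ x : Space d, 4 * M ≤ ‖x‖ → levelIntegral π q κ τ x ≤
      ENNReal.ofReal (2 ^ d * 2 ^ τ * 2 / κ * 4 ^ ρ * ‖x‖ ^ (-(ρ - 1 - τ))) *
        (∫⁻ z : Space d, ENNReal.ofReal (p (‖z‖ - 2))) +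
      ENNReal.ofReal (2 ^ d * 2 ^ τ * 2 / κ) *
        (∫⁻ y : Space d, ENNReal.ofReal (p (max (‖x‖ / 2) (‖y‖ / 3)))) +
      ENNReal.ofReal (p (‖x‖ / 2)) * (ENNReal.ofReal ((2 * M) ^ τ) *
        volume (Metric.ball (0 : Space d) (2 * M))) := by
    intro x hx
    refine le_trans ?_ (add_le_add (add_le_add
      (lintegral_near_le hπ hp hρ hτ hκ hM1 hM hx) (hfar x)) le_rfl)
    rw [← mul_assoc, ← lintegral_indicator_const hbm, ← lintegral_add_left (hNm x),
      ← lintegral_add_right _ (measurable_const.indicator hbm)]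
    refine lintegral_mono fun y => ?_
    -- Outside the shell y either has norm below 2M, at distance at least |x|/2 from x, or is in the
    -- far region. The ball has finite volume and contributes a multiple of the profile at |x|/2.
    by_cases hyN : y ∈ nearShell x
    · refine le_add_right (le_add_right ?_)
      rw [Set.indicator_of_mem hyN]
      exact hle x y
    · have htri : ‖y‖ ≤ ‖y - x‖ + ‖x‖ := by
        have := norm_add_le (y - x) x
        rwa [sub_add_cancel] at this
      have htri' : ‖x‖ ≤ ‖y - x‖ + ‖y‖ := by
        have := norm_sub_le y (y - x)
        rw [sub_sub_cancel] at this
        linarith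
      rcases lt_or_ge ‖y‖ (2 * M) with hyM | hyM
      · refine le_add_left ?_
        rw [Set.indicator_of_mem (by simpa using hyM)]
        calc ENNReal.ofReal (q (y - x)) * (levelWeight π κ x y * ENNReal.ofReal (max 1 ‖y‖ ^ τ))
            ≤ ENNReal.ofReal (p (‖x‖ / 2)) * (1 * ENNReal.ofReal ((2 * M) ^ τ)) := by
              gcongr
              · exact (hqp _).trans (hp (by linarith))
              · exact levelWeight_le_one π hκ.le x y
              · exact max_le (by linarith) hyM.le
          _ = _ := by rw [one_mul]
      · refine le_add_right (le_add_left ?_)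
        rw [Set.indicator_of_mem]
        · exact hle x y
        · by_cases h1 : ‖x‖ / 2 ≤ ‖y‖
          · have h2 : 2 * ‖x‖ < ‖y‖ := by
              by_contra hc
              exact hyN ⟨h1, not_lt.1 hc⟩
            exact ⟨hyM, by linarith [norm_nonneg x], by linarith [norm_nonneg y]⟩
          · push Not at h1
            exact ⟨hyM, by linarith, by linarith⟩
  have hzero : Tendsto (levelIntegral π q κ τ) (Bornology.cobounded (Space d)) (𝓝 0) := by
    have hnorm := tendsto_norm_cobounded_atTop (E := Space d)
    have hz := profile_tendsto_zero hπ.dim_pos hp hp0 hint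
    have t1 : Tendsto (fun x : Space d =>
        ENNReal.ofReal (2 ^ d * 2 ^ τ * 2 / κ * 4 ^ ρ * ‖x‖ ^ (-(ρ - 1 - τ))) *
        (∫⁻ z : Space d, ENNReal.ofReal (p (‖z‖ - 2)))) (Bornology.cobounded (Space d)) (𝓝 0) := by
      have h1 := ((tendsto_rpow_neg_atTop (show 0 < ρ - 1 - τ by linarith)).comp hnorm).const_mul
        (2 ^ d * 2 ^ τ * 2 / κ * 4 ^ ρ)
      rw [mul_zero] at h1
      have h2 := (ENNReal.continuous_ofReal.tendsto 0).comp h1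
      rw [ENNReal.ofReal_zero] at h2
      have h3 := ENNReal.Tendsto.mul_const h2 (Or.inr (lintegral_profile_sub_ne_top hp hint))
      rwa [zero_mul] at h3
    have t2 : Tendsto (fun x : Space d => ENNReal.ofReal (2 ^ d * 2 ^ τ * 2 / κ) *
        (∫⁻ y : Space d, ENNReal.ofReal (p (max (‖x‖ / 2) (‖y‖ / 3)))))
        (Bornology.cobounded (Space d)) (𝓝 0) := by
      have h3 := ENNReal.Tendsto.const_mul
        ((profile_max_tendsto_zero hπ.dim_pos hp hp0 hint).comp hnorm)
        (Or.inr (ENNReal.ofReal_ne_top (r := 2 ^ d * 2 ^ τ * 2 / κ)))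
      rwa [mul_zero] at h3
    have t3 : Tendsto (fun x : Space d => ENNReal.ofReal (p (‖x‖ / 2)) *
        (ENNReal.ofReal ((2 * M) ^ τ) * volume (Metric.ball (0 : Space d) (2 * M))))
        (Bornology.cobounded (Space d)) (𝓝 0) := by
      have h2 := (ENNReal.continuous_ofReal.tendsto 0).comp
        (hz.comp (hnorm.atTop_div_const two_pos))
      rw [ENNReal.ofReal_zero] at h2
      have h3 := ENNReal.Tendsto.mul_const h2 (Or.inr (ENNReal.mul_ne_top
        (ENNReal.ofReal_ne_top (r := (2 * M) ^ τ))
        (measure_ball_lt_top (μ := volume) (x := (0 : Space d)) (r := 2 * M)).ne))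
      rwa [zero_mul] at h3
    have t := (t1.add t2).add t3
    rw [add_zero, add_zero] at t
    refine tendsto_of_tendsto_of_tendsto_of_le_of_le' tendsto_const_nhds t
      (Eventually.of_forall fun _ => zero_le) ?_
    filter_upwards [hnorm.eventually_ge_atTop (4 * M)] with x hx
    exact hbound x hx
  refine ⟨hzero, ?_⟩
  obtain ⟨R, hR0, hR⟩ := exists_norm_of_eventually_cobounded
    (hzero.eventually (eventually_le_nhds zero_lt_one))
  -- For |x| < R, points with |y| ≤ 2R' cost at most (2R')^τ since q has mass one, and all others
  -- lie in the far region.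
  set R' := max R M with hR'
  have hR'1 : 1 ≤ R' := hM1.trans (le_max_right _ _)
  have hF : ∫⁻ z : Space d, ENNReal.ofReal (p (1 / 3 * ‖z‖)) ≠ ⊤ :=
    lintegral_profile_mul_ne_top hp hint (by norm_num)
  set T := ENNReal.ofReal ((2 * R') ^ τ) + ENNReal.ofReal (2 ^ d * 2 ^ τ * 2 / κ) *
    ∫⁻ z : Space d, ENNReal.ofReal (p (1 / 3 * ‖z‖)) with hT
  have hTtop : T ≠ ⊤ :=
    ENNReal.add_ne_top.2 ⟨ENNReal.ofReal_ne_top, ENNReal.mul_ne_top ENNReal.ofReal_ne_top hF⟩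
  refine ⟨1 + T.toReal, by positivity, fun x => ?_⟩
  rw [ENNReal.ofReal_add zero_le_one ENNReal.toReal_nonneg, ENNReal.ofReal_one,
    ENNReal.ofReal_toReal hTtop]
  rcases le_or_gt R ‖x‖ with hx | hx
  · exact le_add_right (hR x hx)
  · refine le_add_left ?_
    have hF' : ENNReal.ofReal (2 ^ d * 2 ^ τ * 2 / κ) *
        (∫⁻ y : Space d, ENNReal.ofReal (p (max (‖x‖ / 2) (‖y‖ / 3)))) ≤
        ENNReal.ofReal (2 ^ d * 2 ^ τ * 2 / κ) *
          ∫⁻ z : Space d, ENNReal.ofReal (p (1 / 3 * ‖z‖)) := by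
      gcongr with y
      exact hp (by rw [one_div, inv_mul_eq_div]; exact le_max_right _ _)
    have hS : ∫⁻ y, ENNReal.ofReal (q (y - x)) * ENNReal.ofReal ((2 * R') ^ τ) =
        ENNReal.ofReal ((2 * R') ^ τ) := by
      rw [lintegral_mul_const _ (hq.measurable_shift x), hq.lintegral_shift, one_mul]
    rw [hT, ← hS]
    refine le_trans ?_ (add_le_add le_rfl ((hfar x).trans hF'))
    rw [← lintegral_add_left ((hq.measurable_shift x).mul_const _)]
    refine lintegral_mono fun y => ?_
    rcases le_or_gt ‖y‖ (2 * R') with hy | hy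
    · refine le_add_right ?_
      gcongr
      calc levelWeight π κ x y * ENNReal.ofReal (max 1 ‖y‖ ^ τ)
          ≤ 1 * ENNReal.ofReal ((2 * R') ^ τ) := by
            gcongr
            · exact levelWeight_le_one π hκ.le x y
            · exact max_le (by linarith) hy
        _ = _ := one_mul _
    · refine le_add_left ?_
      have htri : ‖y‖ ≤ ‖y - x‖ + ‖x‖ := by
        have := norm_add_le (y - x) x
        rwa [sub_add_cancel] at this
      have hRR := le_max_left R M
      have hMR := le_max_right R M
      rw [Set.indicator_of_mem]
      · exact hle x y
      · exact ⟨by linarith, by linarith [norm_nonneg x], by linarith [norm_nonneg y]⟩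

/-! ### Drift under polynomially growing moments. -/

theorem div_rpow_eq_exp {a b : ℝ} (ha : 0 < a) (hb : 0 < b) (e : ℝ) :
    (a / b) ^ e = Real.exp (e * (Real.log a - Real.log b)) := by
  rw [Real.rpow_def_of_pos (div_pos ha hb), Real.log_div ha.ne' hb.ne', mul_comm]

theorem gain_le_levelIntegral {d : ℕ} {π q : Space d → ℝ} {Q : Kernel (Space d) Weight}
    {a b e κ C τ : ℝ} (hC : 0 ≤ C)
    (hQ : ∀ y, moment Q a b y ≤ ENNReal.ofReal (C * max 1 ‖y‖ ^ τ)) (x : Space d)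
    {S : Set (Space d)} (hS : MeasurableSet S)
    (h : ∀ y ∈ S, ENNReal.ofReal ((π y / π x) ^ e) ≤ levelWeight π κ x y) :
    ∫⁻ y in S, ENNReal.ofReal (q (y - x)) * (ENNReal.ofReal ((π y / π x) ^ e) * moment Q a b y) ≤
      ENNReal.ofReal C * levelIntegral π q κ τ x := by
  unfold levelIntegral
  rw [← lintegral_const_mul' _ _ ENNReal.ofReal_ne_top]
  refine (setLIntegral_mono' hS fun y hy => ?_).trans (setLIntegral_le_lintegral _ _)
  calc ENNReal.ofReal (q (y - x)) * (ENNReal.ofReal ((π y / π x) ^ e) * moment Q a b y)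
      ≤ ENNReal.ofReal (q (y - x)) * (levelWeight π κ x y *
          (ENNReal.ofReal C * ENNReal.ofReal (max 1 ‖y‖ ^ τ))) := by
        rw [← ENNReal.ofReal_mul hC]
        gcongr
        · exact h y hy
        · exact hQ y
    _ = _ := by ring

theorem upperGain_le_levelIntegral {d : ℕ} {π q : Space d → ℝ} (hπ : SuperExpRegularTarget π)
    {Q : Kernel (Space d) Weight} {a b e κ C τ : ℝ} (hC : 0 ≤ C)
    (hQ : ∀ y, moment Q a b y ≤ ENNReal.ofReal (C * max 1 ‖y‖ ^ τ)) (he : e ≤ -κ) (x : Space d) :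
    upperGain π q Q a b e x ≤ ENNReal.ofReal C * levelIntegral π q κ τ x := by
  refine gain_le_levelIntegral hC hQ x
    (measurableSet_le measurable_const hπ.contDiff.continuous.measurable) fun y hy => ?_
  have h1 := sub_nonneg.2 (Real.log_le_log (hπ.pos x) hy)
  unfold levelWeight
  rw [div_rpow_eq_exp (hπ.pos y) (hπ.pos x), abs_of_nonneg h1]
  refine ENNReal.ofReal_le_ofReal (Real.exp_le_exp.2 ?_)
  nlinarith

theorem lowerGain_le_levelIntegral {d : ℕ} {π q : Space d → ℝ} (hπ : SuperExpRegularTarget π)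
    {Q : Kernel (Space d) Weight} {a b e κ C τ : ℝ} (hC : 0 ≤ C)
    (hQ : ∀ y, moment Q a b y ≤ ENNReal.ofReal (C * max 1 ‖y‖ ^ τ)) (he : κ ≤ e) (x : Space d) :
    lowerGain π q Q a b e x ≤ ENNReal.ofReal C * levelIntegral π q κ τ x := by
  refine gain_le_levelIntegral hC hQ x
    (measurableSet_lt hπ.contDiff.continuous.measurable measurable_const) fun y hy => ?_
  have hy : π y < π x := hy
  have h1 := sub_nonpos.2 (Real.log_le_log (hπ.pos y) hy.le)
  unfold levelWeight
  rw [div_rpow_eq_exp (hπ.pos y) (hπ.pos x), abs_of_nonpos h1]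
  refine ENNReal.ofReal_le_ofReal (Real.exp_le_exp.2 ?_)
  nlinarith

theorem tendsto_rpow_mul_exp_neg_mul_rpow {a b c : ℝ} (hb : 0 < b) (hc : 0 < c) :
    Tendsto (fun R : ℝ => R ^ a * Real.exp (-b * R ^ c)) atTop (𝓝 0) := by
  refine ((tendsto_rpow_mul_exp_neg_mul_atTop_nhds_zero (a / c) b hb).comp
    (tendsto_rpow_atTop hc)).congr' ?_
  filter_upwards [eventually_gt_atTop 0] with R hR
  simp only [Function.comp]
  rw [← Real.rpow_mul hR.le, mul_div_cancel₀ _ hc.ne']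

theorem locallyBoundedGeOne_max_rpow (d : ℕ) {k : ℝ} (hk : 0 ≤ k) :
    LocallyBoundedGeOne (fun x : Space d => max 1 ‖x‖ ^ k) := by
  refine ⟨fun x => Real.one_le_rpow (le_max_left _ _) hk, fun K hK => hK.bddAbove_image ?_⟩
  exact ((continuous_const.max continuous_norm).rpow_const fun _ => Or.inr hk).continuousOn

set_option maxHeartbeats 1000000 in
/-- Polynomial drift when the moments grow polynomially, more slowly than the radial slope of
`log π`. -/
theorem exists_polynomialDrift_of_strongSuperExp {d : ℕ} {π q : Space d → ℝ}
    (hπ : SuperExpRegularTarget π) (hq : SymmetricIncrement q) {ρ : ℝ} (hρ : 1 < ρ)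
    (hs : StrongSuperExp π ρ) (hrad : RadiallyDominated q) {α' β' C ρ' : ℝ}
    (hα' : 0 < α') (hβ' : 1 < β') (hρ'0 : 0 ≤ ρ') (hρ' : ρ' < ρ - 1) {η α β : ℝ} (hη : 0 < η)
    (hη1 : η < 1) (hηα : η < α) (hαα' : α ≤ α') (hβ : 1 - η < β) (hββ' : β < β' - η) :
    ∃ M wlo whi b δ : ℝ, 1 ≤ M ∧ 0 < wlo ∧ wlo ≤ 1 ∧ 1 ≤ whi ∧ 1 ≤ b ∧ 0 < δ ∧
      ∀ (Q : Kernel (Space d) Weight) [IsMarkovKernel Q], UnitMean Q →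
        (∀ x, moment Q α' β' x ≤ ENNReal.ofReal (C * max 1 ‖x‖ ^ ρ')) →
        PolynomialDrift π q Q η α β M wlo whi b δ := by
  -- exponents
  set θ := min (β' - β) (min α 1) with hθ
  have hθβ : θ ≤ β' - β := min_le_left _ _
  have hθα : θ ≤ α := (min_le_right _ _).trans (min_le_left _ _)
  have hθ1 : θ ≤ 1 := (min_le_right _ _).trans (min_le_right _ _)
  have hηθ : η < θ := lt_min (by linarith) (lt_min hηα hη1)
  -- The midpoint of 1 - β and η, truncated at zero: β + θ₁ - 1 must be positive while θ₁ stays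
  -- below η.
  set θ₁ := max 0 ((1 - β + η) / 2) with hθ₁
  have hθ₁0 : 0 ≤ θ₁ := le_max_left _ _
  have hθ₁η : θ₁ < η := max_lt hη (by linarith)
  have hθ₁β : 0 < β + θ₁ - 1 := by
    have := le_max_right 0 ((1 - β + η) / 2)
    linarith
  set θ₂ := (η + θ) / 2 with hθ₂
  -- One rate κ for which the level weight dominates the density ratios in all four gains: exponents
  -- -η and θ₁ - η upwards, θ₂ - η and θ - η downwards.
  set κ := min (η - θ₁) (θ₂ - η) with hκ
  have hκ0 : 0 < κ := lt_min (by linarith) (by linarith)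
  have hκ₁ : κ ≤ η - θ₁ := min_le_left _ _
  have hκ₂ : κ ≤ θ₂ - η := min_le_right _ _
  set ξ := (β' - 1) / 2 with hξ
  have hξ0 : 0 < ξ := by linarith
  -- With ŵ = (1 ∨ |x|)^k the moment bound of order (1 ∨ |x|)^ρ' is at most of order ŵ^ξ; adding 1
  -- keeps k positive when ρ' = 0.
  set k := ρ' / ξ + 1 with hk
  have hk0 : 0 < k := by positivity
  have hkξ : ρ' ≤ k * ξ := by
    rw [hk, add_mul, div_mul_cancel₀ _ hξ0.ne']
    linarith
  have hwhat := locallyBoundedGeOne_max_rpow d hk0.le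
  have hwhat' : Tendsto (fun x : Space d => max 1 ‖x‖ ^ k) (Bornology.cobounded (Space d))
      atTop := by
    refine (tendsto_rpow_atTop hk0).comp ?_
    exact tendsto_atTop_mono (fun x => le_max_right _ _) tendsto_norm_cobounded_atTop
  -- constants
  obtain ⟨hzero, D, hD0, hD⟩ := levelIntegral_tendsto_zero hπ hq hρ hs hrad hρ'0 hρ' hκ0
  obtain ⟨t, δ, Rs, S, ht, hδ, hRs0, hS⟩ := exists_inward_increments hπ hq
  obtain ⟨Rg, hRg0, hRg⟩ := hs.inner_gradient_le 1
  set C₁ := max C 1 with hC₁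
  have hC₁0 : 0 < C₁ := by positivity
  set δ₁ := min (δ / 2) 1 with hδ₁
  have hδ₁0 : 0 < δ₁ := by positivity
  obtain ⟨Rz, hRz0, hRz⟩ := exists_norm_of_eventually_cobounded
    (hzero.eventually (eventually_le_nhds (show 0 < ENNReal.ofReal (δ₁ / 4 / C₁) by
      rw [ENNReal.ofReal_pos]; positivity)))
  -- An inward step multiplies π by e^(tL) with L of order |x|^(ρ-1), which overwhelms the powers of
  -- |x| coming from ŵ and the moments.
  obtain ⟨Re, hRe⟩ : ∃ Re : ℝ, ∀ r, Re ≤ r → C₁ * 2 ^ ρ' * (r ^ (k * α' + ρ') *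
      Real.exp (-(t * (1 / 2) ^ (ρ - 1) * α') * r ^ (ρ - 1))) ≤ 1 / 2 := by
    have h := (tendsto_rpow_mul_exp_neg_mul_rpow (a := k * α' + ρ') (c := ρ - 1)
      (show 0 < t * (1 / 2) ^ (ρ - 1) * α' by positivity) (by linarith)).const_mul (C₁ * 2 ^ ρ')
    rw [mul_zero] at h
    exact eventually_atTop.1 (h.eventually (eventually_le_nhds (by norm_num)))
  have hmom : ∀ Q : Kernel (Space d) Weight,
      (∀ x, moment Q α' β' x ≤ ENNReal.ofReal (C * max 1 ‖x‖ ^ ρ')) →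
      ∀ x, moment Q α' β' x ≤ ENNReal.ofReal (C₁ * max 1 ‖x‖ ^ ρ') := by
    intro Q hQ x
    refine (hQ x).trans (ENNReal.ofReal_le_ofReal ?_)
    gcongr
    exact le_max_left _ _
  set C₂ := max (C₁ * 2 ^ ρ') (C₁ * D) with hC₂
  have hC₂0 : 0 < C₂ := lt_max_of_lt_left (by positivity)
  -- The criterion's κ is β + θ₁ - 1, so the allowed growth exponents are 0 and θ₂ - θ₁ ≥ 0.
  -- Boundedness of the level integrals is then enough.
  refine exists_polynomialDrift hπ hq (η := η) (α := α) (β := β) (α' := α') (β' := β')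
    (θ := θ) (θ₁ := θ₁) (θ₂ := θ₂) (κ := β + θ₁ - 1) (ξ := ξ) (C := C₂) (δ₁ := δ₁)
    (R := max (max Rs Rz) (max Re (max (Rg + 1) 2))) (what := fun x => max 1 ‖x‖ ^ k)
    hη (by linarith) hαα' (by linarith) hβ'
    (by linarith) hθ1 hθβ hθα hθ₁0 (by linarith) (by linarith) (by linarith)
    (by linarith) (by linarith) (by linarith) (by linarith) hθ₁β (by linarith) (by linarith)
    hξ0.le (by linarith) hC₂0 hδ₁0 (min_le_right _ _) hwhat hwhat'
    (𝒬 := fun Q => ∀ x, moment Q α' β' x ≤ ENNReal.ofReal (C * max 1 ‖x‖ ^ ρ')) ?_ ?_ ?_ ?_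
  · intro Q _ hQ x hx
    have hxz : Rz ≤ ‖x‖ := ((le_max_right _ _).trans (le_max_left _ _)).trans hx
    have h : ENNReal.ofReal C₁ * levelIntegral π q κ ρ' x ≤ ENNReal.ofReal (δ₁ / 4) :=
      calc ENNReal.ofReal C₁ * levelIntegral π q κ ρ' x
          ≤ ENNReal.ofReal C₁ * ENNReal.ofReal (δ₁ / 4 / C₁) := by
            gcongr
            exact hRz x hxz
        _ = _ := by
            rw [← ENNReal.ofReal_mul hC₁0.le, mul_div_cancel₀ _ hC₁0.ne']
    exact ⟨(upperGain_le_levelIntegral hπ hC₁0.le (hmom Q hQ) (by linarith) x).trans h,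
      (lowerGain_le_levelIntegral hπ hC₁0.le (hmom Q hQ) (by linarith) x).trans h⟩
  · intro Q _ hQ x
    have h : ∀ e : ℝ, 0 ≤ e → ENNReal.ofReal C₁ * levelIntegral π q κ ρ' x ≤
        ENNReal.ofReal (C₂ * (max 1 ‖x‖ ^ k) ^ e) := by
      intro e he
      have hw : 1 ≤ (max 1 ‖x‖ ^ k) ^ e := Real.one_le_rpow (hwhat.1 x) he
      calc ENNReal.ofReal C₁ * levelIntegral π q κ ρ' x
          ≤ ENNReal.ofReal C₁ * ENNReal.ofReal D := by
            gcongr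
            exact hD x
        _ = ENNReal.ofReal (C₁ * D) := (ENNReal.ofReal_mul hC₁0.le).symm
        _ ≤ _ := by
            refine ENNReal.ofReal_le_ofReal ?_
            have := le_max_right (C₁ * 2 ^ ρ') (C₁ * D)
            nlinarith
    exact ⟨(upperGain_le_levelIntegral hπ hC₁0.le (hmom Q hQ) (by linarith) x).trans
        (h _ (by linarith)),
      (lowerGain_le_levelIntegral hπ hC₁0.le (hmom Q hQ) (by linarith) x).trans
        (h _ (by linarith))⟩
  · intro Q _ hQ x
    refine ae_of_all _ fun y hy => (hmom Q hQ y).trans (ENNReal.ofReal_le_ofReal ?_)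
    have h1 : max 1 ‖y‖ ≤ 2 * max 1 ‖x‖ := by
      have := le_max_left 1 ‖x‖
      have := le_max_right 1 ‖x‖
      exact max_le (by linarith) (by linarith)
    calc C₁ * max 1 ‖y‖ ^ ρ' ≤ C₁ * (2 * max 1 ‖x‖) ^ ρ' := by gcongr
      _ = C₁ * 2 ^ ρ' * max 1 ‖x‖ ^ ρ' := by
        rw [Real.mul_rpow two_pos.le (by positivity)]; ring
      _ ≤ C₂ * max 1 ‖x‖ ^ (k * ξ) := by
        gcongr
        · exact le_max_left _ _
        · exact le_max_left _ _
      _ = _ := by rw [Real.rpow_mul (by positivity)]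
  · intro Q _ hQ x w hx hwx
    have hxs : Rs ≤ ‖x‖ := ((le_max_left _ _).trans (le_max_left _ _)).trans hx
    have hxe : Re ≤ ‖x‖ := ((le_max_left _ _).trans (le_max_right _ _)).trans hx
    have hxg : Rg + 1 ≤ ‖x‖ := ((le_max_left _ _).trans
      ((le_max_right _ _).trans (le_max_right _ _))).trans hx
    have hx2 : 2 ≤ ‖x‖ := ((le_max_right _ _).trans
      ((le_max_right _ _).trans (le_max_right _ _))).trans hx
    have hx0 : 0 < ‖x‖ := by linarith
    have hw : 0 < (w : ℝ) := w.2
    obtain ⟨hSm, hSδ, hSz⟩ := hS x hxs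
    set L := (1 / 2 * ‖x‖) ^ (ρ - 1) with hL
    have hL0 : 0 ≤ L := by positivity
    have h6 := le_acceptRate (π := π) Q (w := w) hSm hq (k := 1 / 2) (by norm_num) hSδ
      (x := x) ?_
    · refine le_trans (ENNReal.ofReal_le_ofReal ?_) h6
      have := min_le_left (δ / 2) 1
      linarith
    · refine ae_of_all _ fun y hyS => ?_
      obtain ⟨hz1, hzL⟩ := hSz _ hyS
      have h7 := hzL L hL0 fun v hv => by
        have hv0 : 0 < ‖v‖ := by linarith
        refine (hRg v (by linarith)).trans ?_
        have e1 : ‖v‖ ^ ρ = ‖v‖ ^ (ρ - 1) * ‖v‖ := by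
          rw [← Real.rpow_add_one hv0.ne', sub_add_cancel]
        have e2 : L ≤ ‖v‖ ^ (ρ - 1) :=
          Real.rpow_le_rpow (by positivity) (by linarith) (by linarith)
        rw [e1]
        nlinarith
      rw [add_sub_cancel] at h7
      have hπy : Real.exp (t * L) * π x ≤ π y := by
        rw [← Real.exp_log (hπ.pos x), ← Real.exp_log (hπ.pos y), ← Real.exp_add]
        exact Real.exp_le_exp.2 (by linarith)
      have hyn : ‖y‖ ≤ 2 * ‖x‖ := by
        have := norm_add_le x (y - x)
        rw [add_sub_cancel] at this
        linarith
      refine half_le_of_one_le_add_mul (by positivity)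
        (one_le_lintegral_accProb_add hπ Q (α' := α') (β' := β') hα' (Real.exp_pos (t * L))
          x y w hπy) (hmom Q hQ y) (le_trans ?_ (hRe ‖x‖ hxe))
      have hwx' : (w : ℝ) ≤ ‖x‖ ^ k := by
        rwa [max_eq_right (by linarith : (1 : ℝ) ≤ ‖x‖)] at hwx
      have hmax : max 1 ‖y‖ ≤ 2 * ‖x‖ := max_le (by linarith) hyn
      calc ((w : ℝ) / Real.exp (t * L)) ^ α' * (C₁ * max 1 ‖y‖ ^ ρ')
          ≤ (‖x‖ ^ k / Real.exp (t * L)) ^ α' * (C₁ * (2 * ‖x‖) ^ ρ') := by gcongr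
        _ = _ := by
          rw [Real.div_rpow (by positivity) (Real.exp_pos _).le, ← Real.rpow_mul hx0.le,
            ← Real.exp_mul, Real.mul_rpow two_pos.le hx0.le, Real.rpow_add hx0, hL,
            Real.mul_rpow (by norm_num) hx0.le, div_eq_mul_inv, ← Real.exp_neg]
          rw [show -(t * ((1 / 2) ^ (ρ - 1) * ‖x‖ ^ (ρ - 1)) * α') =
            -(t * (1 / 2) ^ (ρ - 1) * α') * ‖x‖ ^ (ρ - 1) by ring]
          ring

end

end PseudoMarginal

theorem mainTheorem6 {d : ℕ} (π q : PseudoMarginal.Space d → ℝ)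
    (hπ : PseudoMarginal.SuperExpRegularTarget π) (hq : PseudoMarginal.SymmetricIncrement q) :
    -- drift under non-uniform moment bounds; the constants are chosen before the weight laws `Q`,
    -- which enter only through the bounds `K` and `ε`
    ((d = 1 → PseudoMarginal.ComparableContours π) →
      ∀ (α' β' ξw ξπ : ℝ) (ψ : ℝ → ℝ) (what : PseudoMarginal.Space d → ℝ),
        0 < α' → 1 < β' →
        0 < ξw → ξw < β' - 1 → 0 < ξπ → ξπ < β' - 1 - ξw →
        PseudoMarginal.GrowthProfile ψ →
        PseudoMarginal.LocallyBoundedGeOne what →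
        Tendsto what (Bornology.cobounded (PseudoMarginal.Space d)) atTop →
        PseudoMarginal.RejectionBalance π ψ what ξπ →
      ∀ η α β : ℝ,
        0 < η → η < min α' (min (β' - 1 - ξw) (1 - ξπ)) →
        η < α → α ≤ α' →
        1 + ξw - η < β → β < β' - η →
        η ≤ min (β' - β) 1 - ξπ →
      ∀ (c : PseudoMarginal.Space d → ℝ) (ξc : ℝ),
        PseudoMarginal.LocallyBoundedGeOne c →
        limsup (fun x => ENNReal.ofReal (c x * Real.exp (-‖x‖)))
          (Bornology.cobounded (PseudoMarginal.Space d)) < ⊤ →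
        0 < ξc → ξc < min (β' - β) (min α 1) - η - ξπ →
        limsup (fun x => ENNReal.ofReal (what x ^ ξπ / c x ^ ξc))
          (Bornology.cobounded (PseudoMarginal.Space d)) = 0 →
      ∀ (K : ℝ → ℝ≥0) (ε : ℝ → PseudoMarginal.Space d → ℝ≥0∞),
        (∀ b, 1 ≤ b → limsup (ε b) (Bornology.cobounded (PseudoMarginal.Space d)) = 0) →
      ∃ M wlo whi b δ : ℝ, 1 ≤ M ∧ 0 < wlo ∧ wlo ≤ 1 ∧ 1 ≤ whi ∧ 1 ≤ b ∧ 0 < δ ∧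
        ∀ (Q : Kernel (PseudoMarginal.Space d) PseudoMarginal.Weight) [IsMarkovKernel Q],
          PseudoMarginal.UnitMean Q →
          essSup (fun x => PseudoMarginal.moment Q α' β' x / ENNReal.ofReal (ψ (π x)))
            volume ≤ 1 →
          (∀ b', 1 < b' →
            (⨆ x : PseudoMarginal.Space d,
              PseudoMarginal.localMoment Q α' β' (b' * max ‖x‖ 1) /
                ENNReal.ofReal (what x ^ ξw)) ≤ K b') →
          (∀ b', 1 ≤ b' → ∀ x,
            PseudoMarginal.tailQuantity π q Q what c α' β' η b' x ≤ ε b' x) →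
          PseudoMarginal.PolynomialDrift π q Q η α β M wlo whi b δ) ∧
    -- simple sufficient conditions
    (∀ ρ : ℝ, 1 < ρ →
        PseudoMarginal.StrongSuperExp π ρ → PseudoMarginal.RadiallyDominated q →
      ∀ α' β' C ρ' : ℝ, 0 < α' → 1 < β' → 0 ≤ ρ' → ρ' < ρ - 1 →
      ∀ η α β : ℝ,
        0 < η → η < min α' (min (β' - 1) 1) →
        η < α → α ≤ α' →
        1 - η < β → β < β' - η →
      ∃ M wlo whi b δ : ℝ, 1 ≤ M ∧ 0 < wlo ∧ wlo ≤ 1 ∧ 1 ≤ whi ∧ 1 ≤ b ∧ 0 < δ ∧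
        ∀ (Q : Kernel (PseudoMarginal.Space d) PseudoMarginal.Weight) [IsMarkovKernel Q],
          PseudoMarginal.UnitMean Q →
          (∀ x, PseudoMarginal.moment Q α' β' x ≤ ENNReal.ofReal (C * max 1 ‖x‖ ^ ρ')) →
          PseudoMarginal.PolynomialDrift π q Q η α β M wlo whi b δ) := by
  refine ⟨?_, ?_⟩
  · intro hd α' β' ξw ξπ ψ what hα' hβ' hξw hξwβ hξπ _ hψ hwhat hwhat' hbal η α β hη hηα' hηα hαα'
      hβ _ _ c ξc hc hcexp hξc hξc' hwc K ε hε
    obtain ⟨M, wlo, whi, b, δ, hM, hwlo, hwlo1, hwhi, hb, hδ, h⟩ :=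
      PseudoMarginal.exists_polynomialDrift_of_nonuniform hπ hq hd hα' hβ' hξw hξwβ hξπ hψ hwhat
        hwhat' hbal hη hηα' hηα hαα' hβ hc hcexp hξc hξc' hwc K ε hε
    exact ⟨M, wlo, whi, b, δ, hM, hwlo, hwlo1, hwhi, hb, hδ,
      fun Q _ hQ h1 h2 h3 => h Q hQ ⟨h1, h2, h3⟩⟩
  · intro ρ hρ hs hrad α' β' C ρ' hα' hβ' hρ'0 hρ' η α β hη hη' hηα hαα' hβ hββ'
    exact PseudoMarginal.exists_polynomialDrift_of_strongSuperExp hπ hq hρ hs hrad hα' hβ' hρ'0 hρ'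
      hη (hη'.trans_le ((min_le_right _ _).trans (min_le_right _ _))) hηα hαα' hβ hββ'
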